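/- **Notation.** Let $k\ge 3$ be an integer, $e(x)=e^{2\pi i x}$, and let $\left(\frac{D}{l}\right)$ be the Kronecker symbol. For positive integers $l,f,n$ and $\xi\in\mathbb Z$ put $$Kl_{l,f}(\xi,n)=\sum_{\substack{a \bmod 4lf^2,\ f^2\mid a^2-4n\\ (a^2-4n)/f^2\equiv 0,1 \bmod 4}}\left(\frac{(a^2-4n)/f^2}{l}\right)e\!\left(\frac{a\xi}{4lf^2}\right).$$ Let $$\theta_\infty(x)=\frac{i}{2\pi}\left\{(x+\sqrt{x^2-1})^{k-1}-(x-\sqrt{x^2-1})^{k-1}\right\}\ \text{ for } |x|<1,\qquad \theta_\infty(x)=0\ \text{ otherwise},$$ $$F(x)=\frac1{2K_0(2)}\int_x^\infty e^{-y-1/y}\frac{dy}{y},\qquad H(y)=\frac{\sqrt\pi}{2\pi i}\int_{\mathrm{Re}(u)=1}\frac{\Gamma(\frac{1+u}2)}{\Gamma(\frac{2-u}2)}(\pi y)^{-u}\tilde F(u)\,du,$$ where $K_0$ is the modified Bessel function of the second kind and $\tilde F(u)=\int_0^\infty F(x)x^{u-1}dx$, and let $$I_{l,f}(\xi,n)=\int_{-1}^1\theta_\infty(x)\left\{F\!\left(\tfrac{lf^2(4n)^{-1/2}}{\sqrt{1-x^2}}\right)+\tfrac{lf^2(4n)^{-1/2}}{\sqrt{1-x^2}}H\!\left(\tfrac{lf^2(4n)^{-1/2}}{\sqrt{1-x^2}}\right)\right\}e\!\left(\tfrac{-x\xi\sqrt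 n}{2lf^2}\right)dx .$$ Let $\kappa,\alpha>0$, let $c_1,c_2>0$, and define $$S_1(n,\kappa,\alpha)=\sum_{\substack{l,f\ge1,\ \xi\in\mathbb Z\\ lf^2|\xi|\le c_1 n^{1/2+\kappa}\\ |\xi|\ge c_2 n^{1/6+\kappa+\alpha}}}\frac{Kl_{l,f}(\xi,n)}{\sqrt l}\,\frac{I_{l,f}(\xi,n)}{(lf^2)^{3/2}} .$$ **Theorem.** 1. For every real $c_3$ with $c_3^3\ge\min(1,c_1)$ there is a constant $C$, depending only on $k,\kappa,\alpha,c_1,c_2,c_3$, such that for every integer $n\ge 2$ $$|S_1(n,\kappa,\alpha)|\le C\,\frac{\log n}{n^{(3-2\kappa)/4}}\sum_{\substack{d_0\ge1,\ d_0^2\mid n\\ d_0\le c_3 n^{(1+2\kappa)/6}}}\left(\frac{\log n}{d_0^{1/2}}+\frac{n^{\frac{1-2(\kappa+3\alpha)}4}}{d_0^{3/2}}\right).$$ 2. There is a constant $C$, depending only on $k,\kappa,\alpha,c_1,c_2$, such that for every real $X\ge2$ $$\Bigl|\sum_{1\le n<X}\sqrt n\,S_1(n,\kappa,\alpha)\Bigr|\le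 C\left(\log^2(X)\,X^{\frac{3+2\kappa}4}+\log(X)\,X^{1-\frac{3\alpha}2}\right).$$ -/

import Mathlib

namespace BeyondEndoscopy

noncomputable section

/-- The Kronecker symbol `(D / l)` for an integer `D` and a positive integer `l`. On the odd part of
`l` it is the Jacobi symbol; `(D / 2)` is `0`, `1`, `-1` according to whether `D` is even,
`D ≡ ±1 mod 8`, or `D ≡ ±3 mod 8`. -/
def kronecker (D : ℤ) (l : ℕ) : ℤ :=
  ZMod.χ₈ (D : ZMod 8) ^ padicValNat 2 l * jacobiSym D (l / 2 ^ padicValNat 2 l)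

/-- `e(x) = exp (2 π i x)`. -/
def e (x : ℝ) : ℂ := Complex.exp (2 * Real.pi * Complex.I * x)

/-- The character sum
`Kl_{l,f}(ξ,n) = ∑ ((a² - 4n)/f² / l) e(aξ / (4lf²))`, over `a mod 4lf²` with `f² ∣ a² - 4n` and
`(a² - 4n)/f² ≡ 0, 1 mod 4`. -/
def Kl (l f : ℕ) (ξ : ℤ) (n : ℕ) : ℂ :=
  ∑ a ∈ (Finset.range (4 * l * f ^ 2)).filter (fun a : ℕ =>
      (f : ℤ) ^ 2 ∣ (a : ℤ) ^ 2 - 4 * n ∧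
        (((a : ℤ) ^ 2 - 4 * n) / (f : ℤ) ^ 2 ≡ 0 [ZMOD 4] ∨
          ((a : ℤ) ^ 2 - 4 * n) / (f : ℤ) ^ 2 ≡ 1 [ZMOD 4])),
    (kronecker (((a : ℤ) ^ 2 - 4 * n) / (f : ℤ) ^ 2) l : ℂ) *
      e ((a : ℝ) * ξ / (4 * l * f ^ 2))

/-- The archimedean function attached to the weight `k`. -/
def thetaInf (k : ℕ) (x : ℝ) : ℂ :=
  if |x| < 1 then
    Complex.I / (2 * Real.pi) *
      (((x : ℂ) + Complex.sqrt ((x : ℂ) ^ 2 - 1)) ^ (k - 1) -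
        ((x : ℂ) - Complex.sqrt ((x : ℂ) ^ 2 - 1)) ^ (k - 1))
  else 0

/-- The modified Bessel function of the second kind of order zero,
`K_0(z) = ∫_0^∞ exp (-z cosh t) dt` for `z > 0`. -/
def besselK0 (z : ℝ) : ℝ := ∫ t in Set.Ioi (0 : ℝ), Real.exp (-z * Real.cosh t)

/-- `F(x) = (2 K_0(2))⁻¹ ∫_x^∞ exp (-y - 1/y) dy/y`. -/
def F (x : ℝ) : ℝ :=
  1 / (2 * besselK0 2) * ∫ y in Set.Ioi x, Real.exp (-y - 1 / y) / y

/-- `H(y) = (√π / 2πi) ∫_{(1)} Γ((1+u)/2) / Γ((2-u)/2) (πy)^{-u} F̃(u) du`, where `F̃` is the Mellin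
transform of `F`; note that `mellinInv` carries the factor `1 / 2πi`. -/
def H (y : ℝ) : ℂ :=
  (Real.sqrt Real.pi : ℂ) *
    mellinInv 1 (fun u : ℂ => Complex.Gamma ((1 + u) / 2) / Complex.Gamma ((2 - u) / 2) *
      mellin (fun x : ℝ => (F x : ℂ)) u) (Real.pi * y)

/-- The Fourier transform `I_{l,f}(ξ,n)`. -/
def fourierI (k l f : ℕ) (ξ : ℤ) (n : ℕ) : ℂ :=
  ∫ x in (-1 : ℝ)..1,
    thetaInf k x *
      ((F ((l * f ^ 2 : ℝ) * (4 * n : ℝ) ^ (-(1 / 2) : ℝ) / Real.sqrt (1 - x ^ 2)) : ℂ) +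
        (((l * f ^ 2 : ℝ) * (4 * n : ℝ) ^ (-(1 / 2) : ℝ) / Real.sqrt (1 - x ^ 2) : ℝ) : ℂ) *
          H ((l * f ^ 2 : ℝ) * (4 * n : ℝ) ^ (-(1 / 2) : ℝ) / Real.sqrt (1 - x ^ 2))) *
      e (-x * ξ * Real.sqrt n / (2 * (l * f ^ 2)))

/-- The triples `(l, f, ξ)`, with `l, f` positive integers and `ξ` an integer, such that
`l f² |ξ| ≤ c₁ n^{1/2+κ}` and `|ξ| ≥ c₂ n^{1/6+κ+α}`. -/
def rangeSet (n : ℕ) (κ α c₁ c₂ : ℝ) : Set (ℕ × ℕ × ℤ) :=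
  {p | 0 < p.1 ∧ 0 < p.2.1 ∧
    (p.1 : ℝ) * (p.2.1 : ℝ) ^ 2 * |(p.2.2 : ℝ)| ≤ c₁ * (n : ℝ) ^ (1 / 2 + κ : ℝ) ∧
    c₂ * (n : ℝ) ^ (1 / 6 + κ + α : ℝ) ≤ |(p.2.2 : ℝ)|}

/-- The sum `S₁(n, κ, α)` attached to the weight `k`, where `c₁` and `c₂` are the constants in the
range of summation `l f² ξ ≪ n^{1/2+κ}`, `ξ ≫ n^{1/6+κ+α}`. -/
def S1 (k n : ℕ) (κ α c₁ c₂ : ℝ) : ℂ :=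
  ∑ᶠ p ∈ rangeSet n κ α c₁ c₂,
    Kl p.1 p.2.1 p.2.2 n / (Real.sqrt p.1 : ℂ) *
      (fourierI k p.1 p.2.1 p.2.2 n /
        ((((p.1 : ℝ) * (p.2.1 : ℝ) ^ 2) ^ (3 / 2 : ℝ) : ℝ) : ℂ))

/-- The range of summation is finite, so that `S1` is a genuine finite sum. -/
theorem rangeSet_finite (n : ℕ) (hn : 0 < n) (κ α c₁ c₂ : ℝ) (hc₂ : 0 < c₂) :
    (rangeSet n κ α c₁ c₂).Finite := by
  set N : ℕ := ⌈c₁ * (n : ℝ) ^ (1 / 2 + κ : ℝ)⌉₊ with hN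
  refine Set.Finite.subset
    ((Finset.Icc 0 N ×ˢ (Finset.Icc 0 N ×ˢ Finset.Icc (-(N : ℤ)) N)).finite_toSet) ?_
  rintro ⟨l, f, ξ⟩ ⟨hl, hf, h1, h2⟩
  simp only at hl hf h1 h2
  have hn' : (0 : ℝ) < n := by exact_mod_cast hn
  have hpos : 0 < |(ξ : ℝ)| := lt_of_lt_of_le (by positivity) h2
  have hξ : 0 < |ξ| := by
    have : (0 : ℝ) < ((|ξ| : ℤ) : ℝ) := by rwa [Int.cast_abs]
    exact_mod_cast this
  have h3 : ((l * f ^ 2 * ξ.natAbs : ℕ) : ℝ) ≤ (N : ℝ) := by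
    refine le_trans ?_ (Nat.le_ceil _)
    push_cast
    rw [Nat.cast_natAbs, Int.cast_abs]
    exact h1
  have h4 : l * f ^ 2 * ξ.natAbs ≤ N := by exact_mod_cast h3
  have hξ1 : 1 ≤ ξ.natAbs := Int.natAbs_pos.mpr (abs_pos.mp hξ)
  have hf2 : 1 ≤ f ^ 2 := Nat.one_le_pow _ _ hf
  have a1 : l ≤ l * f ^ 2 * ξ.natAbs := by
    rw [mul_assoc]; exact Nat.le_mul_of_pos_right _ (by positivity)
  have a2 : f ≤ l * f ^ 2 * ξ.natAbs := by
    calc f ≤ f ^ 2 := by nlinarith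
      _ ≤ l * f ^ 2 := Nat.le_mul_of_pos_left _ hl
      _ ≤ _ := Nat.le_mul_of_pos_right _ hξ1
  have a3 : ξ.natAbs ≤ l * f ^ 2 * ξ.natAbs := Nat.le_mul_of_pos_left _ (by positivity)
  simp only [Finset.coe_product, Set.mem_prod, Finset.mem_coe, Finset.mem_Icc]
  omega

/-- The positive integers `d` with `d² ∣ n` and `d ≤ c₃ n^{(1+2κ)/6}`. -/
def squareDivisors (n : ℕ) (κ c₃ : ℝ) : Finset ℕ :=
  n.divisors.filter (fun d => d ^ 2 ∣ n ∧ (d : ℝ) ≤ c₃ * (n : ℝ) ^ ((1 + 2 * κ) / 6 : ℝ))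

end

end BeyondEndoscopy

/-! ### Weighted exponential sums over a complete residue system -/

namespace BeyondEndoscopy

/-! Both assertions follow from one estimate for a single `n`, `exists_norm_S1_le`: up to a
constant, |S₁(n)| is at most n^{-3/4} (1 + log n)² (1 + n^{1/4 - 3κ/2 - 3α}). The only arithmetic
used about `Kl` is that it is a sum over a mod q = 4lf² of e(aξ/q) with coefficients c_a of modulus
at most 1 that do not depend on ξ (`exists_Kl_eq`). The saving comes from summing over ξ before
integrating over x.

Fix l, f and put λ = √n/(2lf²). For ξ = ±j with j ≥ Ξ, the sum of the products Kl·I is the integral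
over [-1, 1] of an amplitude against Σ_a c_a Σ_j e(±j(a/q - λx)), a combination of Dirichlet
kernels. An r-th antiderivative in x is the same sum with weights j^{-r}, up to a factor of modulus
(2πλ)^{-r}. As a varies, the points a/q - λx are equally spaced on the circle, so Abel summation
controls the sum over a of the absolute values (`sum_norm_expSum_le`). Up to logarithms the first
antiderivative is at most λ^{-1}(1 + q/Ξ) and the second at most λ^{-2} Ξ^{-1}(1 + q/Ξ).

The amplitude is √(1 - x²) times a polynomial times φ(log A - log √(1 - x²)), where φ and its first
two derivatives are bounded (`exists_F_add_mul_H_eq`). This holds because the Mellin transform of F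
decays faster than any power on Re u = 1, while the Gamma quotient grows at most linearly. One
integration by parts within δ of ±1 and two in between (`norm_integral_mul_le_of_sqrt_singularity`),
with δ of order 1/(λΞ), bound the integral by λ^{-3/2} Ξ^{-1/2}(1 + q/Ξ) up to logarithms.

Since λ^{-3/2} is a constant times n^{-3/4}(lf²)^{3/2}, the denominator (lf²)^{3/2} cancels. The
remaining sum of l^{-1/2} over lf² ≤ L = c₁n^{1/2+κ}/Ξ costs √L and a logarithm, and L/Ξ is a
constant times n^{1/6-κ-2α}.

For the first assertion the term d₀ = 1 is already large enough; the condition on c₃ makes the range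
of summation empty whenever d₀ = 1 is excluded. For the second assertion the individual bounds are
added over n in absolute value. -/

theorem e_add (x y : ℝ) : e (x + y) = e x * e y := by
  simp only [e]
  rw [← Complex.exp_add]
  congr 1
  push_cast
  ring

theorem e_eq_exp_mul_I (x : ℝ) : e x = Complex.exp (((2 * Real.pi * x : ℝ) : ℂ) * Complex.I) := by
  simp only [e]
  congr 1
  push_cast
  ring

theorem norm_e (x : ℝ) : ‖e x‖ = 1 := by
  rw [e_eq_exp_mul_I, Complex.norm_exp_ofReal_mul_I]

theorem e_nat_mul (j : ℕ) (x : ℝ) : e (j * x) = e x ^ j := by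
  simp only [e]
  rw [← Complex.exp_nat_mul]
  congr 1
  push_cast
  ring

theorem e_neg (x : ℝ) : e (-x) = (starRingEnd ℂ) (e x) := by
  simp only [e]
  rw [← Complex.exp_conj]
  congr 1
  simp [Complex.conj_ofNat]

theorem e_int (z : ℤ) : e z = 1 := by
  simp only [e]
  rw [Complex.exp_eq_one_iff]
  exact ⟨z, by push_cast; ring⟩

theorem norm_one_sub_e (y : ℝ) : ‖1 - e y‖ = 2 * |Real.sin (Real.pi * y)| := by
  rw [norm_sub_rev, e_eq_exp_mul_I, mul_comm, Complex.norm_exp_I_mul_ofReal_sub_one, norm_mul,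
    Real.norm_eq_abs, Real.norm_eq_abs, abs_of_pos (by norm_num : (0 : ℝ) < 2)]
  congr 3
  ring

/-- Multiplication by `1 - z` turns a power sum with monotone weights into a telescoping one. -/
theorem norm_one_sub_mul_sum_le (w : ℕ → ℝ) (hw : Antitone w) (h0 : ∀ i, 0 ≤ w i) (z : ℂ)
    (hz : ‖z‖ = 1) (N : ℕ) :
    ‖(1 - z) * ∑ i ∈ Finset.range N, (w i : ℂ) * z ^ i‖ ≤ 2 * w 0 := by
  -- With the boundary term `w N * z ^ N` added, passing from `N` to `N + 1` changes the expression
  -- by exactly `(w N - w (N + 1)) z ^ (N + 1)`, so the changes telescope.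
  have key : ∀ N : ℕ, ‖(1 - z) * (∑ i ∈ Finset.range N, (w i : ℂ) * z ^ i) + w N * z ^ N‖
      ≤ w 0 + (w 0 - w N) := by
    intro N
    induction N with
    | zero => simp [abs_of_nonneg (h0 0)]
    | succ N ih =>
      have : (1 - z) * (∑ i ∈ Finset.range (N + 1), (w i : ℂ) * z ^ i) + w (N + 1) * z ^ (N + 1)
        = ((1 - z) * (∑ i ∈ Finset.range N, (w i : ℂ) * z ^ i) + w N * z ^ N)
          - ((w N - w (N + 1) : ℝ) : ℂ) * z ^ (N + 1) := by
        rw [Finset.sum_range_succ]; push_cast; ring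
      rw [this]
      refine (norm_sub_le _ _).trans ?_
      rw [norm_mul, norm_pow, hz, one_pow, mul_one, Complex.norm_real, Real.norm_eq_abs,
        abs_of_nonneg (sub_nonneg.2 (hw (Nat.le_succ N)))]
      linarith
  have h1 : (1 - z) * ∑ i ∈ Finset.range N, (w i : ℂ) * z ^ i =
      ((1 - z) * (∑ i ∈ Finset.range N, (w i : ℂ) * z ^ i) + w N * z ^ N) - w N * z ^ N := by ring
  rw [h1]
  refine (norm_sub_le _ _).trans ?_
  have h2 := key N
  rw [norm_mul (w N : ℂ), norm_pow, hz, one_pow, mul_one, Complex.norm_real, Real.norm_eq_abs,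
    abs_of_nonneg (h0 N)]
  linarith

/-- The weighted exponential sum `∑_{A ≤ j < B} e(jy) / j^r`. -/
noncomputable def expSum (A B r : ℕ) (y : ℝ) : ℂ :=
  ∑ j ∈ Finset.Ico A B, (((j : ℝ) ^ r)⁻¹ : ℝ) * e (j * y)

theorem expSum_neg (A B r : ℕ) (y : ℝ) : ‖expSum A B r (-y)‖ = ‖expSum A B r y‖ := by
  have : expSum A B r (-y) = (starRingEnd ℂ) (expSum A B r y) := by
    simp only [expSum, map_sum, map_mul, Complex.conj_ofReal, ← e_neg, mul_neg]
  rw [this, RCLike.norm_conj]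

theorem expSum_add_int (A B r : ℕ) (y : ℝ) (z : ℤ) : expSum A B r (y + z) = expSum A B r y := by
  simp only [expSum]
  refine Finset.sum_congr rfl fun j _ => ?_
  rw [mul_add, e_add]
  have : e ((j : ℝ) * (z : ℝ)) = 1 := by
    have := e_int (j * z)
    push_cast at this
    exact this
  rw [this, mul_one]

theorem norm_expSum_le_sum (A B r : ℕ) (y : ℝ) :
    ‖expSum A B r y‖ ≤ ∑ j ∈ Finset.Ico A B, ((j : ℝ) ^ r)⁻¹ := by
  refine (norm_sum_le _ _).trans (Finset.sum_le_sum fun j _ => ?_)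
  rw [norm_mul, norm_e, mul_one, Complex.norm_real, Real.norm_eq_abs, abs_of_nonneg (by positivity)]

/-- Abel summation with the decreasing weights j^{-r}: away from integers y the sum is as small as
its first weight divided by the distance of e(y) from 1, whatever its length. -/
theorem norm_one_sub_mul_expSum_le {A : ℕ} (hA : 0 < A) (B r : ℕ) (y : ℝ) :
    ‖1 - e y‖ * ‖expSum A B r y‖ ≤ 2 * ((A : ℝ) ^ r)⁻¹ := by
  have h := norm_one_sub_mul_sum_le (fun i => (((A + i : ℕ) : ℝ) ^ r)⁻¹)
    (fun i j hij => by
      have : 0 < ((A + i : ℕ) : ℝ) := by exact_mod_cast Nat.add_pos_left hA i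
      simp only
      gcongr) (fun i => by positivity) (e y) (norm_e y) (B - A)
  have h2 : expSum A B r y = e y ^ A * ∑ i ∈ Finset.range (B - A),
      (((((A + i : ℕ) : ℝ) ^ r)⁻¹ : ℝ) : ℂ) * e y ^ i := by
    rw [expSum, Finset.sum_Ico_eq_sum_range, Finset.mul_sum]
    refine Finset.sum_congr rfl fun i _ => ?_
    rw [e_nat_mul, pow_add]
    ring
  rw [h2, norm_mul, norm_pow, norm_e, one_pow, one_mul, ← norm_mul]
  simpa using h

theorem four_mul_min_le_norm_one_sub_e {y : ℝ} (h0 : 0 ≤ y) (h1 : y ≤ 1) :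
    4 * min y (1 - y) ≤ ‖1 - e y‖ := by
  rw [norm_one_sub_e]
  have hpi := Real.pi_pos
  have key : ∀ u : ℝ, 0 ≤ u → u ≤ 1 / 2 → 2 * u ≤ Real.sin (Real.pi * u) := by
    intro u hu hu2
    have := Real.mul_le_sin (x := Real.pi * u) (by positivity) (by nlinarith)
    calc 2 * u = 2 / Real.pi * (Real.pi * u) := by field_simp
      _ ≤ _ := this
  rcases le_total y (1 / 2) with h | h
  · have := key y h0 h
    have h3 := min_le_left y (1 - y)
    have h4 := le_abs_self (Real.sin (Real.pi * y))
    linarith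
  · have := key (1 - y) (by linarith) (by linarith)
    rw [show Real.pi * (1 - y) = Real.pi - Real.pi * y by ring, Real.sin_pi_sub] at this
    have h3 := min_le_right y (1 - y)
    have h4 := le_abs_self (Real.sin (Real.pi * y))
    linarith

/-- The term `a = 0` is harmless because `0⁻¹ = 0`; this is what lets the endpoint terms be carried
along in `sum_norm_expSum_le`. -/
theorem sum_range_inv_le (q : ℕ) (hq : 0 < q) :
    ∑ a ∈ Finset.range q, ((a : ℝ))⁻¹ ≤ 1 + Real.log q := by
  obtain ⟨p, rfl⟩ : ∃ p, q = p + 1 := ⟨q - 1, by omega⟩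
  rw [Finset.sum_range_succ']
  have h := harmonic_le_one_add_log p
  simp only [harmonic, Rat.cast_sum] at h
  push_cast at h ⊢
  have h3 : Real.log p ≤ Real.log (p + 1) := by
    rcases Nat.eq_zero_or_pos p with rfl | hp
    · simp
    · exact Real.log_le_log (by exact_mod_cast hp) (by linarith)
  simp
  linarith

/-- Sums of an `ℓ¹` type over a complete set of residues, uniformly in a shift. -/
theorem sum_norm_expSum_le {A : ℕ} (hA : 0 < A) (B r : ℕ) {q : ℕ} (hq : 0 < q) {W : ℝ}
    (hW : ∀ y, ‖expSum A B r y‖ ≤ W) (y₀ : ℝ) :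
    ∑ a ∈ Finset.range q, ‖expSum A B r (a / q + y₀)‖ ≤
      2 * W + ((A : ℝ) ^ r)⁻¹ * q * (1 + Real.log q) := by
  have hq' : (0 : ℝ) < q := by exact_mod_cast hq
  have hW0 : 0 ≤ W := (norm_nonneg _).trans (hW 0)
  set w : ℝ := ((A : ℝ) ^ r)⁻¹ with hw
  set g : ℤ → ℝ → ℝ := fun a θ => ‖expSum A B r ((a + θ) / q)‖ with hg
  have per : ∀ a θ, g (a + q) θ = g a θ := by
    intro a θ
    simp only [hg]
    rw [← expSum_add_int A B r ((a + θ) / q) 1]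
    congr 2
    push_cast
    field_simp
    ring
  have step : ∀ (s : ℤ) (θ : ℝ), ∑ a ∈ Finset.range q, g (a + (s + 1)) θ =
      ∑ a ∈ Finset.range q, g (a + s) θ := by
    intro s θ
    have h1 := Finset.sum_range_succ (fun a : ℕ => g (a + s) θ) q
    have h2 := Finset.sum_range_succ' (fun a : ℕ => g (a + s) θ) q
    rw [h1] at h2
    have h3 : g ((q : ℕ) + s) θ = g ((0 : ℕ) + s) θ := by
      rw [add_comm, per]; simp
    rw [h3] at h2
    have h4 := add_right_cancel h2
    rw [h4]
    refine Finset.sum_congr rfl fun a _ => ?_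
    push_cast
    congr 1
    ring
  have shift : ∀ (s : ℤ) (θ : ℝ), ∑ a ∈ Finset.range q, g (a + s) θ =
      ∑ a ∈ Finset.range q, g a θ := by
    intro s θ
    induction s using Int.induction_on with
    | zero => simp
    | succ i ih => rw [step, ih]
    | pred i ih =>
      rw [← ih, ← step (-(i : ℤ) - 1) θ]
      simp
  -- By periodicity in a the shift y₀ may be replaced by θ/q with 0 ≤ θ < 1. The a-th point then
  -- lies at least a/q above 0 and at least (q - 1 - a)/q below 1.
  set s := ⌊(q : ℝ) * y₀⌋ with hs
  set θ := Int.fract ((q : ℝ) * y₀) with hθ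
  have hy : (q : ℝ) * y₀ = s + θ := (Int.floor_add_fract _).symm
  have h1 : ∑ a ∈ Finset.range q, ‖expSum A B r (a / q + y₀)‖ =
      ∑ a ∈ Finset.range q, g a θ := by
    rw [← shift s θ]
    refine Finset.sum_congr rfl fun a _ => ?_
    simp only [hg]
    congr 2
    field_simp
    rw [hy]
    push_cast
    ring
  have hθ0 : 0 ≤ θ := Int.fract_nonneg _
  have hθ1 : θ < 1 := Int.fract_lt_one _
  -- Only the points `a = 0` and `a = q - 1` can be arbitrarily close to an integer, and they take
  -- the trivial bound `W`. This is the source of `2 * W`; all other points use Abel summation.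
  have hb : ∀ a ∈ Finset.range q, g a θ ≤ ((if a = 0 then W else 0) +
      (if a = q - 1 then W else 0)) +
      w * q / 2 * ((a : ℝ)⁻¹ + ((q - 1 - a : ℕ) : ℝ)⁻¹) := by
    intro a ha
    have haq : a < q := Finset.mem_range.1 ha
    have hpos : 0 ≤ w * q / 2 * ((a : ℝ)⁻¹ + ((q - 1 - a : ℕ) : ℝ)⁻¹) := by positivity
    by_cases h : a = 0
    · have := hW (((a : ℤ) + θ) / q)
      rw [if_pos h]
      have : 0 ≤ (if a = q - 1 then W else 0) := by split_ifs <;> simp [hW0]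
      simp only [hg]
      linarith
    by_cases h' : a = q - 1
    · have := hW (((a : ℤ) + θ) / q)
      rw [if_pos h', if_neg h]
      simp only [hg]
      linarith
    rw [if_neg h, if_neg h', add_zero, zero_add]
    have hb0 : (0 : ℝ) < ((q - 1 - a : ℕ) : ℝ) := by
      exact_mod_cast (by omega : 0 < q - 1 - a)
    have hcast : ((q - 1 - a : ℕ) : ℝ) = q - 1 - a := by
      rw [Nat.cast_sub (by omega), Nat.cast_sub (by omega)]; simp
    set y : ℝ := ((a : ℤ) + θ) / q with hydef
    have hya : (a : ℝ) / q ≤ y := by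
      rw [hydef]; push_cast; gcongr; linarith
    have hyb : ((q - 1 - a : ℕ) : ℝ) / q ≤ 1 - y := by
      rw [hydef, hcast, div_le_iff₀ hq', sub_mul, div_mul_cancel₀ _ hq'.ne']
      push_cast
      linarith
    have hy0 : 0 < y := lt_of_lt_of_le (by positivity) hya
    have hy1 : 0 < 1 - y := lt_of_lt_of_le (by positivity) hyb
    have h4 := four_mul_min_le_norm_one_sub_e hy0.le (by linarith)
    have h5 := norm_one_sub_mul_expSum_le hA B r y
    have hmin : 0 < min y (1 - y) := lt_min hy0 hy1
    have h6 : ‖expSum A B r y‖ ≤ w / 2 * (min y (1 - y))⁻¹ := by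
      rw [← div_eq_mul_inv, le_div_iff₀ hmin]
      have := mul_le_mul_of_nonneg_right h4 (norm_nonneg (expSum A B r y))
      linarith
    have h7 : (min y (1 - y))⁻¹ ≤ q * ((a : ℝ)⁻¹ + ((q - 1 - a : ℕ) : ℝ)⁻¹) := by
      have i1 : y⁻¹ ≤ q * (a : ℝ)⁻¹ := by
        rw [← div_eq_mul_inv, ← inv_div]
        exact inv_anti₀ (by positivity) hya
      have i2 : (1 - y)⁻¹ ≤ q * ((q - 1 - a : ℕ) : ℝ)⁻¹ := by
        rw [← div_eq_mul_inv, ← inv_div]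
        exact inv_anti₀ (by positivity) hyb
      have i3 : 0 ≤ q * (a : ℝ)⁻¹ := by positivity
      have i4 : 0 ≤ q * ((q - 1 - a : ℕ) : ℝ)⁻¹ := by positivity
      rw [mul_add]
      rcases min_choice y (1 - y) with h | h <;> rw [h] <;> linarith
    calc g a θ = ‖expSum A B r y‖ := rfl
      _ ≤ w / 2 * (min y (1 - y))⁻¹ := h6
      _ ≤ w / 2 * (q * ((a : ℝ)⁻¹ + ((q - 1 - a : ℕ) : ℝ)⁻¹)) := by gcongr
      _ = _ := by ring
  rw [h1]
  refine (Finset.sum_le_sum hb).trans ?_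
  rw [Finset.sum_add_distrib, Finset.sum_add_distrib, ← Finset.mul_sum, Finset.sum_add_distrib,
    Finset.sum_ite_eq', Finset.sum_ite_eq', if_pos (Finset.mem_range.2 hq),
    if_pos (Finset.mem_range.2 (by omega)), Finset.sum_range_reflect (fun a : ℕ => (a : ℝ)⁻¹) q]
  have := sum_range_inv_le q hq
  have h8 : w * q / 2 * (∑ a ∈ Finset.range q, (a : ℝ)⁻¹ + ∑ a ∈ Finset.range q, (a : ℝ)⁻¹) ≤
      w * q * (1 + Real.log q) := by
    calc _ = w * q * ∑ a ∈ Finset.range q, (a : ℝ)⁻¹ := by ring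
      _ ≤ _ := by gcongr
  linarith

theorem norm_expSum_one_le (A : ℕ) {B : ℕ} (hB : 0 < B) (y : ℝ) :
    ‖expSum A B 1 y‖ ≤ 1 + Real.log B := by
  refine (norm_expSum_le_sum A B 1 y).trans ((Finset.sum_le_sum_of_subset_of_nonneg
    (fun j hj => Finset.mem_range.2 (Finset.mem_Ico.1 hj).2)
    (fun _ _ _ => by positivity)).trans ?_)
  simpa using sum_range_inv_le B hB

theorem norm_expSum_two_le {A : ℕ} (hA : 0 < A) (B : ℕ) (y : ℝ) :
    ‖expSum A B 2 y‖ ≤ 2 * (A : ℝ)⁻¹ := by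
  refine (norm_expSum_le_sum A B 2 y).trans ?_
  have := sum_Ioo_inv_sq_le (α := ℝ) (A - 1) B
  have h2 : Finset.Ioo (A - 1) B = Finset.Ico A B := by
    ext j; simp only [Finset.mem_Ioo, Finset.mem_Ico]; omega
  rw [h2, Nat.cast_sub hA] at this
  simpa [div_eq_mul_inv] using this

end BeyondEndoscopy

/-! ### Oscillatory integrals with square root singularities at the endpoints -/

open MeasureTheory Set in
/-- A bound for an oscillatory integral over `[-1, 1]` of a function with square root singularities
at both ends, in terms of bounds for the first and second antiderivative of the oscillating
factor. -/
theorem BeyondEndoscopy.norm_integral_mul_le_of_sqrt_singularity {G G₁ G₂ h h₁ h₂ : ℝ → ℂ}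
    {K M₁ M₂ δ : ℝ}
    (hG : ∀ x ∈ Ioo (-1 : ℝ) 1, HasDerivAt G (G₁ x) x)
    (hG₁ : ∀ x ∈ Ioo (-1 : ℝ) 1, HasDerivAt G₁ (G₂ x) x)
    (hG₂ : ContinuousOn G₂ (Ioo (-1 : ℝ) 1))
    (bG : ∀ x ∈ Icc (-1 : ℝ) 1, ‖G x‖ ≤ K * √(1 - x ^ 2))
    (bG₁ : ∀ x ∈ Ioo (-1 : ℝ) 1, ‖G₁ x‖ ≤ K / √(1 - x ^ 2))
    (bG₂ : ∀ x ∈ Ioo (-1 : ℝ) 1, ‖G₂ x‖ ≤ K / √(1 - x ^ 2) ^ 3)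
    (hh : Continuous h) (hh₁ : ∀ x, HasDerivAt h₁ (h x) x) (hh₂ : ∀ x, HasDerivAt h₂ (h₁ x) x)
    (bh₁ : ∀ x, ‖h₁ x‖ ≤ M₁) (bh₂ : ∀ x, ‖h₂ x‖ ≤ M₂) (hδ : 0 < δ) (hδ' : δ ≤ 1 / 2) :
    ‖∫ x in (-1 : ℝ)..1, G x * h x‖ ≤ K * (8 * √δ * M₁ + 4 * M₂ / √δ) := by
  have hK : 0 ≤ K := by
    have := (norm_nonneg _).trans (bG 0 (by norm_num))
    simpa using this
  have hM₁ : 0 ≤ M₁ := (norm_nonneg _).trans (bh₁ 0)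
  have hM₂ : 0 ≤ M₂ := (norm_nonneg _).trans (bh₂ 0)
  have ch₁ : Continuous h₁ := continuous_iff_continuousAt.2 fun x => (hh₁ x).continuousAt
  have ch₂ : Continuous h₂ := continuous_iff_continuousAt.2 fun x => (hh₂ x).continuousAt
  have wpos : ∀ x ∈ Ioo (-1 : ℝ) 1, 0 < 1 - x ^ 2 := fun x hx => by nlinarith [hx.1, hx.2]
  -- endpoint values
  have hG1 : G 1 = 0 := by
    have := bG 1 (by norm_num)
    simpa using this
  have hGm1 : G (-1) = 0 := by
    have := bG (-1) (by norm_num)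
    simpa using this
  have cG : ContinuousOn G (Icc (-1 : ℝ) 1) := by
    have hw : ContinuousOn (fun x : ℝ => K * √(1 - x ^ 2)) (Icc (-1 : ℝ) 1) := by fun_prop
    intro x hx
    by_cases hx' : x ∈ Ioo (-1 : ℝ) 1
    · exact (hG x hx').continuousAt.continuousWithinAt
    · have h1 : K * √(1 - x ^ 2) = 0 := by
        have : x = -1 ∨ x = 1 := by
          by_contra hcon
          push Not at hcon
          exact hx' ⟨lt_of_le_of_ne hx.1 (Ne.symm hcon.1), lt_of_le_of_ne hx.2 hcon.2⟩
        rcases this with rfl | rfl <;> simp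
      have h2 : G x = 0 := by
        have := bG x hx
        rw [h1] at this
        simpa using this
      have h3 : Filter.Tendsto (fun x : ℝ => K * √(1 - x ^ 2)) (nhdsWithin x (Icc (-1) 1))
        (nhds (K * √(1 - x ^ 2))) := hw x hx
      unfold ContinuousWithinAt
      rw [h1] at h3
      rw [h2]
      exact squeeze_zero_norm' (by filter_upwards [self_mem_nhdsWithin] with y hy using bG y hy) h3
  -- the majorant of `1 / √(1 - x²)` and its antiderivative
  set v : ℝ → ℝ := fun x => 1 / √(1 - x) + 1 / √(1 + x) with hv
  set V : ℝ → ℝ := fun x => 2 * √(1 + x) - 2 * √(1 - x) with hV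
  have cV : Continuous V := by fun_prop
  have dV : ∀ x ∈ Ioo (-1 : ℝ) 1, HasDerivAt V (v x) x := by
    intro x hx
    have h1 : (0 : ℝ) < 1 - x := by linarith [hx.2]
    have h2 : (0 : ℝ) < 1 + x := by linarith [hx.1]
    have e1 := (((hasDerivAt_id x).const_sub 1).sqrt (by simpa using h1.ne')).const_mul 2
    have e2 := (((hasDerivAt_id x).const_add 1).sqrt (by simpa using h2.ne')).const_mul 2
    have e3 := e2.sub e1
    refine e3.congr_deriv ?_
    simp only [hv, id]
    field_simp
    ring
  have vpos : ∀ x, 0 ≤ v x := fun x => by simp only [hv]; positivity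
  have intv : ∀ a b : ℝ, -1 ≤ a → a ≤ b → b ≤ 1 → IntervalIntegrable v volume a b := by
    intro a b ha hab hb
    refine intervalIntegral.intervalIntegrable_deriv_of_nonneg cV.continuousOn
      (fun x hx => dV x ?_) (fun x _ => vpos x)
    rw [min_eq_left hab, max_eq_right hab] at hx
    exact ⟨by linarith [hx.1], by linarith [hx.2]⟩
  have valv : ∀ a b : ℝ, -1 ≤ a → a ≤ b → b ≤ 1 → ∫ x in a..b, v x = V b - V a := by
    intro a b ha hab hb
    exact intervalIntegral.integral_eq_sub_of_hasDerivAt_of_le hab cV.continuousOn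
      (fun x hx => dV x ⟨by linarith [hx.1], by linarith [hx.2]⟩) (intv a b ha hab hb)
  have wv : ∀ x ∈ Ioo (-1 : ℝ) 1, 1 / √(1 - x ^ 2) ≤ v x := by
    intro x hx
    have h1 : (0 : ℝ) < 1 - x := by linarith [hx.2]
    have h2 : (0 : ℝ) < 1 + x := by linarith [hx.1]
    have p1 : 0 ≤ 1 / √(1 - x) := by positivity
    have p2 : 0 ≤ 1 / √(1 + x) := by positivity
    rcases le_total 0 x with h0 | h0
    · have : 1 / √(1 - x ^ 2) ≤ 1 / √(1 - x) := by
        apply one_div_le_one_div_of_le (Real.sqrt_pos.2 h1)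
        exact Real.sqrt_le_sqrt (by nlinarith)
      simp only [hv]; linarith
    · have : 1 / √(1 - x ^ 2) ≤ 1 / √(1 + x) := by
        apply one_div_le_one_div_of_le (Real.sqrt_pos.2 h2)
        exact Real.sqrt_le_sqrt (by nlinarith)
      simp only [hv]; linarith
  have bG₁v : ∀ x ∈ Ioo (-1 : ℝ) 1, ‖G₁ x‖ ≤ K * v x := fun x hx =>
    (bG₁ x hx).trans (by
      have := mul_le_mul_of_nonneg_left (wv x hx) hK
      rwa [mul_one_div] at this)
  have cG₁ : ContinuousOn G₁ (Ioo (-1 : ℝ) 1) := fun x hx =>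
    (hG₁ x hx).continuousAt.continuousWithinAt
  have intG₁ : ∀ a b : ℝ, -1 ≤ a → a ≤ b → b ≤ 1 → IntervalIntegrable G₁ volume a b := by
    intro a b ha hab hb
    rw [intervalIntegrable_iff_integrableOn_Ioo_of_le hab]
    have h1 : IntegrableOn (fun x => K * v x) (Ioo a b) :=
      (((intv a b ha hab hb).const_mul K).1).mono_set Ioo_subset_Ioc_self
    have hsub : Ioo a b ⊆ Ioo (-1 : ℝ) 1 := Ioo_subset_Ioo ha hb
    refine h1.mono' ((cG₁.mono hsub).aestronglyMeasurable measurableSet_Ioo) ?_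
    filter_upwards [ae_restrict_mem measurableSet_Ioo] with x hx using bG₁v x (hsub hx)
  have edge : ∀ a b : ℝ, -1 ≤ a → a ≤ b → b ≤ 1 →
      ‖∫ x in a..b, G₁ x * h₁ x‖ ≤ K * M₁ * (V b - V a) := by
    intro a b ha hab hb
    rw [← valv a b ha hab hb, ← intervalIntegral.integral_const_mul]
    refine intervalIntegral.norm_integral_le_of_norm_le hab ?_ ((intv a b ha hab hb).const_mul _)
    have : ∀ᵐ x : ℝ, x ≠ b := by
      simp [ae_iff]
    -- The point `b` is discarded because `b = 1` is allowed and the bound for `G₁` holds only in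
    -- the open interval.
    filter_upwards [this] with x hxb hx
    have hx' : x ∈ Ioo (-1 : ℝ) 1 :=
      ⟨by linarith [hx.1], lt_of_lt_of_le (lt_of_le_of_ne hx.2 hxb) hb⟩
    rw [norm_mul]
    calc ‖G₁ x‖ * ‖h₁ x‖ ≤ (K * v x) * M₁ := by
          gcongr
          · exact bG₁v x hx'
          · exact bh₁ x
      _ = _ := by ring
  -- On the two edges of length δ the singularity of `G₁` is integrable and `M₁` is used. A second
  -- integration by parts there would meet (1 - x²)^{-3/2}, so it is confined to `[-b, b]`.
  set b : ℝ := 1 - δ with hb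
  have hb0 : 0 ≤ b := by linarith
  have hb1 : b < 1 := by linarith
  have hsd : 0 < √δ := Real.sqrt_pos.2 hδ
  have hVb : V 1 - V b ≤ 4 * √δ := by
    have h1 : √(1 + 1 : ℝ) ≤ √(1 + b) + √δ := by
      rw [Real.sqrt_le_left (by positivity), add_sq, Real.sq_sqrt (by linarith), Real.sq_sqrt hδ.le]
      have : 0 ≤ 2 * √(1 + b) * √δ := by positivity
      linarith
    simp only [hV]
    rw [show 1 - b = δ by rw [hb]; ring]
    norm_num at h1 ⊢
    linarith
  have hVb' : V (-b) - V (-1) ≤ 4 * √δ := by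
    have h1 : V (-b) = - V b := by
      simp only [hV, sub_neg_eq_add, ← sub_eq_add_neg]; ring
    have h2 : V (-1) = - V 1 := by
      simp only [hV, sub_neg_eq_add, ← sub_eq_add_neg]; ring
    rw [h1, h2]; linarith
  -- the weight `(1 - x²)^(-3/2)`
  have dW : ∀ x ∈ Icc (-b) b, HasDerivAt (fun x : ℝ => x / √(1 - x ^ 2)) (1 / √(1 - x ^ 2) ^ 3) x := by
    intro x hx
    have hw := wpos x ⟨by linarith [hx.1], by linarith [hx.2]⟩
    have hs := Real.sqrt_pos.2 hw
    have e1 : HasDerivAt (fun x : ℝ => 1 - x ^ 2) (-(2 * x)) x := by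
      simpa using ((hasDerivAt_pow 2 x).const_sub 1)
    have e2 := (hasDerivAt_id x).div (e1.sqrt hw.ne') hs.ne'
    refine e2.congr_deriv ?_
    have h2 : √(1 - x ^ 2) ^ 2 = 1 - x ^ 2 := Real.sq_sqrt hw.le
    have h3 : x ^ 2 = 1 - √(1 - x ^ 2) ^ 2 := by rw [h2]; ring
    simp only [id]
    field_simp
    rw [h2]
    ring
  have hsubI : Icc (-b) b ⊆ Ioo (-1 : ℝ) 1 := fun x hx => ⟨by linarith [hx.1], by linarith [hx.2]⟩
  have hbb : -b ≤ b := by linarith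
  have cw3 : ContinuousOn (fun x : ℝ => 1 / √(1 - x ^ 2) ^ 3) (uIcc (-b) b) := by
    rw [uIcc_of_le hbb]
    refine ContinuousOn.div (by fun_prop) (by fun_prop) fun x hx => ?_
    exact pow_ne_zero _ (Real.sqrt_pos.2 (wpos x (hsubI hx))).ne'
  have valW : ∫ x in (-b)..b, 1 / √(1 - x ^ 2) ^ 3 = 2 * (b / √(1 - b ^ 2)) := by
    rw [intervalIntegral.integral_eq_sub_of_hasDerivAt (f := fun x : ℝ => x / √(1 - x ^ 2))
      (by rw [uIcc_of_le hbb]; exact dW) cw3.intervalIntegrable]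
    simp only [neg_sq, neg_div]
    ring
  -- Here 1 - b² = 2δ - δ² ≥ δ, since δ ≤ 1.
  have hwb : √δ ≤ √(1 - b ^ 2) := Real.sqrt_le_sqrt (by rw [hb]; nlinarith)
  have intG₂ : IntervalIntegrable G₂ volume (-b) b := by
    apply ContinuousOn.intervalIntegrable
    rw [uIcc_of_le hbb]
    exact hG₂.mono hsubI
  -- Each of the two boundary terms costs `K * M₂ / √δ`, and the integral of (1 - x²)^{-3/2} costs
  -- twice that; hence the 4.
  have mid : ‖∫ x in (-b)..b, G₁ x * h₁ x‖ ≤ 4 * K * M₂ / √δ := by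
    rw [intervalIntegral.integral_mul_deriv_eq_deriv_mul_of_hasDerivAt (u := G₁) (v := h₂)
      (u' := G₂) (v' := h₁) (by rw [uIcc_of_le hbb]; exact cG₁.mono hsubI) ch₂.continuousOn
      (fun x hx => hG₁ x (hsubI (by
        rw [min_eq_left hbb, max_eq_right hbb] at hx; exact Ioo_subset_Icc_self hx)))
      (fun x _ => hh₂ x) intG₂ (ch₁.intervalIntegrable _ _)]
    have e1 : ∀ x ∈ Icc (-b) b, x ^ 2 = b ^ 2 → ‖G₁ x * h₂ x‖ ≤ K * M₂ / √δ := by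
      intro x hx hxb
      rw [norm_mul]
      have h1 := bG₁ x (hsubI hx)
      rw [hxb] at h1
      calc ‖G₁ x‖ * ‖h₂ x‖ ≤ (K / √δ) * M₂ := by
            gcongr
            · exact h1.trans (by gcongr)
            · exact bh₂ x
        _ = _ := by ring
    have e2 : ‖∫ x in (-b)..b, G₂ x * h₂ x‖ ≤ 2 * (K * M₂ / √δ) := by
      have i1 : ‖∫ x in (-b)..b, G₂ x * h₂ x‖ ≤
          ∫ x in (-b)..b, K * M₂ * (1 / √(1 - x ^ 2) ^ 3) := by
        refine intervalIntegral.norm_integral_le_of_norm_le hbb ?_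
          ((cw3.intervalIntegrable).const_mul _)
        refine Filter.Eventually.of_forall fun x hx => ?_
        rw [norm_mul]
        have hx' := hsubI (Ioc_subset_Icc_self hx)
        calc ‖G₂ x‖ * ‖h₂ x‖ ≤ (K / √(1 - x ^ 2) ^ 3) * M₂ := by
              gcongr
              · exact bG₂ x hx'
              · exact bh₂ x
          _ = _ := by ring
      rw [intervalIntegral.integral_const_mul, valW] at i1
      refine i1.trans ?_
      have : b / √(1 - b ^ 2) ≤ 1 / √δ := by gcongr
      calc K * M₂ * (2 * (b / √(1 - b ^ 2))) ≤ K * M₂ * (2 * (1 / √δ)) := by gcongr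
        _ = _ := by ring
    refine (norm_sub_le _ _).trans ?_
    have h3 := norm_sub_le (G₁ b * h₂ b) (G₁ (-b) * h₂ (-b))
    have h4 := e1 b ⟨hbb, le_rfl⟩ rfl
    have h5 := e1 (-b) ⟨le_rfl, hbb⟩ (by ring)
    have h6 : 4 * K * M₂ / √δ = 4 * (K * M₂ / √δ) := by ring
    linarith
  -- No boundary terms survive, because the bound on `G` forces it to vanish at ±1.
  have ibp : ∫ x in (-1 : ℝ)..1, G x * h x = - ∫ x in (-1 : ℝ)..1, G₁ x * h₁ x := by
    rw [intervalIntegral.integral_mul_deriv_eq_deriv_mul_of_hasDerivAt (u := G) (v := h₁)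
      (u' := G₁) (v' := h) (by rw [uIcc_of_le (by norm_num)]; exact cG) ch₁.continuousOn
      (fun x hx => hG x (by
        rwa [min_eq_left (by norm_num), max_eq_right (by norm_num)] at hx))
      (fun x _ => hh₁ x) (intG₁ _ _ le_rfl (by norm_num) le_rfl) (hh.intervalIntegrable _ _),
      hG1, hGm1]
    simp
  have intGh : ∀ a b : ℝ, -1 ≤ a → a ≤ b → b ≤ 1 →
      IntervalIntegrable (fun x => G₁ x * h₁ x) volume a b := fun a b ha hab hb =>
    (intG₁ a b ha hab hb).mul_continuousOn ch₁.continuousOn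
  rw [ibp, norm_neg, ← intervalIntegral.integral_add_adjacent_intervals (b := -b)
    (intGh _ _ le_rfl (by linarith) (by linarith)) (intGh _ _ (by linarith) (by linarith) le_rfl),
    ← intervalIntegral.integral_add_adjacent_intervals (a := -b) (b := b)
    (intGh _ _ (by linarith) (by linarith) (by linarith))
    (intGh _ _ (by linarith) (by linarith) le_rfl)]
  have t1 := edge (-1) (-b) le_rfl (by linarith) (by linarith)
  have t2 := edge b 1 (by linarith) (by linarith) le_rfl
  have hKM : 0 ≤ K * M₁ := by positivity
  have t3 := mul_le_mul_of_nonneg_left hVb hKM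
  have t4 := mul_le_mul_of_nonneg_left hVb' hKM
  refine (norm_add_le _ _).trans ((add_le_add t1 ((norm_add_le _ _).trans (add_le_add mid t2))).trans
    ?_)
  have : K * (8 * √δ * M₁ + 4 * M₂ / √δ) = 4 * K * M₂ / √δ + 2 * (K * M₁ * (4 * √δ)) := by ring
  linarith

/-! ### Decay of the Mellin transform of exp(-x - 1/x) on vertical lines -/

namespace BeyondEndoscopy

open MeasureTheory Set Filter Topology

theorem integrableOn_Ioi_of_bounds {f : ℝ → ℂ} {C : ℝ} (hf : ContinuousOn f (Ioi 0))
    (h0 : ∀ x > 0, ‖f x‖ ≤ C) (h2 : ∀ x > 0, ‖f x‖ * x ^ 2 ≤ C) : IntegrableOn f (Ioi 0) := by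
  have h : IntegrableOn (fun x : ℝ => 2 * C * (1 + x ^ 2)⁻¹) (Ioi 0) :=
    (integrable_inv_one_add_sq.const_mul _).integrableOn
  refine h.mono' (hf.aestronglyMeasurable measurableSet_Ioi) ?_
  filter_upwards [ae_restrict_mem measurableSet_Ioi] with x hx
  rw [← div_eq_mul_inv, le_div_iff₀ (by positivity)]
  have := h0 x hx
  have := h2 x hx
  linarith

theorem norm_cpow_mul {x : ℝ} (hx : 0 < x) (s : ℂ) (z : ℂ) :
    ‖(x : ℂ) ^ s * z‖ = ‖z‖ * x ^ s.re := by
  rw [norm_mul, Complex.norm_cpow_eq_rpow_re_of_pos hx, mul_comm]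

theorem continuousOn_ofReal_cpow (s : ℂ) : ContinuousOn (fun x : ℝ => (x : ℂ) ^ s) (Ioi 0) :=
  fun x hx => (Complex.continuousAt_ofReal_cpow_const x s (Or.inr (ne_of_gt hx))).continuousWithinAt

theorem mellin_integrand_integrableOn {u : ℝ → ℂ} {C : ℝ} {s : ℂ} (hu : ContinuousOn u (Ioi 0))
    (h0 : ∀ x > 0, ‖u x‖ * x ^ s.re ≤ C) (h2 : ∀ x > 0, ‖u x‖ * x ^ (s.re + 2) ≤ C) :
    IntegrableOn (fun x : ℝ => (x : ℂ) ^ s * u x) (Ioi 0) := by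
  refine integrableOn_Ioi_of_bounds (C := C) ((continuousOn_ofReal_cpow s).mul hu) ?_ ?_
  · intro x hx
    rw [norm_cpow_mul hx]
    exact h0 x hx
  · intro x hx
    rw [norm_cpow_mul hx, mul_assoc, ← Real.rpow_natCast x 2, ← Real.rpow_add hx]
    exact_mod_cast h2 x hx

/-- Integration by parts for the Mellin transform. -/
theorem integral_cpow_mul_deriv {u u' : ℝ → ℂ} {C : ℝ} {s : ℂ} (hs : s ≠ 0)
    (hu : ∀ x > 0, HasDerivAt u (u' x) x) (hu' : ContinuousOn u' (Ioi 0))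
    (h1 : ∀ x > 0, ‖u x‖ * x ^ (s.re - 1) ≤ C) (h2 : ∀ x > 0, ‖u x‖ * x ^ (s.re + 1) ≤ C)
    (h3 : ∀ x > 0, ‖u' x‖ * x ^ s.re ≤ C) (h4 : ∀ x > 0, ‖u' x‖ * x ^ (s.re + 2) ≤ C) :
    ∫ x in Ioi (0 : ℝ), (x : ℂ) ^ s * u' x = - (s * ∫ x in Ioi (0 : ℝ), (x : ℂ) ^ (s - 1) * u x) := by
  have cu : ContinuousOn u (Ioi 0) := fun x hx => (hu x hx).continuousAt.continuousWithinAt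
  have i1 := mellin_integrand_integrableOn (s := s) hu' h3 h4
  have i2 : IntegrableOn (fun x : ℝ => (x : ℂ) ^ (s - 1) * u x) (Ioi 0) := by
    refine mellin_integrand_integrableOn (C := C) cu ?_ ?_
    · simpa using h1
    · intro x hx
      have := h2 x hx
      rwa [show (s - 1).re + 2 = s.re + 1 by simp; ring]
  -- The bounds at exponents σ - 1 and σ + 1 give one power of x to spare at 0 and at infinity, so
  -- the boundary terms vanish.
  have b0 : ∀ x : ℝ, 0 < x → ‖(x : ℂ) ^ s * u x‖ ≤ C * x := by
    intro x hx
    rw [norm_cpow_mul hx]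
    have := mul_le_mul_of_nonneg_right (h1 x hx) hx.le
    rw [mul_assoc, ← Real.rpow_add_one hx.ne'] at this
    simpa using this
  have b1 : ∀ x : ℝ, 0 < x → ‖(x : ℂ) ^ s * u x‖ ≤ C * x⁻¹ := by
    intro x hx
    rw [norm_cpow_mul hx]
    have := mul_le_mul_of_nonneg_right (h2 x hx) (inv_nonneg.2 hx.le)
    rw [mul_assoc, ← Real.rpow_neg_one, ← Real.rpow_add hx] at this
    rw [← Real.rpow_neg_one]
    simpa using this
  have l0 : Tendsto (fun x : ℝ => (x : ℂ) ^ s * u x) (𝓝[>] 0) (𝓝 0) := by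
    refine squeeze_zero_norm' (a := fun x => C * x) ?_ ?_
    · filter_upwards [self_mem_nhdsWithin] with x hx using b0 x hx
    · have : Tendsto (fun x : ℝ => C * x) (𝓝 0) (𝓝 (C * 0)) := (continuous_const.mul continuous_id).tendsto 0
      rw [mul_zero] at this
      exact this.mono_left nhdsWithin_le_nhds
  have l1 : Tendsto (fun x : ℝ => (x : ℂ) ^ s * u x) atTop (𝓝 0) := by
    refine squeeze_zero_norm' (a := fun x => C * x⁻¹) ?_ ?_
    · filter_upwards [eventually_gt_atTop 0] with x hx using b1 x hx
    · simpa using (tendsto_inv_atTop_zero (𝕜 := ℝ)).const_mul C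
  have := integral_Ioi_mul_deriv_eq_deriv_mul (a := 0) (u := fun x : ℝ => (x : ℂ) ^ s)
    (u' := fun x : ℝ => s * (x : ℂ) ^ (s - 1)) (v := u) (v' := u') (a' := 0) (b' := 0)
    (fun x hx => hasDerivAt_ofReal_cpow_const (ne_of_gt hx) hs) (fun x hx => hu x hx) i1
    (by
      have := i2.const_mul s
      refine this.congr ?_
      filter_upwards with x
      simp only [Pi.mul_apply]; ring) l0 l1
  rw [this, sub_zero, zero_sub, ← integral_const_mul]
  congr 1
  refine integral_congr_ae ?_
  filter_upwards with x
  ring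

/-- The function `exp (-x - 1/x)`. -/
noncomputable def expNegAddInv (x : ℝ) : ℝ := Real.exp (-x - 1 / x)

theorem expNegAddInv_nonneg (x : ℝ) : 0 ≤ expNegAddInv x := (Real.exp_pos _).le

/-- The exponent -(x + 1/x) beats every power at both ends: exp(-y) yⁿ ≤ n! is applied with y = x
for x ≥ 1 and with y = 1/x for x ≤ 1. -/
theorem exists_expNegAddInv_mul_rpow_le (σ : ℝ) : ∃ C : ℝ, ∀ x > 0, expNegAddInv x * x ^ σ ≤ C := by
  obtain ⟨n, hn⟩ := exists_nat_ge |σ|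
  have hn1 := (abs_le.1 hn).1
  have hn2 := (abs_le.1 hn).2
  refine ⟨n.factorial, fun x hx => ?_⟩
  have hf : (0 : ℝ) < n.factorial := by positivity
  have key : ∀ y : ℝ, 0 < y → y ≤ x + 1 / x → expNegAddInv x * y ^ n ≤ n.factorial := by
    intro y hy hyx
    have h1 := Real.pow_div_factorial_le_exp y hy.le n
    rw [div_le_iff₀ hf] at h1
    have h2 : expNegAddInv x ≤ Real.exp (-y) := Real.exp_le_exp.2 (by linarith)
    calc expNegAddInv x * y ^ n ≤ Real.exp (-y) * (Real.exp y * n.factorial) := by gcongr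
      _ = n.factorial := by rw [← mul_assoc, ← Real.exp_add]; simp
  have hx' : 0 < 1 / x := by positivity
  rcases le_total 1 x with h | h
  · refine le_trans ?_ (key x hx (by linarith))
    rw [← Real.rpow_natCast]
    exact mul_le_mul_of_nonneg_left (Real.rpow_le_rpow_of_exponent_le h hn2) (expNegAddInv_nonneg x)
  · refine le_trans ?_ (key (1 / x) hx' (by linarith))
    rw [← Real.rpow_natCast, one_div, Real.inv_rpow hx.le, ← Real.rpow_neg hx.le]
    exact mul_le_mul_of_nonneg_left (Real.rpow_le_rpow_of_exponent_ge hx h (by linarith))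
      (expNegAddInv_nonneg x)

theorem hasDerivAt_expNegAddInv {x : ℝ} (hx : x ≠ 0) :
    HasDerivAt expNegAddInv (expNegAddInv x * (-1 + 1 / x ^ 2)) x := by
  have h1 : HasDerivAt (fun y : ℝ => -y - 1 / y) (-1 + 1 / x ^ 2) x := by
    have := (hasDerivAt_id x).neg.sub (hasDerivAt_inv hx)
    refine (this.congr_deriv (by simp)).congr_of_eventuallyEq ?_
    exact Eventually.of_forall fun y => by simp
  exact h1.exp

theorem continuousOn_expNegAddInv : ContinuousOn expNegAddInv (Ioi 0) := fun _ hx =>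
  (hasDerivAt_expNegAddInv (ne_of_gt hx)).continuousAt.continuousWithinAt

/-- The integral `∫₀^∞ exp (-x - 1/x) x^s dx`. -/
noncomputable def expMellin (s : ℂ) : ℂ := ∫ x in Ioi (0 : ℝ), (x : ℂ) ^ s * expNegAddInv x

theorem norm_expNegAddInv (x : ℝ) : ‖(expNegAddInv x : ℂ)‖ = expNegAddInv x := by
  rw [Complex.norm_real, Real.norm_eq_abs, abs_of_nonneg (expNegAddInv_nonneg x)]

theorem integrableOn_cpow_mul_expNegAddInv (s : ℂ) :
    IntegrableOn (fun x : ℝ => (x : ℂ) ^ s * expNegAddInv x) (Ioi 0) := by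
  obtain ⟨C, hC⟩ := exists_expNegAddInv_mul_rpow_le s.re
  obtain ⟨D, hD⟩ := exists_expNegAddInv_mul_rpow_le (s.re + 2)
  refine mellin_integrand_integrableOn (C := max C D)
    (Complex.continuous_ofReal.comp_continuousOn continuousOn_expNegAddInv) ?_ ?_
  · intro x hx
    rw [norm_expNegAddInv]
    exact (hC x hx).trans (le_max_left _ _)
  · intro x hx
    rw [norm_expNegAddInv]
    exact (hD x hx).trans (le_max_right _ _)

/-- Integration by parts, since the derivative of exp(-x - 1/x) is (-1 + x^{-2}) times the function.
The factor `s` on the left against two transforms without it is what produces decay. -/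
theorem expMellin_recurrence {s : ℂ} (hs : s ≠ 0) :
    s * expMellin (s - 1) = expMellin s - expMellin (s - 2) := by
  obtain ⟨C1, hC1⟩ := exists_expNegAddInv_mul_rpow_le (s.re - 1)
  obtain ⟨C2, hC2⟩ := exists_expNegAddInv_mul_rpow_le (s.re + 1)
  obtain ⟨C3, hC3⟩ := exists_expNegAddInv_mul_rpow_le s.re
  obtain ⟨C4, hC4⟩ := exists_expNegAddInv_mul_rpow_le (s.re - 2)
  obtain ⟨C5, hC5⟩ := exists_expNegAddInv_mul_rpow_le (s.re + 2)
  have hp : ∀ (τ C : ℝ), (∀ x > 0, expNegAddInv x * x ^ τ ≤ C) → 0 ≤ C := fun τ C h =>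
    (mul_nonneg (expNegAddInv_nonneg 1) (by positivity)).trans (h 1 one_pos)
  have p1 := hp _ _ hC1
  have p2 := hp _ _ hC2
  have p3 := hp _ _ hC3
  have p4 := hp _ _ hC4
  have p5 := hp _ _ hC5
  have nb : ∀ x > 0, ∀ τ : ℝ,
      ‖((expNegAddInv x * (-1 + 1 / x ^ 2) : ℝ) : ℂ)‖ * x ^ τ ≤
      expNegAddInv x * x ^ τ + expNegAddInv x * x ^ (τ - 2) := by
    intro x hx τ
    rw [Complex.norm_real, Real.norm_eq_abs, abs_mul, abs_of_nonneg (expNegAddInv_nonneg x),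
      Real.rpow_sub hx, mul_assoc, ← mul_add]
    refine mul_le_mul_of_nonneg_left ?_ (expNegAddInv_nonneg x)
    have : |(-1 + 1 / x ^ 2 : ℝ)| ≤ 1 + 1 / x ^ 2 := by
      refine (abs_add_le _ _).trans ?_
      rw [abs_neg, abs_one, abs_of_pos (by positivity : 0 < 1 / x ^ 2)]
    calc _ ≤ (1 + 1 / x ^ 2) * x ^ τ := by gcongr
      _ = _ := by norm_num; ring
  have h := integral_cpow_mul_deriv (u := fun x => (expNegAddInv x : ℂ))
    (u' := fun x => ((expNegAddInv x * (-1 + 1 / x ^ 2) : ℝ) : ℂ))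
    (C := C1 + C2 + C3 + C4 + C5) hs
    (fun x hx => (hasDerivAt_expNegAddInv (ne_of_gt hx)).ofReal_comp)
    (by
      refine Complex.continuous_ofReal.comp_continuousOn (continuousOn_expNegAddInv.mul ?_)
      exact continuousOn_const.add (continuousOn_const.div (by fun_prop) fun _ hx =>
        pow_ne_zero _ (ne_of_gt hx)))
    (fun x hx => by rw [norm_expNegAddInv]; linarith [hC1 x hx])
    (fun x hx => by rw [norm_expNegAddInv]; linarith [hC2 x hx])
    (fun x hx => (nb x hx _).trans (by linarith [hC3 x hx, hC4 x hx]))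
    (fun x hx => (nb x hx _).trans (by
      have := hC3 x hx
      rw [show s.re + 2 - 2 = s.re by ring]
      linarith [hC5 x hx]))
  have h2 : ∫ x in Ioi (0 : ℝ), (x : ℂ) ^ s * ((expNegAddInv x * (-1 + 1 / x ^ 2) : ℝ) : ℂ) =
      expMellin (s - 2) - expMellin s := by
    simp only [expMellin]
    rw [← integral_sub (integrableOn_cpow_mul_expNegAddInv _) (integrableOn_cpow_mul_expNegAddInv _)]
    refine setIntegral_congr_fun measurableSet_Ioi fun x hx => ?_
    have hx0 : (x : ℂ) ≠ 0 := by exact_mod_cast (ne_of_gt hx)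
    rw [Complex.cpow_sub _ _ hx0]
    push_cast
    norm_num
    field_simp
    ring
  rw [h2] at h
  have h3 : s * expMellin (s - 1) = -(expMellin (s - 2) - expMellin s) := by
    rw [h, neg_neg]; rfl
  rw [h3]; ring

/-- The recurrence trades a factor |t| for transforms on the neighbouring lines σ ± 1, so the
induction must treat all real σ at once. For `N = 0` the absolute integral does not depend on t. -/
theorem exists_norm_expMellin_le (N : ℕ) :
    ∀ σ : ℝ, ∃ C : ℝ, ∀ t : ℝ, (1 + |t|) ^ N * ‖expMellin (σ + t * Complex.I)‖ ≤ C := by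
  induction N with
  | zero =>
    intro σ
    refine ⟨∫ x in Ioi (0 : ℝ), ‖(x : ℂ) ^ (σ : ℂ) * expNegAddInv x‖, fun t => ?_⟩
    rw [pow_zero, one_mul]
    refine (norm_integral_le_integral_norm _).trans (le_of_eq ?_)
    refine setIntegral_congr_fun measurableSet_Ioi fun x hx => ?_
    rw [norm_cpow_mul hx, norm_cpow_mul hx]
    simp
  | succ N ih =>
    intro σ
    obtain ⟨C0, h0⟩ := ih σ
    obtain ⟨C1, h1⟩ := ih (σ + 1)
    obtain ⟨C2, h2⟩ := ih (σ - 1)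
    refine ⟨C0 + C1 + C2, fun t => ?_⟩
    have key : |t| * ‖expMellin (σ + t * Complex.I)‖ ≤
        ‖expMellin ((σ + 1 : ℝ) + t * Complex.I)‖ + ‖expMellin ((σ - 1 : ℝ) + t * Complex.I)‖ := by
      set s : ℂ := (σ + 1 : ℝ) + t * Complex.I with hs
      have him : s.im = t := by simp [hs]
      -- The recurrence requires `s ≠ 0`, but `s = 0` forces `t = 0` and the left side vanishes.
      by_cases hs0 : s = 0
      · have : t = 0 := by rw [← him, hs0]; simp
        rw [this, abs_zero, zero_mul]; positivity
      · have h := expMellin_recurrence hs0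
        rw [show s - 1 = σ + t * Complex.I by rw [hs]; push_cast; ring,
          show s - 2 = (σ - 1 : ℝ) + t * Complex.I by rw [hs]; push_cast; ring] at h
        have h3 : |t| ≤ ‖s‖ := by rw [← him]; exact Complex.abs_im_le_norm s
        calc |t| * ‖expMellin (σ + t * Complex.I)‖ ≤ ‖s‖ * ‖expMellin (σ + t * Complex.I)‖ := by
              gcongr
          _ = ‖expMellin s - expMellin ((σ - 1 : ℝ) + t * Complex.I)‖ := by rw [← norm_mul, h]
          _ ≤ _ := norm_sub_le _ _
    have hp : 0 ≤ (1 + |t|) ^ N := by positivity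
    have := mul_le_mul_of_nonneg_left key hp
    calc (1 + |t|) ^ (N + 1) * ‖expMellin (σ + t * Complex.I)‖
        = (1 + |t|) ^ N * ‖expMellin (σ + t * Complex.I)‖ +
          (1 + |t|) ^ N * (|t| * ‖expMellin (σ + t * Complex.I)‖) := by ring
      _ ≤ _ := by
        have := h0 t
        have := h1 t
        have := h2 t
        linarith

theorem continuous_expMellin (σ : ℝ) : Continuous fun t : ℝ => expMellin (σ + t * Complex.I) := by
  refine continuous_of_dominated (bound := fun x : ℝ => ‖(x : ℂ) ^ (σ : ℂ) * expNegAddInv x‖)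
    (fun t => (integrableOn_cpow_mul_expNegAddInv _).aestronglyMeasurable) (fun t => ?_)
    (integrableOn_cpow_mul_expNegAddInv _).norm ?_
  · filter_upwards [ae_restrict_mem measurableSet_Ioi] with x hx
    rw [norm_cpow_mul hx, norm_cpow_mul hx]
    simp
  · filter_upwards [ae_restrict_mem measurableSet_Ioi] with x hx
    have hx0 : (x : ℂ) ≠ 0 := by exact_mod_cast (ne_of_gt hx)
    refine Continuous.mul ?_ continuous_const
    exact Continuous.const_cpow (by fun_prop) (Or.inl hx0)

end BeyondEndoscopy

/-! ### The Mellin kernel of H on the line Re u = 1 -/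

namespace BeyondEndoscopy

open MeasureTheory Set Filter Topology

theorem integrableOn_expNegAddInv_div : IntegrableOn (fun y => expNegAddInv y / y) (Ioi 0) := by
  have h := (integrableOn_cpow_mul_expNegAddInv (-1)).norm
  refine h.congr ?_
  filter_upwards [ae_restrict_mem measurableSet_Ioi] with x hx
  rw [norm_cpow_mul hx, norm_expNegAddInv, Complex.neg_re, Complex.one_re, Real.rpow_neg_one,
    div_eq_mul_inv]

theorem F_eq (x : ℝ) : F x = 1 / (2 * besselK0 2) * ∫ y in Ioi x, expNegAddInv y / y := rfl

theorem hasDerivAt_F {x : ℝ} (hx : 0 < x) :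
    HasDerivAt F (-(1 / (2 * besselK0 2)) * (expNegAddInv x / x)) x := by
  have hint := integrableOn_expNegAddInv_div
  have hc : ContinuousOn (fun y => expNegAddInv y / y) (Ioi 0) :=
    continuousOn_expNegAddInv.div continuousOn_id fun _ hy => ne_of_gt hy
  have h1 : HasDerivAt (fun u => ∫ y in (x / 2)..u, expNegAddInv y / y) (expNegAddInv x / x) x := by
    refine intervalIntegral.integral_hasDerivAt_right ?_ ?_ (hc.continuousAt (Ioi_mem_nhds hx))
    · apply ContinuousOn.intervalIntegrable
      refine hc.mono ?_
      rw [uIcc_of_le (by linarith)]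
      exact fun y hy => lt_of_lt_of_le (by positivity) hy.1
    · exact ContinuousOn.stronglyMeasurableAtFilter isOpen_Ioi hc x hx
  have h2 : HasDerivAt (fun u => 1 / (2 * besselK0 2) *
      ((∫ y in Ioi (x / 2), expNegAddInv y / y) - ∫ y in (x / 2)..u, expNegAddInv y / y))
      (-(1 / (2 * besselK0 2)) * (expNegAddInv x / x)) x :=
    ((h1.const_sub _).const_mul _).congr_deriv (by ring)
  refine h2.congr_of_eventuallyEq ?_
  filter_upwards [Ioi_mem_nhds hx] with u hu
  rw [F_eq, ← intervalIntegral.integral_interval_add_Ioi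
    (hint.mono_set (Ioi_subset_Ioi (by positivity : 0 ≤ x / 2)))
    (hint.mono_set (Ioi_subset_Ioi (le_of_lt hu)))]
  ring

/-- For y > x the factor x² can be replaced by y² inside the integral. The two bounds are those on u
that `integral_cpow_mul_deriv` asks for when Re s = 1. -/
theorem exists_abs_F_le : ∃ C : ℝ, ∀ x > 0, |F x| ≤ C ∧ |F x| * x ^ 2 ≤ C := by
  have hint := integrableOn_expNegAddInv_div
  have hint2 : IntegrableOn (fun y => expNegAddInv y * y) (Ioi 0) := by
    refine (integrableOn_cpow_mul_expNegAddInv 1).norm.congr ?_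
    filter_upwards [ae_restrict_mem measurableSet_Ioi] with x hx
    rw [norm_cpow_mul hx, norm_expNegAddInv, Complex.one_re, Real.rpow_one]
  set c := |1 / (2 * besselK0 2)|
  have hc : 0 ≤ c := abs_nonneg _
  have nn : ∀ y ∈ Ioi (0 : ℝ), 0 ≤ expNegAddInv y / y := fun y hy =>
    div_nonneg (expNegAddInv_nonneg y) (le_of_lt hy)
  have nn2 : ∀ y ∈ Ioi (0 : ℝ), 0 ≤ expNegAddInv y * y := fun y hy =>
    mul_nonneg (expNegAddInv_nonneg y) (le_of_lt hy)
  have i1 : 0 ≤ ∫ y in Ioi (0 : ℝ), expNegAddInv y / y := setIntegral_nonneg measurableSet_Ioi nn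
  have i2 : 0 ≤ ∫ y in Ioi (0 : ℝ), expNegAddInv y * y := setIntegral_nonneg measurableSet_Ioi nn2
  refine ⟨c * (∫ y in Ioi (0 : ℝ), expNegAddInv y / y) + c * ∫ y in Ioi (0 : ℝ), expNegAddInv y * y,
    fun x hx => ?_⟩
  have hsub : Ioi x ⊆ Ioi (0 : ℝ) := Ioi_subset_Ioi (le_of_lt hx)
  have j0 : 0 ≤ ∫ y in Ioi x, expNegAddInv y / y :=
    setIntegral_nonneg measurableSet_Ioi fun y hy => nn y (hsub hy)
  have j1 : ∫ y in Ioi x, expNegAddInv y / y ≤ ∫ y in Ioi (0 : ℝ), expNegAddInv y / y :=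
    setIntegral_mono_set hint ((ae_restrict_mem measurableSet_Ioi).mono nn) hsub.eventuallyLE
  have j2 : (∫ y in Ioi x, expNegAddInv y / y) * x ^ 2 ≤ ∫ y in Ioi (0 : ℝ), expNegAddInv y * y := by
    rw [← integral_mul_const]
    refine le_trans ?_ (setIntegral_mono_set hint2
      ((ae_restrict_mem measurableSet_Ioi).mono nn2) hsub.eventuallyLE)
    refine setIntegral_mono_on ((hint.mono_set hsub).mul_const _) (hint2.mono_set hsub)
      measurableSet_Ioi fun y hy => ?_
    have hy0 : 0 < y := hsub hy
    have hxy : x ^ 2 ≤ y ^ 2 := pow_le_pow_left₀ hx.le (le_of_lt hy) 2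
    calc expNegAddInv y / y * x ^ 2 ≤ expNegAddInv y / y * y ^ 2 :=
          mul_le_mul_of_nonneg_left hxy (nn y hy0)
      _ = expNegAddInv y * y := by field_simp
  rw [F_eq, abs_mul, abs_of_nonneg j0]
  have k1 := mul_le_mul_of_nonneg_left j1 hc
  have k2 := mul_le_mul_of_nonneg_left j2 hc
  have k3 := mul_nonneg hc i1
  have k4 := mul_nonneg hc i2
  exact ⟨by linarith, by rw [mul_assoc]; linarith⟩

/-- Integration by parts using F'(x) = -c exp(-x - 1/x)/x: the rapid decay of `expMellin` passes to
the Mellin transform of F. The value of `besselK0 2` plays no role. -/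
theorem mul_mellin_F (t : ℝ) : ((1 : ℝ) + t * Complex.I) *
    mellin (fun x : ℝ => (F x : ℂ)) ((1 : ℝ) + t * Complex.I) =
      (1 / (2 * besselK0 2) : ℝ) * expMellin ((0 : ℝ) + t * Complex.I) := by
  set s : ℂ := (1 : ℝ) + t * Complex.I with hs
  have hre : s.re = 1 := by simp [hs]
  have hs0 : s ≠ 0 := fun h => by rw [h] at hre; simp at hre
  obtain ⟨C0, hC0⟩ := exists_abs_F_le
  obtain ⟨C1, hC1⟩ := exists_expNegAddInv_mul_rpow_le 0
  obtain ⟨C2, hC2⟩ := exists_expNegAddInv_mul_rpow_le 2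
  set c : ℝ := 1 / (2 * besselK0 2) with hc
  have p0 : 0 ≤ C0 := (abs_nonneg _).trans (hC0 1 one_pos).1
  have p1 : 0 ≤ C1 := (mul_nonneg (expNegAddInv_nonneg 1) (by positivity)).trans (hC1 1 one_pos)
  have p2 : 0 ≤ C2 := (mul_nonneg (expNegAddInv_nonneg 1) (by positivity)).trans (hC2 1 one_pos)
  have p3 : 0 ≤ |c| * C1 := by positivity
  have p4 : 0 ≤ |c| * C2 := by positivity
  have nb : ∀ x : ℝ, 0 < x → ∀ τ : ℝ, ‖((-c * (expNegAddInv x / x) : ℝ) : ℂ)‖ * x ^ (τ + 1) =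
      |c| * (expNegAddInv x * x ^ τ) := by
    intro x hx τ
    rw [Complex.norm_real, Real.norm_eq_abs, abs_mul, abs_neg,
      abs_of_nonneg (div_nonneg (expNegAddInv_nonneg x) hx.le), Real.rpow_add_one hx.ne']
    field_simp
  have h := integral_cpow_mul_deriv (u := fun x => (F x : ℂ))
    (u' := fun x => ((-c * (expNegAddInv x / x) : ℝ) : ℂ)) (C := C0 + |c| * C1 + |c| * C2) hs0
    (fun x hx => (hasDerivAt_F hx).ofReal_comp)
    (by
      refine Complex.continuous_ofReal.comp_continuousOn (continuousOn_const.mul ?_)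
      exact continuousOn_expNegAddInv.div continuousOn_id fun _ hy => ne_of_gt hy)
    (fun x hx => by
      rw [hre, Complex.norm_real, Real.norm_eq_abs, sub_self, Real.rpow_zero, mul_one]
      linarith [(hC0 x hx).1])
    (fun x hx => by
      rw [hre, Complex.norm_real, Real.norm_eq_abs]
      norm_num
      linarith [(hC0 x hx).2])
    (fun x hx => by
      rw [hre]
      have := nb x hx 0
      rw [zero_add] at this
      rw [this]
      have := mul_le_mul_of_nonneg_left (hC1 x hx) (abs_nonneg c)
      linarith)
    (fun x hx => by
      rw [hre, add_comm]
      have := nb x hx 2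
      rw [this]
      have := mul_le_mul_of_nonneg_left (hC2 x hx) (abs_nonneg c)
      linarith)
  have h2 : ∫ x in Ioi (0 : ℝ), (x : ℂ) ^ s * ((-c * (expNegAddInv x / x) : ℝ) : ℂ) =
      -(c * expMellin ((0 : ℝ) + t * Complex.I)) := by
    rw [expMellin, ← integral_const_mul, ← integral_neg]
    refine setIntegral_congr_fun measurableSet_Ioi fun x hx => ?_
    have hx0 : (x : ℂ) ≠ 0 := by exact_mod_cast (ne_of_gt hx)
    rw [show s = ((0 : ℝ) + t * Complex.I) + 1 by rw [hs]; push_cast; ring,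
      Complex.cpow_add _ _ hx0, Complex.cpow_one]
    push_cast
    field_simp
  rw [h2] at h
  exact (neg_injective h).symm

/-- The squared modulus is Γ(1 + is)Γ(1 - is), and the reflection formula applies after splitting
off the factor is. -/
theorem norm_Gamma_one_add_sq {s : ℝ} (hs : 0 < s) :
    ‖Complex.Gamma (1 + s * Complex.I)‖ ^ 2 = Real.pi * s / Real.sinh (Real.pi * s) := by
  have hsI : (s : ℂ) * Complex.I ≠ 0 := by
    simp [hs.ne']
  have hsinh : Real.sinh (Real.pi * s) ≠ 0 := by
    have := Real.sinh_pos_iff.2 (by positivity : 0 < Real.pi * s)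
    exact this.ne'
  have h1 : ((‖Complex.Gamma (1 + s * Complex.I)‖ ^ 2 : ℝ) : ℂ) =
      Complex.Gamma (1 + s * Complex.I) * Complex.Gamma (1 - s * Complex.I) := by
    rw [Complex.ofReal_pow, ← Complex.mul_conj', ← Complex.Gamma_conj]
    congr 2
    simp [sub_eq_add_neg]
  have h2 : Complex.Gamma (1 + s * Complex.I) = s * Complex.I * Complex.Gamma (s * Complex.I) := by
    rw [add_comm, Complex.Gamma_add_one _ hsI]
  apply Complex.ofReal_injective
  rw [h1, h2, mul_assoc ((s : ℂ) * Complex.I), Complex.Gamma_mul_Gamma_one_sub, ← mul_assoc,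
    Complex.sin_mul_I]
  have : Complex.sinh (Real.pi * s) ≠ 0 := by
    rw [← Complex.ofReal_mul, ← Complex.ofReal_sinh]
    exact_mod_cast hsinh
  push_cast
  field_simp

theorem norm_Gamma_half_sub_sq (s : ℝ) :
    ‖Complex.Gamma (1 / 2 - s * Complex.I)‖ ^ 2 = Real.pi / Real.cosh (Real.pi * s) := by
  have h1 : ((‖Complex.Gamma (1 / 2 - s * Complex.I)‖ ^ 2 : ℝ) : ℂ) =
      Complex.Gamma (1 / 2 - s * Complex.I) * Complex.Gamma (1 - (1 / 2 - s * Complex.I)) := by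
    rw [Complex.ofReal_pow, ← Complex.mul_conj', ← Complex.Gamma_conj]
    congr 2
    simp [Complex.conj_ofNat]
    ring
  rw [Complex.Gamma_mul_Gamma_one_sub, show (Real.pi : ℂ) * (1 / 2 - s * Complex.I) =
    Real.pi / 2 - Real.pi * s * Complex.I by ring, Complex.sin_pi_div_two_sub, Complex.cos_mul_I]
    at h1
  apply Complex.ofReal_injective
  rw [h1]
  push_cast
  rfl

/-- For s = t/2 > 0 the two reflection identities give the squared modulus s·coth(πs), which is at
most (1 + s)². Negative t follows by conjugation, and t = 0 from Γ(1/2)² = π. A linear bound is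
enough, since the Mellin transform of F decays faster than any power. -/
theorem norm_Gamma_ratio_le (t : ℝ) :
    ‖Complex.Gamma ((1 + ((1 : ℝ) + t * Complex.I)) / 2) /
      Complex.Gamma ((2 - ((1 : ℝ) + t * Complex.I)) / 2)‖ ≤ 1 + |t| := by
  have pos : ∀ s : ℝ, 0 < s → ‖Complex.Gamma (1 + s * Complex.I)‖ /
      ‖Complex.Gamma (1 / 2 - s * Complex.I)‖ ≤ 1 + s := by
    intro s hs
    have hsinh := Real.sinh_pos_iff.2 (by positivity : 0 < Real.pi * s)
    refine le_of_sq_le_sq ?_ (by positivity)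
    rw [div_pow, norm_Gamma_one_add_sq hs, norm_Gamma_half_sub_sq]
    have hpi := Real.pi_gt_three
    have h1 : s ≤ Real.sinh (Real.pi * s) := by
      have := Real.self_le_sinh_iff.2 (by positivity : 0 ≤ Real.pi * s)
      nlinarith
    have h2 : Real.cosh (Real.pi * s) ≤ Real.sinh (Real.pi * s) + 1 := by
      have h3 := Real.cosh_sub_sinh (Real.pi * s)
      have h4 : Real.exp (-(Real.pi * s)) ≤ 1 := Real.exp_le_one_iff.2 (by
        have : 0 < Real.pi * s := by positivity
        linarith)
      linarith
    have h3 : Real.pi * s / Real.sinh (Real.pi * s) / (Real.pi / Real.cosh (Real.pi * s)) =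
        s * Real.cosh (Real.pi * s) / Real.sinh (Real.pi * s) := by
      field_simp
    rw [h3, div_le_iff₀ hsinh]
    nlinarith [mul_le_mul_of_nonneg_left h2 hs.le, mul_pos hs hsinh, mul_pos (mul_pos hs hs) hsinh]
  rw [norm_div, show (1 + ((1 : ℝ) + t * Complex.I)) / 2 = 1 + ((t / 2 : ℝ) : ℂ) * Complex.I by
    push_cast; ring, show (2 - ((1 : ℝ) + t * Complex.I)) / 2 =
    1 / 2 - ((t / 2 : ℝ) : ℂ) * Complex.I by push_cast; ring]
  rcases lt_trichotomy t 0 with h | h | h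
  · have e1 : Complex.Gamma (1 + ((t / 2 : ℝ) : ℂ) * Complex.I) =
        (starRingEnd ℂ) (Complex.Gamma (1 + ((-t / 2 : ℝ) : ℂ) * Complex.I)) := by
      rw [← Complex.Gamma_conj]; congr 1; simp [Complex.conj_ofNat]; ring
    have e2 : Complex.Gamma (1 / 2 - ((t / 2 : ℝ) : ℂ) * Complex.I) =
        (starRingEnd ℂ) (Complex.Gamma (1 / 2 - ((-t / 2 : ℝ) : ℂ) * Complex.I)) := by
      rw [← Complex.Gamma_conj]; congr 1; simp [Complex.conj_ofNat]; ring
    rw [e1, e2, RCLike.norm_conj, RCLike.norm_conj, abs_of_neg h]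
    exact (pos (-t / 2) (by linarith)).trans (by linarith)
  · subst h
    have h1 := norm_Gamma_half_sub_sq 0
    simp only [Complex.ofReal_zero, zero_mul, sub_zero, mul_zero, Real.cosh_zero, div_one] at h1
    simp only [zero_div, Complex.ofReal_zero, zero_mul, add_zero, sub_zero, Complex.Gamma_one,
      norm_one, abs_zero]
    have hpi := Real.pi_gt_three
    have h2 : 1 ≤ ‖Complex.Gamma (1 / 2)‖ := by
      by_contra hcon
      push Not at hcon
      have := norm_nonneg (Complex.Gamma (1 / 2))
      nlinarith
    exact (div_le_one (by linarith)).2 h2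
  · rw [abs_of_pos h]
    exact (pos (t / 2) (by linarith)).trans (by linarith)

/-- The integrand of the Mellin integral defining `H`, without the power. -/
noncomputable def mellinKernelH (t : ℝ) : ℂ :=
  Complex.Gamma ((1 + ((1 : ℝ) + t * Complex.I)) / 2) /
    Complex.Gamma ((2 - ((1 : ℝ) + t * Complex.I)) / 2) *
      mellin (fun x : ℝ => (F x : ℂ)) ((1 : ℝ) + t * Complex.I)

theorem one_add_mul_I_ne_zero (t : ℝ) : ((1 : ℝ) : ℂ) + t * Complex.I ≠ 0 := fun h => by
  have := congrArg Complex.re h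
  simp at this

theorem continuous_mellinKernelH : Continuous mellinKernelH := by
  have h1 : Continuous fun t : ℝ => Complex.Gamma ((1 + ((1 : ℝ) + t * Complex.I)) / 2) := by
    refine continuous_iff_continuousAt.2 fun t => ?_
    have : DifferentiableAt ℂ Complex.Gamma ((1 + ((1 : ℝ) + t * Complex.I)) / 2) := by
      refine Complex.differentiableAt_Gamma _ fun m h => ?_
      have := congrArg Complex.re h
      simp at this
      linarith
    exact this.continuousAt.comp (f := fun t : ℝ => (1 + (((1 : ℝ) : ℂ) + t * Complex.I)) / 2)
      (by fun_prop)
  have h2 : Continuous fun t : ℝ => (Complex.Gamma ((2 - ((1 : ℝ) + t * Complex.I)) / 2))⁻¹ :=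
    Complex.differentiable_one_div_Gamma.continuous.comp
      (f := fun t : ℝ => (2 - (((1 : ℝ) : ℂ) + t * Complex.I)) / 2) (by fun_prop)
  have h3 : Continuous fun t : ℝ => mellin (fun x : ℝ => (F x : ℂ)) ((1 : ℝ) + t * Complex.I) := by
    have : (fun t : ℝ => mellin (fun x : ℝ => (F x : ℂ)) ((1 : ℝ) + t * Complex.I)) = fun t : ℝ =>
        (1 / (2 * besselK0 2) : ℝ) * expMellin ((0 : ℝ) + t * Complex.I) /
          ((1 : ℝ) + t * Complex.I) := by
      funext t
      rw [← mul_mellin_F, mul_div_cancel_left₀ _ (one_add_mul_I_ne_zero t)]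
    rw [this]
    exact (continuous_const.mul (continuous_expMellin 0)).div (by fun_prop) one_add_mul_I_ne_zero
  exact (h1.mul h2).mul h3

theorem exists_norm_mellinKernelH_le (N : ℕ) :
    ∃ C : ℝ, ∀ t, (1 + |t|) ^ N * ‖mellinKernelH t‖ ≤ C := by
  obtain ⟨C, hC⟩ := exists_norm_expMellin_le (N + 1) 0
  refine ⟨|1 / (2 * besselK0 2)| * C, fun t => ?_⟩
  have h1 : ‖mellin (fun x : ℝ => (F x : ℂ)) ((1 : ℝ) + t * Complex.I)‖ ≤
      |1 / (2 * besselK0 2)| * ‖expMellin ((0 : ℝ) + t * Complex.I)‖ := by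
    have h := congrArg norm (mul_mellin_F t)
    rw [norm_mul, norm_mul, Complex.norm_real, Real.norm_eq_abs] at h
    rw [← h]
    refine le_mul_of_one_le_left (norm_nonneg _) ?_
    have := Complex.abs_re_le_norm (((1 : ℝ) : ℂ) + t * Complex.I)
    simpa using this
  rw [mellinKernelH, norm_mul]
  calc (1 + |t|) ^ N * (_ * _) ≤ (1 + |t|) ^ N * ((1 + |t|) *
        (|1 / (2 * besselK0 2)| * ‖expMellin ((0 : ℝ) + t * Complex.I)‖)) := by
        gcongr
        exact norm_Gamma_ratio_le t
    _ = |1 / (2 * besselK0 2)| * ((1 + |t|) ^ (N + 1) * ‖expMellin ((0 : ℝ) + t * Complex.I)‖) := by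
        ring
    _ ≤ _ := by gcongr; exact hC t

end BeyondEndoscopy

/-! ### F(y) + yH(y) as a smooth function of log y -/

namespace BeyondEndoscopy

open MeasureTheory Set Filter Topology

theorem integrable_of_decay {K : ℝ → ℂ} {C : ℝ} (hK : Continuous K)
    (hC : ∀ t, (1 + |t|) ^ 2 * ‖K t‖ ≤ C) : Integrable K := by
  refine (integrable_inv_one_add_sq.const_mul C).mono' hK.aestronglyMeasurable ?_
  filter_upwards with t
  rw [← div_eq_mul_inv, le_div_iff₀ (by positivity)]
  refine le_trans ?_ (hC t)
  rw [mul_comm]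
  gcongr
  nlinarith [abs_nonneg t, sq_abs t]

/-- The oscillatory integral `∫ exp (-its) K(t) dt`. -/
noncomputable def expIntegral (K : ℝ → ℂ) (s : ℝ) : ℂ :=
  ∫ t : ℝ, Complex.exp (((-(t * s) : ℝ) : ℂ) * Complex.I) * K t

theorem norm_exp_mul_I_mul (x : ℝ) (z : ℂ) : ‖Complex.exp ((x : ℂ) * Complex.I) * z‖ = ‖z‖ := by
  rw [norm_mul, Complex.norm_exp_ofReal_mul_I, one_mul]

theorem norm_expIntegral_le (K : ℝ → ℂ) (s : ℝ) : ‖expIntegral K s‖ ≤ ∫ t, ‖K t‖ :=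
  (norm_integral_le_integral_norm _).trans (le_of_eq (by simp only [norm_exp_mul_I_mul]))

/-- Differentiation under the integral brings down a factor t. Decay of order 3 leaves order 2 for
the new integrand, which suffices for integrability. -/
theorem hasDerivAt_expIntegral {K : ℝ → ℂ} {C : ℝ} (hK : Continuous K)
    (hC : ∀ t, (1 + |t|) ^ 3 * ‖K t‖ ≤ C) (s : ℝ) :
    HasDerivAt (expIntegral K) (expIntegral (fun t => (-t * Complex.I) * K t) s) s := by
  set K1 : ℝ → ℂ := fun t => (-t * Complex.I) * K t with hK1
  have cK1 : Continuous K1 := by fun_prop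
  have nK1 : ∀ t, ‖K1 t‖ = |t| * ‖K t‖ := fun t => by simp [hK1]
  have i0 : Integrable K := integrable_of_decay (C := C) hK fun t => by
    refine le_trans ?_ (hC t)
    gcongr
    · linarith [abs_nonneg t]
    · norm_num
  have i1 : Integrable K1 := integrable_of_decay (C := C) cK1 fun t => by
    refine le_trans ?_ (hC t)
    rw [nK1, ← mul_assoc, pow_succ _ 2]
    gcongr
    linarith [abs_nonneg t]
  refine (hasDerivAt_integral_of_dominated_loc_of_deriv_le (bound := fun t => ‖K1 t‖)
    (F := fun s t => Complex.exp (((-(t * s) : ℝ) : ℂ) * Complex.I) * K t)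
    (F' := fun s t => Complex.exp (((-(t * s) : ℝ) : ℂ) * Complex.I) * K1 t)
    (s := univ) univ_mem (Eventually.of_forall fun s => Continuous.aestronglyMeasurable (by fun_prop))
    ?_ (Continuous.aestronglyMeasurable (by fun_prop)) ?_ i1.norm ?_).2
  · exact i0.mono (Continuous.aestronglyMeasurable (by fun_prop))
      (Eventually.of_forall fun t => by rw [norm_exp_mul_I_mul])
  · filter_upwards with t x _
    rw [norm_exp_mul_I_mul]
  · filter_upwards with t x _
    have h1 : HasDerivAt (fun x : ℝ => (((-(t * x) : ℝ) : ℂ) * Complex.I)) (-t * Complex.I) x := by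
      have := (((hasDerivAt_id x).const_mul t).neg.ofReal_comp).mul_const Complex.I
      simpa using this
    have := h1.cexp.mul_const (K t)
    exact this.congr_deriv (by simp only [hK1]; ring)

/-- `y H(y)` is an oscillatory integral in `log (π y)`. -/
theorem mul_H_eq {y : ℝ} (hy : 0 < y) : (y : ℂ) * H y =
    (Real.sqrt Real.pi / (2 * Real.pi ^ 2) : ℝ) *
      expIntegral mellinKernelH (Real.log y + Real.log Real.pi) := by
  have hpi := Real.pi_pos
  have hpy : 0 < Real.pi * y := by positivity
  -- On Re u = 1 one has (πy)^{-u} = (πy)^{-1} exp(-it log(πy)). The first factor cancels the y in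
  -- front and leaves the extra π in the constant.
  rw [H, mellinInv, expIntegral, Complex.real_smul, ← integral_const_mul, ← integral_const_mul,
    ← integral_const_mul, ← integral_const_mul]
  refine integral_congr_ae (Eventually.of_forall fun t => ?_)
  simp only [smul_eq_mul]
  have hne : ((Real.pi * y : ℝ) : ℂ) ≠ 0 := by exact_mod_cast hpy.ne'
  have h1 : ((Real.pi * y : ℝ) : ℂ) ^ (-(((1 : ℝ) : ℂ) + t * Complex.I)) =
      ((Real.pi * y : ℝ) : ℂ)⁻¹ * Complex.exp (((-(t * (Real.log y + Real.log Real.pi)) : ℝ) : ℂ) *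
        Complex.I) := by
    rw [neg_add, Complex.cpow_add _ _ hne, Complex.ofReal_one, Complex.cpow_neg_one,
      Complex.cpow_def_of_ne_zero hne, ← Complex.ofReal_log hpy.le, Real.log_mul hpi.ne' hy.ne']
    congr 2
    push_cast
    ring
  rw [h1]
  simp only [mellinKernelH]
  have hy' : (y : ℂ) ≠ 0 := by exact_mod_cast hy.ne'
  have hpi' : (Real.pi : ℂ) ≠ 0 := by exact_mod_cast hpi.ne'
  push_cast
  field_simp

theorem abs_two_mul_exp_sub_le (s : ℝ) : |(-Real.exp s + Real.exp (-s))| ≤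
    Real.exp s + Real.exp (-s) := by
  have h1 := Real.exp_pos s
  have h2 := Real.exp_pos (-s)
  rw [abs_le]
  constructor <;> linarith

/-- In the variable `log y`, the function `F(y) + y H(y)` is twice differentiable with bounded
derivatives. -/
theorem exists_F_add_mul_H_eq : ∃ (φ φ₁ φ₂ : ℝ → ℂ) (M : ℝ), (∀ s, HasDerivAt φ (φ₁ s) s) ∧
    (∀ s, HasDerivAt φ₁ (φ₂ s) s) ∧ Continuous φ₂ ∧ (∀ s, ‖φ s‖ ≤ M) ∧ (∀ s, ‖φ₁ s‖ ≤ M) ∧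
    (∀ s, ‖φ₂ s‖ ≤ M) ∧ ∀ y > 0, (F y : ℂ) + y * H y = φ (Real.log y) := by
  set c : ℝ := 1 / (2 * besselK0 2) with hc
  set b : ℝ := Real.sqrt Real.pi / (2 * Real.pi ^ 2) with hb
  set K := mellinKernelH with hK
  set K1 : ℝ → ℂ := fun t => (-t * Complex.I) * K t with hK1
  set K2 : ℝ → ℂ := fun t => (-t * Complex.I) * K1 t with hK2
  -- Two derivatives cost two powers of t, and `K2` must still decay to order 3, because its
  -- integral is shown to be continuous by differentiating once more.
  obtain ⟨CK, hCK⟩ := exists_norm_mellinKernelH_le 5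
  have cK : Continuous K := continuous_mellinKernelH
  have cK1 : Continuous K1 := by fun_prop
  have cK2 : Continuous K2 := by fun_prop
  have one_le : ∀ t : ℝ, 1 ≤ 1 + |t| := fun t => by linarith [abs_nonneg t]
  have dec : ∀ (N : ℕ) (J : ℝ → ℂ), (∀ t, (1 + |t|) ^ (N + 1) * ‖J t‖ ≤ CK) →
      ∀ t, (1 + |t|) ^ N * ‖(-t * Complex.I) * J t‖ ≤ CK := by
    intro N J hJ t
    refine le_trans ?_ (hJ t)
    have : ‖(-t * Complex.I : ℂ) * J t‖ = |t| * ‖J t‖ := by simp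
    rw [this, pow_succ, mul_assoc]
    gcongr
    linarith
  have d1 : ∀ t, (1 + |t|) ^ 4 * ‖K1 t‖ ≤ CK := dec 4 K hCK
  have d2 : ∀ t, (1 + |t|) ^ 3 * ‖K2 t‖ ≤ CK := dec 3 K1 d1
  have h0 : ∀ t, (1 + |t|) ^ 3 * ‖K t‖ ≤ CK := fun t =>
    le_trans (mul_le_mul_of_nonneg_right (pow_le_pow_right₀ (one_le t) (by norm_num))
      (norm_nonneg _)) (hCK t)
  have h1 : ∀ t, (1 + |t|) ^ 3 * ‖K1 t‖ ≤ CK := fun t =>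
    le_trans (mul_le_mul_of_nonneg_right (pow_le_pow_right₀ (one_le t) (by norm_num))
      (norm_nonneg _)) (d1 t)
  set q : ℝ → ℝ := fun s => expNegAddInv (Real.exp s) with hq
  have qeq : ∀ s, q s = Real.exp (-Real.exp s - Real.exp (-s)) := fun s => by
    simp only [hq, expNegAddInv, one_div, Real.exp_neg]
  have dq : ∀ s, HasDerivAt q (q s * (-Real.exp s + Real.exp (-s))) s := by
    intro s
    have e1 : HasDerivAt (fun s => -Real.exp s - Real.exp (-s)) (-Real.exp s + Real.exp (-s)) s := by
      have := (Real.hasDerivAt_exp s).neg.sub ((hasDerivAt_id s).neg.exp)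
      exact this.congr_deriv (by simp)
    have e2 := e1.exp
    rw [← qeq] at e2
    refine e2.congr_of_eventuallyEq (Eventually.of_forall qeq)
  have cq : Continuous q := continuous_iff_continuousAt.2 fun s => (dq s).continuousAt
  have dF : ∀ s, HasDerivAt (fun s => F (Real.exp s)) (-c * q s) s := by
    intro s
    have := (hasDerivAt_F (Real.exp_pos s)).comp s (Real.hasDerivAt_exp s)
    refine this.congr_deriv ?_
    change -c * (q s / Real.exp s) * Real.exp s = -c * q s
    rw [mul_assoc, div_mul_cancel₀ _ (Real.exp_pos s).ne']
  obtain ⟨CF, hCF⟩ := exists_abs_F_le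
  obtain ⟨C0, hC0⟩ := exists_expNegAddInv_mul_rpow_le 0
  obtain ⟨C1, hC1⟩ := exists_expNegAddInv_mul_rpow_le 1
  obtain ⟨C2, hC2⟩ := exists_expNegAddInv_mul_rpow_le (-1)
  have bq : ∀ s, |q s| ≤ C0 := fun s => by
    have := hC0 _ (Real.exp_pos s)
    rw [Real.rpow_zero, mul_one] at this
    rw [abs_of_nonneg (expNegAddInv_nonneg _)]
    exact this
  have bq' : ∀ s, |q s * (-Real.exp s + Real.exp (-s))| ≤ C1 + C2 := fun s => by
    have e1 := hC1 _ (Real.exp_pos s)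
    have e2 := hC2 _ (Real.exp_pos s)
    rw [Real.rpow_one] at e1
    rw [Real.rpow_neg_one, ← Real.exp_neg] at e2
    rw [abs_mul, abs_of_nonneg (expNegAddInv_nonneg _ : 0 ≤ q s)]
    calc _ ≤ q s * (Real.exp s + Real.exp (-s)) :=
          mul_le_mul_of_nonneg_left (abs_two_mul_exp_sub_le s) (expNegAddInv_nonneg _)
      _ = expNegAddInv (Real.exp s) * Real.exp s + expNegAddInv (Real.exp s) * Real.exp (-s) := by
          simp only [hq]; ring
      _ ≤ _ := add_le_add e1 e2
  have dE : ∀ (J : ℝ → ℂ), Continuous J → (∀ t, (1 + |t|) ^ 3 * ‖J t‖ ≤ CK) → ∀ s,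
      HasDerivAt (fun s => (b : ℂ) * expIntegral J (s + Real.log Real.pi))
        ((b : ℂ) * expIntegral (fun t => (-t * Complex.I) * J t) (s + Real.log Real.pi)) s := by
    intro J cJ hJ s
    have := (hasDerivAt_expIntegral cJ hJ (s + Real.log Real.pi)).comp_add_const s (Real.log Real.pi)
    exact this.const_mul _
  have bE : ∀ (J : ℝ → ℂ) (s : ℝ), ‖(b : ℂ) * expIntegral J (s + Real.log Real.pi)‖ ≤
      |b| * ∫ t, ‖J t‖ := by
    intro J s
    rw [norm_mul, Complex.norm_real, Real.norm_eq_abs]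
    exact mul_le_mul_of_nonneg_left (norm_expIntegral_le _ _) (abs_nonneg _)
  have pE : ∀ J : ℝ → ℂ, 0 ≤ |b| * ∫ t, ‖J t‖ := fun J => by positivity
  have pF : 0 ≤ CF := (abs_nonneg _).trans (hCF 1 one_pos).1
  have p0 : 0 ≤ |c| * C0 := mul_nonneg (abs_nonneg _) ((abs_nonneg _).trans (bq 0))
  have p1 : 0 ≤ |c| * (C1 + C2) := mul_nonneg (abs_nonneg _) ((abs_nonneg _).trans (bq' 0))
  refine ⟨fun s => (F (Real.exp s) : ℂ) + b * expIntegral K (s + Real.log Real.pi),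
    fun s => ((-c * q s : ℝ) : ℂ) + b * expIntegral K1 (s + Real.log Real.pi),
    fun s => ((-c * (q s * (-Real.exp s + Real.exp (-s))) : ℝ) : ℂ) +
      b * expIntegral K2 (s + Real.log Real.pi),
    CF + |c| * C0 + |c| * (C1 + C2) + (|b| * ∫ t, ‖K t‖) + (|b| * ∫ t, ‖K1 t‖) +
      (|b| * ∫ t, ‖K2 t‖),
    fun s => ?_, fun s => ?_, ?_, fun s => ?_, fun s => ?_, fun s => ?_, fun y hy => ?_⟩
  · exact (dF s).ofReal_comp.add (dE K cK h0 s)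
  · exact ((dq s).const_mul (-c)).ofReal_comp.add (dE K1 cK1 h1 s)
  · refine Continuous.add (by fun_prop) ?_
    exact continuous_iff_continuousAt.2 fun s => (dE K2 cK2 d2 s).continuousAt
  · refine (norm_add_le _ _).trans ?_
    have e1 : ‖(F (Real.exp s) : ℂ)‖ ≤ CF := by
      rw [Complex.norm_real]; exact (hCF _ (Real.exp_pos s)).1
    linarith [bE K s, pE K1, pE K2]
  · refine (norm_add_le _ _).trans ?_
    have e1 : ‖((-c * q s : ℝ) : ℂ)‖ ≤ |c| * C0 := by
      rw [Complex.norm_real, Real.norm_eq_abs, abs_mul, abs_neg]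
      exact mul_le_mul_of_nonneg_left (bq s) (abs_nonneg _)
    linarith [bE K1 s, pE K, pE K2]
  · refine (norm_add_le _ _).trans ?_
    have e1 : ‖((-c * (q s * (-Real.exp s + Real.exp (-s))) : ℝ) : ℂ)‖ ≤ |c| * (C1 + C2) := by
      rw [Complex.norm_real, Real.norm_eq_abs, abs_mul, abs_neg]
      exact mul_le_mul_of_nonneg_left (bq' s) (abs_nonneg _)
    linarith [bE K2 s, pE K, pE K1]
  · change _ = (F (Real.exp (Real.log y)) : ℂ) + b * expIntegral K (Real.log y + Real.log Real.pi)
    rw [mul_H_eq hy, Real.exp_log hy]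

end BeyondEndoscopy

/-! ### The amplitude and its derivatives -/

namespace BeyondEndoscopy

open MeasureTheory Set Filter Topology

-- With z² = x² - 1, conjugating z gives conjugate elements of ℂ[x] + zℂ[x]. The difference of the
-- two powers is therefore z times a polynomial, which exhibits the square root in θ_∞.
open Polynomial in
theorem exists_polynomial_add_sqrt_pow (n : ℕ) : ∃ P Q : ℂ[X], ∀ x z : ℂ, z ^ 2 = x ^ 2 - 1 →
    (x + z) ^ n = Q.eval x + z * P.eval x ∧ (x - z) ^ n = Q.eval x - z * P.eval x := by
  induction n with
  | zero => exact ⟨0, 1, fun x z _ => by simp⟩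
  | succ n ih =>
    obtain ⟨P, Q, h⟩ := ih
    refine ⟨Q + X * P, X * Q + (X ^ 2 - 1) * P, fun x z hz => ?_⟩
    obtain ⟨h1, h2⟩ := h x z hz
    simp only [eval_add, eval_mul, eval_X, eval_sub, eval_pow, eval_one]
    rw [pow_succ (x + z), pow_succ (x - z), h1, h2, ← hz]
    constructor <;> ring

open Polynomial ComplexOrder in
/-- On `[-1, 1]`, `θ_∞(x)` is a polynomial multiple of `√(1 - x²)`. -/
theorem exists_thetaInf_eq (k : ℕ) : ∃ P : ℂ[X], ∀ x ∈ Icc (-1 : ℝ) 1,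
    thetaInf k x = (√(1 - x ^ 2) : ℝ) * P.eval (x : ℂ) := by
  obtain ⟨P, Q, h⟩ := exists_polynomial_add_sqrt_pow (k - 1)
  refine ⟨C (-(1 / Real.pi : ℂ)) * P, fun x hx => ?_⟩
  by_cases hx1 : |x| < 1
  · have hw : 0 ≤ 1 - x ^ 2 := by nlinarith [hx.1, hx.2]
    have hz : Complex.sqrt ((x : ℂ) ^ 2 - 1) = Complex.I * (√(1 - x ^ 2) : ℝ) := by
      have e1 : (x : ℂ) ^ 2 - 1 = -((1 - x ^ 2 : ℝ) : ℂ) := by push_cast; ring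
      have e2 : (0 : ℂ) ≤ ((1 - x ^ 2 : ℝ) : ℂ) := Complex.zero_le_real.2 hw
      rw [e1, Complex.sqrt_neg_of_nonneg e2, Complex.sqrt_of_nonneg e2,
        Complex.ofReal_re]
    have hz2 : (Complex.I * (√(1 - x ^ 2) : ℝ)) ^ 2 = (x : ℂ) ^ 2 - 1 := by
      rw [mul_pow, Complex.I_sq, ← Complex.ofReal_pow, Real.sq_sqrt hw]
      push_cast
      ring
    obtain ⟨h1, h2⟩ := h x _ hz2
    rw [thetaInf, if_pos hx1, hz, h1, h2, eval_mul, eval_C]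
    have : (Real.pi : ℂ) ≠ 0 := by exact_mod_cast Real.pi_pos.ne'
    field_simp
    ring_nf
    simp only [Complex.I_sq]
    ring
  · have hx2 : 1 - x ^ 2 = 0 := by
      have h1 : |x| = 1 := le_antisymm (abs_le.2 ⟨hx.1, hx.2⟩) (not_lt.1 hx1)
      rw [← sq_abs, h1]; norm_num
    rw [thetaInf, if_neg hx1, hx2]
    simp

open Polynomial in
theorem exists_norm_eval_le (P : ℂ[X]) : ∃ B : ℝ, ∀ x ∈ Icc (-1 : ℝ) 1, ‖P.eval (x : ℂ)‖ ≤ B := by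
  obtain ⟨B, hB⟩ := isCompact_Icc.exists_bound_of_continuousOn (s := Icc (-1 : ℝ) 1)
    (f := fun x : ℝ => P.eval (x : ℂ))
    (P.continuous.comp Complex.continuous_ofReal).continuousOn
  exact ⟨B, hB⟩

theorem hasDerivAt_sqrt_one_sub_sq {x : ℝ} (hx : 0 < 1 - x ^ 2) :
    HasDerivAt (fun x : ℝ => √(1 - x ^ 2)) (-(x / √(1 - x ^ 2))) x := by
  have e1 : HasDerivAt (fun x : ℝ => 1 - x ^ 2) (-(2 * x)) x := by
    simpa using ((hasDerivAt_pow 2 x).const_sub 1)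
  exact (e1.sqrt hx.ne').congr_deriv (by field_simp)

theorem hasDerivAt_div_sqrt_one_sub_sq {x : ℝ} (hx : 0 < 1 - x ^ 2) :
    HasDerivAt (fun x : ℝ => x / √(1 - x ^ 2)) (1 / √(1 - x ^ 2) ^ 3) x := by
  have hs := Real.sqrt_pos.2 hx
  have e2 := (hasDerivAt_id x).div (hasDerivAt_sqrt_one_sub_sq hx) hs.ne'
  refine e2.congr_deriv ?_
  have h2 : √(1 - x ^ 2) ^ 2 = 1 - x ^ 2 := Real.sq_sqrt hx.le
  simp only [id]
  field_simp
  rw [h2]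
  ring

/-- The archimedean amplitude in `fourierI`. -/
noncomputable def amplitude (k : ℕ) (A x : ℝ) : ℂ :=
  thetaInf k x * ((F (A / √(1 - x ^ 2)) : ℂ) +
    ((A / √(1 - x ^ 2) : ℝ) : ℂ) * H (A / √(1 - x ^ 2)))

/-- The amplitude is integrable, and its integral against an oscillating factor exhibits
cancellation, uniformly in the parameter `A`. -/
theorem exists_norm_integral_amplitude_mul_le (k : ℕ) : ∃ K : ℝ, 0 ≤ K ∧ ∀ A > 0,
    IntervalIntegrable (amplitude k A) volume (-1) 1 ∧ ∀ (h h₁ h₂ : ℝ → ℂ) (M₁ M₂ δ : ℝ), Continuous h → (∀ x, HasDerivAt h₁ (h x) x) →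
    (∀ x, HasDerivAt h₂ (h₁ x) x) → (∀ x, ‖h₁ x‖ ≤ M₁) → (∀ x, ‖h₂ x‖ ≤ M₂) → 0 < δ → δ ≤ 1 / 2 →
    ‖∫ x in (-1 : ℝ)..1, amplitude k A x * h x‖ ≤ K * (8 * √δ * M₁ + 4 * M₂ / √δ) := by
  obtain ⟨φ, φ₁, φ₂, M, dφ, dφ₁, cφ₂, bφ, bφ₁, bφ₂, hφ⟩ := exists_F_add_mul_H_eq
  obtain ⟨P, hP⟩ := exists_thetaInf_eq k
  obtain ⟨B0, hB0⟩ := exists_norm_eval_le P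
  obtain ⟨B1, hB1⟩ := exists_norm_eval_le (Polynomial.derivative P)
  obtain ⟨B2, hB2⟩ := exists_norm_eval_le (Polynomial.derivative (Polynomial.derivative P))
  have hM : 0 ≤ M := (norm_nonneg _).trans (bφ 0)
  have z1 : (0 : ℝ) ∈ Icc (-1 : ℝ) 1 := by norm_num
  have p0 : 0 ≤ B0 := (norm_nonneg _).trans (hB0 0 z1)
  have p1 : 0 ≤ B1 := (norm_nonneg _).trans (hB1 0 z1)
  have p2 : 0 ≤ B2 := (norm_nonneg _).trans (hB2 0 z1)
  set B := B0 + B1 + B2 with hB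
  have b0 : ∀ x ∈ Icc (-1 : ℝ) 1, ‖P.eval (x : ℂ)‖ ≤ B := fun x hx => by linarith [hB0 x hx]
  have b1 : ∀ x ∈ Icc (-1 : ℝ) 1, ‖(Polynomial.derivative P).eval (x : ℂ)‖ ≤ B := fun x hx => by
    linarith [hB1 x hx]
  have b2 : ∀ x ∈ Icc (-1 : ℝ) 1,
      ‖(Polynomial.derivative (Polynomial.derivative P)).eval (x : ℂ)‖ ≤ B := fun x hx => by
    linarith [hB2 x hx]
  have pB : 0 ≤ B := by linarith
  -- The second derivative is the worst case: its four products contribute 1, 2, 2 and 4 times `B *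
  -- M / w ^ 3`. No dependence on `A` enters, as `A` only translates the argument of φ and the
  -- bounds on φ hold on the whole line.
  refine ⟨9 * B * M, by positivity, fun A hA => ?_⟩
  set w : ℝ → ℝ := fun x => √(1 - x ^ 2) with hw
  set L : ℝ → ℝ := fun x => Real.log A - Real.log (w x) with hL
  have wpos : ∀ x ∈ Ioo (-1 : ℝ) 1, 0 < 1 - x ^ 2 := fun x hx => by nlinarith [hx.1, hx.2]
  have wpos' : ∀ x ∈ Ioo (-1 : ℝ) 1, 0 < w x := fun x hx => Real.sqrt_pos.2 (wpos x hx)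
  have wle : ∀ x, w x ≤ 1 := fun x => by
    simp only [hw]
    rw [Real.sqrt_le_one]
    nlinarith [sq_nonneg x]
  have dw : ∀ x ∈ Ioo (-1 : ℝ) 1, HasDerivAt w (-(x / w x)) x := fun x hx =>
    hasDerivAt_sqrt_one_sub_sq (wpos x hx)
  have dv : ∀ x ∈ Ioo (-1 : ℝ) 1, HasDerivAt (fun x => x / w x) (1 / w x ^ 3) x := fun x hx =>
    hasDerivAt_div_sqrt_one_sub_sq (wpos x hx)
  have dL : ∀ x ∈ Ioo (-1 : ℝ) 1, HasDerivAt L (x / w x ^ 2) x := fun x hx => by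
    have := ((dw x hx).log (wpos' x hx).ne').const_sub (Real.log A)
    refine this.congr_deriv ?_
    have := (wpos' x hx).ne'
    field_simp
  set Ψ : ℝ → ℂ := fun x => (w x : ℂ) * φ (L x) with hΨ
  -- Since L' = x/w² and w' = -x/w, differentiating φ(L) costs no more than differentiating w: both
  -- terms carry the same factor x/w.
  set Ψ₁ : ℝ → ℂ := fun x => ((x / w x : ℝ) : ℂ) * (φ₁ (L x) - φ (L x)) with hΨ₁
  set Ψ₂ : ℝ → ℂ := fun x => ((1 / w x ^ 3 : ℝ) : ℂ) * (φ₁ (L x) - φ (L x)) +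
    ((x ^ 2 / w x ^ 3 : ℝ) : ℂ) * (φ₂ (L x) - φ₁ (L x)) with hΨ₂
  have dφL : ∀ x ∈ Ioo (-1 : ℝ) 1, HasDerivAt (fun x => φ (L x))
      (((x / w x ^ 2 : ℝ) : ℂ) * φ₁ (L x)) x := fun x hx => by
    exact ((dφ (L x)).scomp x (dL x hx)).congr_deriv (by rw [Complex.real_smul])
  have dφ₁L : ∀ x ∈ Ioo (-1 : ℝ) 1, HasDerivAt (fun x => φ₁ (L x))
      (((x / w x ^ 2 : ℝ) : ℂ) * φ₂ (L x)) x := fun x hx => by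
    exact ((dφ₁ (L x)).scomp x (dL x hx)).congr_deriv (by rw [Complex.real_smul])
  have dΨ : ∀ x ∈ Ioo (-1 : ℝ) 1, HasDerivAt Ψ (Ψ₁ x) x := fun x hx => by
    have := (dw x hx).ofReal_comp.mul (dφL x hx)
    refine this.congr_deriv ?_
    have hne : (w x : ℂ) ≠ 0 := by exact_mod_cast (wpos' x hx).ne'
    simp only [hΨ₁]
    push_cast
    field_simp
    ring
  have dΨ₁ : ∀ x ∈ Ioo (-1 : ℝ) 1, HasDerivAt Ψ₁ (Ψ₂ x) x := fun x hx => by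
    have := (dv x hx).ofReal_comp.mul ((dφ₁L x hx).sub (dφL x hx))
    refine this.congr_deriv ?_
    have hne : (w x : ℂ) ≠ 0 := by exact_mod_cast (wpos' x hx).ne'
    simp only [hΨ₂, Pi.sub_apply]
    push_cast
    field_simp
  have dP : ∀ (R : Polynomial ℂ) (x : ℝ), HasDerivAt (fun x : ℝ => R.eval (x : ℂ))
      ((Polynomial.derivative R).eval (x : ℂ)) x := fun R x => (R.hasDerivAt (x : ℂ)).comp_ofReal
  set P₁ := Polynomial.derivative P with hP₁
  set P₂ := Polynomial.derivative P₁ with hP₂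
  have nw : ∀ x ∈ Ioo (-1 : ℝ) 1, ‖Ψ x‖ ≤ M * w x := fun x hx => by
    simp only [hΨ]
    rw [norm_mul, Complex.norm_real, Real.norm_eq_abs, abs_of_pos (wpos' x hx), mul_comm]
    exact mul_le_mul_of_nonneg_right (bφ _) (wpos' x hx).le
  have n1 : ∀ s, ‖φ₁ s - φ s‖ ≤ 2 * M := fun s =>
    (norm_sub_le _ _).trans (by linarith [bφ s, bφ₁ s])
  have n2 : ∀ s, ‖φ₂ s - φ₁ s‖ ≤ 2 * M := fun s =>
    (norm_sub_le _ _).trans (by linarith [bφ₂ s, bφ₁ s])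
  have nΨ₁ : ∀ x ∈ Ioo (-1 : ℝ) 1, ‖Ψ₁ x‖ ≤ 2 * M / w x := fun x hx => by
    have hwx := wpos' x hx
    simp only [hΨ₁]
    rw [norm_mul, Complex.norm_real, Real.norm_eq_abs, abs_div, abs_of_pos hwx]
    have hx1 : |x| ≤ 1 := abs_le.2 ⟨hx.1.le, hx.2.le⟩
    calc _ ≤ 1 / w x * (2 * M) := by gcongr; exact n1 _
      _ = _ := by ring
  have nΨ₂ : ∀ x ∈ Ioo (-1 : ℝ) 1, ‖Ψ₂ x‖ ≤ 4 * M / w x ^ 3 := fun x hx => by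
    have hwx := wpos' x hx
    simp only [hΨ₂]
    refine (norm_add_le _ _).trans ?_
    rw [norm_mul, norm_mul, Complex.norm_real, Real.norm_eq_abs, Complex.norm_real,
      Real.norm_eq_abs, abs_of_pos (by positivity : 0 < 1 / w x ^ 3),
      abs_of_nonneg (by positivity : 0 ≤ x ^ 2 / w x ^ 3)]
    have hx1 : x ^ 2 ≤ 1 := by nlinarith [hx.1, hx.2]
    calc _ ≤ 1 / w x ^ 3 * (2 * M) + 1 / w x ^ 3 * (2 * M) := by
          gcongr
          · exact n1 _
          · exact n2 _
      _ = _ := by ring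
  have winv : ∀ x ∈ Ioo (-1 : ℝ) 1, w x ≤ 1 / w x ∧ 1 / w x ≤ 1 / w x ^ 3 := fun x hx => by
    have hwx := wpos' x hx
    have h1 := wle x
    constructor
    · rw [le_div_iff₀ hwx]; nlinarith
    · apply one_div_le_one_div_of_le (by positivity)
      have : w x ^ 2 ≤ 1 := by nlinarith
      nlinarith
  have cw : ContinuousOn w (Ioo (-1 : ℝ) 1) := fun x hx => (dw x hx).continuousAt.continuousWithinAt
  have cL : ContinuousOn L (Ioo (-1 : ℝ) 1) := fun x hx => (dL x hx).continuousAt.continuousWithinAt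
  have cΨ : ContinuousOn Ψ (Ioo (-1 : ℝ) 1) := fun x hx => (dΨ x hx).continuousAt.continuousWithinAt
  have cΨ₁ : ContinuousOn Ψ₁ (Ioo (-1 : ℝ) 1) := fun x hx =>
    (dΨ₁ x hx).continuousAt.continuousWithinAt
  have cφ : Continuous φ := continuous_iff_continuousAt.2 fun s => (dφ s).continuousAt
  have cφ₁ : Continuous φ₁ := continuous_iff_continuousAt.2 fun s => (dφ₁ s).continuousAt
  have cΨ₂ : ContinuousOn Ψ₂ (Ioo (-1 : ℝ) 1) := by
    have hne : ∀ x ∈ Ioo (-1 : ℝ) 1, w x ^ 3 ≠ 0 := fun x hx => (pow_pos (wpos' x hx) 3).ne'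
    refine ContinuousOn.add (ContinuousOn.mul ?_ ?_) (ContinuousOn.mul ?_ ?_)
    · exact Complex.continuous_ofReal.comp_continuousOn (continuousOn_const.div (cw.pow 3) hne)
    · exact (cφ₁.comp_continuousOn cL).sub (cφ.comp_continuousOn cL)
    · exact Complex.continuous_ofReal.comp_continuousOn
        ((continuous_pow 2).continuousOn.div (cw.pow 3) hne)
    · exact (cφ₂.comp_continuousOn cL).sub (cφ₁.comp_continuousOn cL)
  have cP : ∀ R : Polynomial ℂ, ContinuousOn (fun x : ℝ => R.eval (x : ℂ)) (Ioo (-1 : ℝ) 1) :=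
    fun R => (R.continuous.comp Complex.continuous_ofReal).continuousOn
  have heq : ∀ x ∈ Icc (-1 : ℝ) 1, amplitude k A x = P.eval (x : ℂ) * Ψ x := by
    intro x hx
    rw [amplitude, hP x hx]
    by_cases hx1 : x ∈ Ioo (-1 : ℝ) 1
    · have hwx := wpos' x hx1
      rw [hφ _ (div_pos hA hwx), Real.log_div hA.ne' hwx.ne']
      simp only [hΨ, hL, hw]
      ring
    · have hx2 : 1 - x ^ 2 = 0 := by
        have : x = -1 ∨ x = 1 := by
          by_contra hcon
          push Not at hcon
          exact hx1 ⟨lt_of_le_of_ne hx.1 (Ne.symm hcon.1), lt_of_le_of_ne hx.2 hcon.2⟩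
        rcases this with rfl | rfl <;> norm_num
      simp only [hΨ, hw, hx2]
      simp
  refine ⟨?_, fun h h₁ h₂ M₁ M₂ δ ch dh₁ dh₂ bh₁ bh₂ hδ hδ' => ?_⟩
  · rw [intervalIntegrable_iff_integrableOn_Ioo_of_le (by norm_num)]
    have hm : AEStronglyMeasurable (fun x : ℝ => P.eval (x : ℂ) * Ψ x)
        (volume.restrict (Ioo (-1 : ℝ) 1)) := ((cP P).mul cΨ).aestronglyMeasurable measurableSet_Ioo
    have hi : IntegrableOn (fun x : ℝ => P.eval (x : ℂ) * Ψ x) (Ioo (-1 : ℝ) 1) := by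
      refine (integrableOn_const (C := B * M) (by simp)).mono' hm ?_
      filter_upwards [ae_restrict_mem measurableSet_Ioo] with x hx
      rw [norm_mul]
      exact mul_le_mul (b0 x (Ioo_subset_Icc_self hx))
        ((nw x hx).trans (mul_le_of_le_one_right hM (wle x))) (norm_nonneg _) pB
    exact hi.congr_fun (fun x hx => (heq x (Ioo_subset_Icc_self hx)).symm) measurableSet_Ioo
  have key := norm_integral_mul_le_of_sqrt_singularity
    (G := fun x => P.eval (x : ℂ) * Ψ x)
    (G₁ := fun x => P₁.eval (x : ℂ) * Ψ x + P.eval (x : ℂ) * Ψ₁ x)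
    (G₂ := fun x => (P₂.eval (x : ℂ) * Ψ x + P₁.eval (x : ℂ) * Ψ₁ x) +
      (P₁.eval (x : ℂ) * Ψ₁ x + P.eval (x : ℂ) * Ψ₂ x)) (K := 9 * B * M)
    (fun x hx => (dP P x).mul (dΨ x hx))
    (fun x hx => ((dP P₁ x).mul (dΨ x hx)).add ((dP P x).mul (dΨ₁ x hx)))
    ((((cP P₂).mul cΨ).add ((cP P₁).mul cΨ₁)).add (((cP P₁).mul cΨ₁).add ((cP P).mul cΨ₂)))
    (fun x hx => by
      have hw0 : 0 ≤ w x := Real.sqrt_nonneg _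
      rw [norm_mul]
      have h1 : ‖Ψ x‖ ≤ M * w x := by
        simp only [hΨ]
        rw [norm_mul, Complex.norm_real, Real.norm_eq_abs, abs_of_nonneg hw0, mul_comm]
        exact mul_le_mul_of_nonneg_right (bφ _) hw0
      calc ‖P.eval (x : ℂ)‖ * ‖Ψ x‖ ≤ B * (M * w x) := by
            gcongr
            exact b0 x hx
        _ ≤ 9 * B * M * w x := by
            have : 0 ≤ B * (M * w x) := by positivity
            linarith)
    (fun x hx => by
      have hx' := Ioo_subset_Icc_self hx
      have hwx := wpos' x hx
      refine (norm_add_le _ _).trans ?_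
      rw [norm_mul (P₁.eval (x : ℂ)) (Ψ x), norm_mul (P.eval (x : ℂ)) (Ψ₁ x)]
      calc _ ≤ B * (M * w x) + B * (2 * M / w x) := by
            exact add_le_add (mul_le_mul (b1 x hx') (nw x hx) (norm_nonneg _) pB)
              (mul_le_mul (b0 x hx') (nΨ₁ x hx) (norm_nonneg _) pB)
        _ ≤ B * (M * (1 / w x)) + B * (2 * M / w x) := by
            gcongr
            exact (winv x hx).1
        _ = 3 * B * M / w x := by ring
        _ ≤ 9 * B * M / w x := by
            gcongr
            norm_num)
    (fun x hx => by
      have hx' := Ioo_subset_Icc_self hx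
      have hwx := wpos' x hx
      obtain ⟨w1, w2⟩ := winv x hx
      refine (norm_add_le _ _).trans ((add_le_add (norm_add_le _ _) (norm_add_le _ _)).trans ?_)
      rw [norm_mul (P₂.eval (x : ℂ)) (Ψ x), norm_mul (P₁.eval (x : ℂ)) (Ψ₁ x),
        norm_mul (P.eval (x : ℂ)) (Ψ₂ x)]
      calc _ ≤ (B * (M * w x) + B * (2 * M / w x)) + (B * (2 * M / w x) + B * (4 * M / w x ^ 3)) := by
            exact add_le_add (add_le_add (mul_le_mul (b2 x hx') (nw x hx) (norm_nonneg _) pB)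
              (mul_le_mul (b1 x hx') (nΨ₁ x hx) (norm_nonneg _) pB))
              (add_le_add (mul_le_mul (b1 x hx') (nΨ₁ x hx) (norm_nonneg _) pB)
              (mul_le_mul (b0 x hx') (nΨ₂ x hx) (norm_nonneg _) pB))
        _ = (B * M * w x + 4 * (B * M) * (1 / w x)) + 4 * (B * M) * (1 / w x ^ 3) := by ring
        _ ≤ (B * M * (1 / w x ^ 3) + 4 * (B * M) * (1 / w x ^ 3)) + 4 * (B * M) * (1 / w x ^ 3) := by
            gcongr
            exact w1.trans w2
        _ = _ := by ring)
    ch dh₁ dh₂ bh₁ bh₂ hδ hδ'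
  refine le_of_eq_of_le ?_ key
  congr 1
  refine intervalIntegral.integral_congr fun x hx => ?_
  rw [uIcc_of_le (by norm_num)] at hx
  simp only [heq x hx]

end BeyondEndoscopy

/-! ### Summing over ξ inside the integral -/

namespace BeyondEndoscopy

open MeasureTheory Set Filter Topology

theorem abs_kronecker_le_one (D : ℤ) (l : ℕ) : |kronecker D l| ≤ 1 := by
  rw [kronecker, abs_mul, abs_pow]
  have h1 : |ZMod.χ₈ (D : ZMod 8)| ≤ 1 := by
    rcases ZMod.isQuadratic_χ₈ (D : ZMod 8) with h | h | h <;> rw [h] <;> norm_num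
  have h2 : |jacobiSym D (l / 2 ^ padicValNat 2 l)| ≤ 1 := by
    rcases jacobiSym.trichotomy D (l / 2 ^ padicValNat 2 l) with h | h | h <;> rw [h] <;> norm_num
  exact mul_le_one₀ (pow_le_one₀ (abs_nonneg _) h1) (abs_nonneg _) h2

/-- All that is retained of the character sum: the coefficients are bounded by 1 and, decisively,
independent of ξ, so the sum over ξ can be carried out inside. -/
theorem exists_Kl_eq (l f n : ℕ) : ∃ c : ℕ → ℂ, (∀ a, ‖c a‖ ≤ 1) ∧ ∀ ξ : ℤ,
    Kl l f ξ n = ∑ a ∈ Finset.range (4 * l * f ^ 2), c a * e ((a : ℝ) * ξ / (4 * l * f ^ 2)) := by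
  classical
  refine ⟨fun a => if ((f : ℤ) ^ 2 ∣ (a : ℤ) ^ 2 - 4 * n ∧
        (((a : ℤ) ^ 2 - 4 * n) / (f : ℤ) ^ 2 ≡ 0 [ZMOD 4] ∨
          ((a : ℤ) ^ 2 - 4 * n) / (f : ℤ) ^ 2 ≡ 1 [ZMOD 4])) then
      (kronecker (((a : ℤ) ^ 2 - 4 * n) / (f : ℤ) ^ 2) l : ℂ) else 0, fun a => ?_, fun ξ => ?_⟩
  · dsimp only
    split_ifs
    · rw [Complex.norm_intCast]
      exact_mod_cast abs_kronecker_le_one _ l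
    · simp
  · rw [Kl, Finset.sum_filter]
    refine Finset.sum_congr rfl fun a _ => ?_
    dsimp only
    split_ifs
    · rfl
    · rw [zero_mul]

theorem hasDerivAt_e (x : ℝ) : HasDerivAt e (2 * Real.pi * Complex.I * e x) x := by
  have h1 : HasDerivAt (fun x : ℝ => 2 * Real.pi * Complex.I * (x : ℂ)) (2 * Real.pi * Complex.I) x := by
    simpa using (hasDerivAt_id x).ofReal_comp.const_mul (2 * Real.pi * Complex.I)
  exact h1.cexp.congr_deriv (by rw [e]; ring)

theorem continuous_e : Continuous e :=
  continuous_iff_continuousAt.2 fun x => (hasDerivAt_e x).continuousAt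

theorem hasDerivAt_expSum {A : ℕ} (hA : 0 < A) (B r : ℕ) (y : ℝ) :
    HasDerivAt (expSum A B (r + 1)) (2 * Real.pi * Complex.I * expSum A B r y) y := by
  have h : ∀ j ∈ Finset.Ico A B, HasDerivAt (fun y : ℝ => ((((j : ℝ) ^ (r + 1))⁻¹ : ℝ) : ℂ) * e (j * y))
      (2 * Real.pi * Complex.I * (((((j : ℝ) ^ r)⁻¹ : ℝ) : ℂ) * e (j * y))) y := by
    intro j hj
    have hj0 : (j : ℂ) ≠ 0 := by
      have := (Finset.mem_Ico.1 hj).1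
      exact_mod_cast (by omega : j ≠ 0)
    have h1 : HasDerivAt (fun y : ℝ => (j : ℝ) * y) j y := by
      simpa using (hasDerivAt_id y).const_mul (j : ℝ)
    have h2 := ((hasDerivAt_e (j * y)).scomp y h1).const_mul (((((j : ℝ) ^ (r + 1))⁻¹ : ℝ) : ℂ))
    refine h2.congr_deriv ?_
    rw [Complex.real_smul]
    push_cast
    field_simp
    ring
  have := HasDerivAt.fun_sum h
  rw [← Finset.mul_sum] at this
  exact this

theorem continuous_expSum (A B r : ℕ) : Continuous (expSum A B r) := by
  unfold expSum
  exact continuous_finsetSum _ fun j _ =>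
    continuous_const.mul (continuous_e.comp (continuous_const.mul continuous_id))

theorem norm_expSum_sign_mul (A B r : ℕ) {σ : ℝ} (hσ : σ = 1 ∨ σ = -1) (y : ℝ) :
    ‖expSum A B r (σ * y)‖ = ‖expSum A B r y‖ := by
  rcases hσ with rfl | rfl
  · rw [one_mul]
  · rw [neg_one_mul, expSum_neg]

/-- Summing over the dual variable `ξ = σ j` first, cancellation in the resulting Dirichlet kernels
bounds the sum of the products `Kl(ξ) I(ξ)`. -/
theorem exists_norm_sum_Kl_mul_fourierI_le (k : ℕ) : ∃ K : ℝ, 0 ≤ K ∧ ∀ (l f n A B : ℕ) (σ : ℤ) (δ : ℝ),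
    0 < l → 0 < f → 0 < n → 0 < A → 0 < B → (σ = 1 ∨ σ = -1) → 0 < δ → δ ≤ 1 / 2 →
    ‖∑ j ∈ Finset.Ico A B, Kl l f (σ * j) n * fourierI k l f (σ * j) n‖ ≤
      K * (8 * √δ * ((√n / (2 * (l * f ^ 2 : ℕ)))⁻¹ *
        (2 * (1 + Real.log B) + (A : ℝ)⁻¹ * (4 * l * f ^ 2 : ℕ) *
          (1 + Real.log (4 * l * f ^ 2 : ℕ)))) +
        4 * (((√n / (2 * (l * f ^ 2 : ℕ)))⁻¹) ^ 2 *
          (4 * (A : ℝ)⁻¹ + ((A : ℝ) ^ 2)⁻¹ * (4 * l * f ^ 2 : ℕ) *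
            (1 + Real.log (4 * l * f ^ 2 : ℕ)))) / √δ) := by
  obtain ⟨K, hK, hbound⟩ := exists_norm_integral_amplitude_mul_le k
  refine ⟨K, hK, fun l f n A B σ δ hl hf hn hA hB hσ hδ hδ' => ?_⟩
  obtain ⟨c, hc, hKl⟩ := exists_Kl_eq l f n
  set q : ℕ := 4 * l * f ^ 2 with hq
  have hq0 : 0 < q := by positivity
  have hn' : (0 : ℝ) < n := by exact_mod_cast hn
  have hl' : (0 : ℝ) < l := by exact_mod_cast hl
  have hf' : (0 : ℝ) < f := by exact_mod_cast hf
  set lam : ℝ := √n / (2 * (l * f ^ 2 : ℕ)) with hlam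
  have hlam0 : 0 < lam := by positivity
  have hσ' : (σ : ℝ) = 1 ∨ (σ : ℝ) = -1 := by
    rcases hσ with rfl | rfl <;> simp
  have hσ0 : (σ : ℝ) ≠ 0 := by rcases hσ' with h | h <;> rw [h] <;> norm_num
  have hσabs : |(σ : ℝ)| = 1 := by rcases hσ' with h | h <;> rw [h] <;> norm_num
  -- the oscillating factor and its antiderivatives
  set D : ℂ := 2 * Real.pi * Complex.I * (-(σ * lam : ℝ)) with hD
  have hD0 : D ≠ 0 := by
    have : (Real.pi : ℂ) ≠ 0 := by exact_mod_cast Real.pi_pos.ne'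
    have h2 : ((σ * lam : ℝ) : ℂ) ≠ 0 := by exact_mod_cast mul_ne_zero hσ0 hlam0.ne'
    simp only [hD]
    exact mul_ne_zero (by simp [this]) (neg_ne_zero.2 h2)
  have hDnorm : lam ≤ ‖D‖ := by
    rw [hD, norm_mul, norm_neg, Complex.norm_real, Real.norm_eq_abs, abs_mul, hσabs, one_mul,
      abs_of_pos hlam0]
    have h1 : (1 : ℝ) ≤ ‖2 * (Real.pi : ℂ) * Complex.I‖ := by
      simp [abs_of_pos Real.pi_pos]
      linarith [Real.pi_gt_three]
    exact le_mul_of_one_le_left hlam0.le h1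
  -- `g 0` is the oscillating factor after summing over j. Raising r divides the j-th term by j, so
  -- `D⁻¹ * g 1` and `D⁻¹ ^ 2 * g 2` are its successive antiderivatives.
  set g : ℕ → ℝ → ℂ := fun r x => ∑ a ∈ Finset.range q, c a * expSum A B r (σ * (a / q - lam * x))
    with hg
  have dg : ∀ r x, HasDerivAt (g (r + 1)) (D * g r x) x := by
    intro r x
    have h : ∀ a ∈ Finset.range q, HasDerivAt
        (fun x : ℝ => c a * expSum A B (r + 1) (σ * (a / q - lam * x)))
        (D * (c a * expSum A B r (σ * (a / q - lam * x)))) x := by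
      intro a _
      have h1 : HasDerivAt (fun x : ℝ => (σ : ℝ) * (a / q - lam * x)) (-(σ * lam)) x := by
        have := (((hasDerivAt_id x).const_mul lam).const_sub ((a : ℝ) / q)).const_mul (σ : ℝ)
        exact this.congr_deriv (by ring)
      have h2 := ((hasDerivAt_expSum hA B r _).scomp x h1).const_mul (c a)
      refine h2.congr_deriv ?_
      rw [Complex.real_smul, hD]
      push_cast
      ring
    have := HasDerivAt.fun_sum h
    rw [← Finset.mul_sum] at this
    exact this
  have bg : ∀ r W, (∀ y, ‖expSum A B r y‖ ≤ W) → ∀ x, ‖g r x‖ ≤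
      2 * W + ((A : ℝ) ^ r)⁻¹ * q * (1 + Real.log q) := by
    -- The phases a/q - λx are a complete set of residues shifted by -λx, so the bound is uniform in
    -- x.
    intro r W hW x
    refine (norm_sum_le _ _).trans ?_
    refine le_trans (Finset.sum_le_sum fun a _ => ?_)
      (sum_norm_expSum_le hA B r hq0 hW (-(lam * x)))
    rw [norm_mul, norm_expSum_sign_mul A B r hσ', sub_eq_add_neg]
    exact mul_le_of_le_one_left (norm_nonneg _) (hc a)
  have cg : Continuous (g 0) := by
    refine continuous_finsetSum _ fun a _ => continuous_const.mul ?_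
    exact (continuous_expSum A B 0).comp (by fun_prop)
  obtain ⟨hint, hbound'⟩ := hbound ((l * f ^ 2 : ℝ) * (4 * n : ℝ) ^ (-(1 / 2) : ℝ)) (by positivity)
  have hmain := hbound' (g 0)
    (fun x => D⁻¹ * g 1 x) (fun x => (D⁻¹) ^ 2 * g 2 x)
    (lam⁻¹ * (2 * (1 + Real.log B) + (A : ℝ)⁻¹ * q * (1 + Real.log q)))
    ((lam⁻¹) ^ 2 * (4 * (A : ℝ)⁻¹ + ((A : ℝ) ^ 2)⁻¹ * q * (1 + Real.log q))) δ cg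
    (fun x => ((dg 0 x).const_mul _).congr_deriv (by rw [inv_mul_cancel_left₀ hD0]))
    (fun x => ((dg 1 x).const_mul _).congr_deriv (by
      rw [pow_two, mul_assoc, inv_mul_cancel_left₀ hD0]))
    (fun x => by
      rw [norm_mul, norm_inv]
      have h1 := bg 1 _ (norm_expSum_one_le A hB) x
      rw [pow_one] at h1
      exact mul_le_mul (inv_anti₀ hlam0 hDnorm) h1 (norm_nonneg _) (by positivity))
    (fun x => by
      rw [norm_mul, norm_pow, norm_inv]
      have h1 := bg 2 _ (norm_expSum_two_le hA B) x
      rw [← mul_assoc, show (2 : ℝ) * 2 = 4 by norm_num] at h1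
      exact mul_le_mul (pow_le_pow_left₀ (by positivity) (inv_anti₀ hlam0 hDnorm) 2) h1
        (norm_nonneg _) (by positivity)) hδ hδ'
  refine le_of_eq_of_le ?_ hmain
  congr 1
  -- interchange of summation and integration
  have hI : ∀ j : ℕ, fourierI k l f (σ * j) n = ∫ x in (-1 : ℝ)..1,
      amplitude k ((l * f ^ 2 : ℝ) * (4 * n : ℝ) ^ (-(1 / 2) : ℝ)) x * e (j * (σ * -(lam * x))) := by
    intro j
    rw [fourierI]
    refine intervalIntegral.integral_congr fun x _ => ?_
    rw [amplitude]
    congr 2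
    rw [hlam]
    push_cast
    field_simp
  have hint2 : ∀ (d : ℂ) (y : ℝ), IntervalIntegrable (fun x : ℝ => d *
      (amplitude k ((l * f ^ 2 : ℝ) * (4 * n : ℝ) ^ (-(1 / 2) : ℝ)) x * e (y * (σ * -(lam * x)))))
      volume (-1) 1 := fun d y =>
    (hint.mul_continuousOn (continuous_e.comp (by fun_prop)).continuousOn).const_mul d
  have h1 : ∀ j : ℕ, Kl l f (σ * j) n * fourierI k l f (σ * j) n = ∫ x in (-1 : ℝ)..1,
      Kl l f (σ * j) n * (amplitude k ((l * f ^ 2 : ℝ) * (4 * n : ℝ) ^ (-(1 / 2) : ℝ)) x *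
        e (j * (σ * -(lam * x)))) := fun j => by
    rw [hI, intervalIntegral.integral_const_mul]
  simp only [h1]
  rw [← intervalIntegral.integral_finsetSum fun j _ => hint2 _ _]
  refine intervalIntegral.integral_congr fun x _ => ?_
  simp only [hg, hKl, Finset.sum_mul, Finset.mul_sum, expSum]
  rw [Finset.sum_comm]
  refine Finset.sum_congr rfl fun a _ => Finset.sum_congr rfl fun j _ => ?_
  have h2 : e (j * (σ * (a / q - lam * x))) =
      e ((a : ℝ) * ((σ * j : ℤ) : ℝ) / (4 * l * f ^ 2)) * e (j * (σ * -(lam * x))) := by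
    rw [← e_add]
    congr 1
    rw [hq]
    push_cast
    ring
  rw [h2]
  push_cast
  ring

end BeyondEndoscopy

/-! ### Choice of the cut, and sums over l and f -/

namespace BeyondEndoscopy

/-- The estimate for fixed l, f with the cut δ chosen and all logarithms collected in one majorant
ℓ. The lower bound ρ for λΞ is needed to keep the cut at most 1/2. -/
theorem sum_Kl_mul_fourierI_bound (k : ℕ) {ρ : ℝ} (hρ : 0 < ρ) : ∃ K : ℝ, 0 ≤ K ∧
    ∀ (l f n B : ℕ) (σ : ℤ) (Ξ ℓ : ℝ), 0 < l → 0 < f → 0 < n → 0 < B → (σ = 1 ∨ σ = -1) →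
    0 < Ξ → ρ ≤ √n / (2 * (l * f ^ 2 : ℕ)) * Ξ → 1 ≤ ℓ → 1 + Real.log B ≤ ℓ →
    1 + Real.log (4 * l * f ^ 2 : ℕ) ≤ ℓ →
    ‖∑ j ∈ Finset.Ico ⌈Ξ⌉₊ B, Kl l f (σ * j) n * fourierI k l f (σ * j) n‖ ≤
      K * ((√n / (2 * (l * f ^ 2 : ℕ)))⁻¹ * √((√n / (2 * (l * f ^ 2 : ℕ)))⁻¹) / √Ξ *
        (ℓ * (1 + (4 * l * f ^ 2 : ℕ) / Ξ))) := by
  obtain ⟨K, hK, hbound⟩ := exists_norm_sum_Kl_mul_fourierI_le k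
  set s : ℝ := √(ρ / 2) with hs
  refine ⟨K * (16 * s + 16 / s), by positivity, fun l f n B σ Ξ ℓ hl hf hn hB hσ hΞ hρΞ hℓ hℓB hℓq => ?_⟩
  have hn' : (0 : ℝ) < n := by exact_mod_cast hn
  have hl' : (0 : ℝ) < l := by exact_mod_cast hl
  have hf' : (0 : ℝ) < f := by exact_mod_cast hf
  set lam : ℝ := √n / (2 * (l * f ^ 2 : ℕ)) with hlam
  have hlam0 : 0 < lam := by positivity
  set μ : ℝ := lam⁻¹ with hμ
  have hμ0 : 0 < μ := inv_pos.2 hlam0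
  set q : ℝ := ((4 * l * f ^ 2 : ℕ) : ℝ) with hq
  have hA : 0 < ⌈Ξ⌉₊ := Nat.ceil_pos.2 hΞ
  have hAinv : ((⌈Ξ⌉₊ : ℕ) : ℝ)⁻¹ ≤ Ξ⁻¹ := inv_anti₀ hΞ (Nat.le_ceil _)
  -- The terms √δ·M₁ and M₂/√δ balance when δ is of the order of M₂/M₁, that is 1/(λΞ). The factor
  -- ρ/2 gives δ ≤ 1/2.
  set δ : ℝ := ρ / 2 * μ / Ξ with hδ
  have hδ0 : 0 < δ := by positivity
  have hδ1 : δ ≤ 1 / 2 := by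
    rw [hδ, hμ, div_le_iff₀ hΞ, ← div_eq_mul_inv, div_le_iff₀ hlam0]
    linarith
  have hsδ : √δ = s * √μ / √Ξ := by
    rw [hδ, Real.sqrt_div (by positivity), Real.sqrt_mul (by positivity)]
  refine (hbound l f n ⌈Ξ⌉₊ B σ δ hl hf hn hA hB hσ hδ0 hδ1).trans ?_
  rw [← hlam, ← hμ, ← hq]
  set T : ℝ := ℓ * (1 + q / Ξ) with hT
  have t1 : 2 * (1 + Real.log B) + ((⌈Ξ⌉₊ : ℕ) : ℝ)⁻¹ * q * (1 + Real.log q) ≤ 2 * T := by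
    calc _ ≤ 2 * ℓ + Ξ⁻¹ * q * ℓ := by gcongr
      _ = 2 * ℓ + ℓ * (q / Ξ) := by rw [div_eq_mul_inv]; ring
      _ ≤ 2 * T := by
        have : 0 ≤ ℓ * (q / Ξ) := by positivity
        rw [hT]; linarith
  have t2 : 4 * ((⌈Ξ⌉₊ : ℕ) : ℝ)⁻¹ + (((⌈Ξ⌉₊ : ℕ) : ℝ) ^ 2)⁻¹ * q * (1 + Real.log q) ≤
      4 * Ξ⁻¹ * T := by
    rw [← inv_pow]
    calc _ ≤ 4 * Ξ⁻¹ + (Ξ⁻¹) ^ 2 * q * ℓ := by gcongr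
      _ ≤ 4 * Ξ⁻¹ * ℓ + (Ξ⁻¹) ^ 2 * q * ℓ := by
          have : 4 * Ξ⁻¹ ≤ 4 * Ξ⁻¹ * ℓ := le_mul_of_one_le_right (by positivity) hℓ
          linarith
      _ = 4 * Ξ⁻¹ * ℓ + Ξ⁻¹ * (ℓ * (q / Ξ)) := by rw [div_eq_mul_inv]; ring
      _ ≤ 4 * Ξ⁻¹ * T := by
        have : 0 ≤ Ξ⁻¹ * (ℓ * (q / Ξ)) := by positivity
        rw [hT]; linarith
  have hsΞ := Real.sq_sqrt hΞ.le
  have hsμ := Real.sq_sqrt hμ0.le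
  calc K * (8 * √δ * (μ * (2 * (1 + Real.log B) + ((⌈Ξ⌉₊ : ℕ) : ℝ)⁻¹ * q * (1 + Real.log q))) +
        4 * (μ ^ 2 * (4 * ((⌈Ξ⌉₊ : ℕ) : ℝ)⁻¹ + (((⌈Ξ⌉₊ : ℕ) : ℝ) ^ 2)⁻¹ * q *
          (1 + Real.log q))) / √δ)
      ≤ K * (8 * √δ * (μ * (2 * T)) + 4 * (μ ^ 2 * (4 * Ξ⁻¹ * T)) / √δ) := by gcongr
    _ = K * (16 * s + 16 / s) * (μ * √μ / √Ξ * T) := by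
      rw [hsδ]
      have e1 : Ξ⁻¹ = 1 / (√Ξ * √Ξ) := by rw [← pow_two, hsΞ, one_div]
      have e2 : μ ^ 2 = μ * (√μ * √μ) := by rw [← pow_two √μ, hsμ]; ring
      rw [e1, e2]
      field_simp
      ring

theorem sum_filter_Icc_eq (g : ℤ → ℂ) {N m : ℕ} (hm : 0 < m) {Y Ξ : ℝ} (hΞ : 0 < Ξ) (hN : Y ≤ N) :
    ∑ ξ ∈ (Finset.Icc (-(N : ℤ)) N).filter (fun ξ : ℤ => (m : ℝ) * |(ξ : ℝ)| ≤ Y ∧ Ξ ≤ |(ξ : ℝ)|), g ξ =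
      ∑ j ∈ Finset.Ico ⌈Ξ⌉₊ (⌊Y / m⌋₊ + 1), g j + ∑ j ∈ Finset.Ico ⌈Ξ⌉₊ (⌊Y / m⌋₊ + 1), g (-j) := by
  have hm' : (0 : ℝ) < m := by exact_mod_cast hm
  have hm1 : (1 : ℝ) ≤ m := by exact_mod_cast hm
  have hmem : ∀ j : ℕ, j ∈ Finset.Ico ⌈Ξ⌉₊ (⌊Y / m⌋₊ + 1) ↔ (m : ℝ) * j ≤ Y ∧ Ξ ≤ j := by
    intro j
    rw [Finset.mem_Ico, Nat.ceil_le, Nat.lt_succ_iff, and_comm]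
    refine and_congr_left fun hj => ?_
    have hj0 : j ≠ 0 := by
      rintro rfl
      simp at hj
      linarith
    rw [Nat.le_floor_iff' hj0, le_div_iff₀ hm', mul_comm]
  have hbd : ∀ j : ℕ, (m : ℝ) * j ≤ Y → j ≤ N := by
    intro j hj
    have : (j : ℝ) ≤ N := by
      have : (0 : ℝ) ≤ j := j.cast_nonneg
      nlinarith
    exact_mod_cast this
  rw [← Finset.sum_filter_add_sum_filter_not _ (fun ξ : ℤ => 0 < ξ)]
  congr 1
  · refine Finset.sum_nbij' (fun ξ => ξ.toNat) (fun j => (j : ℤ)) ?_ ?_ ?_ ?_ ?_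
    · intro ξ hξ
      simp only [Finset.mem_filter] at hξ
      obtain ⟨⟨_, h1, h2⟩, h3⟩ := hξ
      have h4 : ((ξ.toNat : ℕ) : ℝ) = |(ξ : ℝ)| := by
        rw [abs_of_pos (by exact_mod_cast h3)]
        exact_mod_cast Int.toNat_of_nonneg h3.le
      rw [hmem, h4]
      exact ⟨h1, h2⟩
    · intro j hj
      rw [hmem] at hj
      have hj0 : (0 : ℝ) < j := lt_of_lt_of_le hΞ hj.2
      have := hbd j hj.1
      simp only [Finset.mem_filter, Finset.mem_Icc, Int.cast_natCast, Nat.abs_cast]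
      have : 0 < j := by exact_mod_cast hj0
      exact ⟨⟨⟨by omega, by omega⟩, hj⟩, by omega⟩
    · intro ξ hξ
      simp only [Finset.mem_filter] at hξ
      exact Int.toNat_of_nonneg hξ.2.le
    · intro j _
      simp
    · intro ξ hξ
      simp only [Finset.mem_filter] at hξ
      rw [Int.toNat_of_nonneg hξ.2.le]
  · refine Finset.sum_nbij' (fun ξ => (-ξ).toNat) (fun j => -(j : ℤ)) ?_ ?_ ?_ ?_ ?_
    · intro ξ hξ
      simp only [Finset.mem_filter, not_lt] at hξ
      obtain ⟨⟨_, h1, h2⟩, h3⟩ := hξ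
      have h4 : (((-ξ).toNat : ℕ) : ℝ) = |(ξ : ℝ)| := by
        rw [abs_of_nonpos (by exact_mod_cast h3)]
        exact_mod_cast Int.toNat_of_nonneg (neg_nonneg.2 h3)
      rw [hmem, h4]
      exact ⟨h1, h2⟩
    · intro j hj
      rw [hmem] at hj
      have := hbd j hj.1
      simp only [Finset.mem_filter, Finset.mem_Icc, Int.cast_neg, Int.cast_natCast, abs_neg,
        Nat.abs_cast]
      exact ⟨⟨⟨by omega, by omega⟩, hj⟩, by omega⟩
    · intro ξ hξ
      simp only [Finset.mem_filter, not_lt] at hξ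
      rw [Int.toNat_of_nonneg (neg_nonneg.2 hξ.2), neg_neg]
    · intro j _
      simp
    · intro ξ hξ
      simp only [Finset.mem_filter, not_lt] at hξ
      rw [Int.toNat_of_nonneg (neg_nonneg.2 hξ.2), neg_neg]

theorem sum_inv_sqrt_le (N : ℕ) (R : ℝ) :
    ∑ l ∈ Finset.Icc 1 N, (if (l : ℝ) ≤ R then 1 / √(l : ℝ) else 0) ≤ 2 * √R := by
  -- The bound by √N is carried along because, as long as the newest term is nonzero, N ≤ R and it
  -- implies the bound by √R; afterwards the sum no longer grows.
  have key : ∑ l ∈ Finset.Icc 1 N, (if (l : ℝ) ≤ R then 1 / √(l : ℝ) else 0) ≤ 2 * √(N : ℝ) ∧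
      ∑ l ∈ Finset.Icc 1 N, (if (l : ℝ) ≤ R then 1 / √(l : ℝ) else 0) ≤ 2 * √R := by
    induction N with
    | zero => simp
    | succ N ih =>
      rw [Finset.sum_Icc_succ_top (by omega)]
      have hmono : √(N : ℝ) ≤ √((N + 1 : ℕ) : ℝ) := Real.sqrt_le_sqrt (by push_cast; linarith)
      split_ifs with h
      · have hpos : 0 < √((N + 1 : ℕ) : ℝ) := Real.sqrt_pos.2 (by positivity)
        have h1 : 1 / √((N + 1 : ℕ) : ℝ) ≤ 2 * (√((N + 1 : ℕ) : ℝ) - √(N : ℝ)) := by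
          rw [div_le_iff₀ hpos]
          have e1 : √((N + 1 : ℕ) : ℝ) ^ 2 = N + 1 := by
            rw [Real.sq_sqrt (by positivity)]; push_cast; ring
          have e2 : √(N : ℝ) ^ 2 = N := Real.sq_sqrt (by positivity)
          nlinarith [sq_nonneg (√((N + 1 : ℕ) : ℝ) - √(N : ℝ))]
        have h2 : √((N + 1 : ℕ) : ℝ) ≤ √R := Real.sqrt_le_sqrt h
        exact ⟨by linarith [ih.1], by linarith [ih.1]⟩
      · exact ⟨by linarith [ih.1], by linarith [ih.2]⟩
  exact key.2

/-- For fixed f the condition reads l ≤ L/f², which gives 2√L/f; the sum over f is then harmonic. -/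
theorem sum_sum_inv_sqrt_le (N : ℕ) {L : ℝ} (hL : 0 ≤ L) :
    ∑ l ∈ Finset.Icc 1 N, ∑ f ∈ Finset.Icc 1 N,
      (if (l : ℝ) * (f : ℝ) ^ 2 ≤ L then 1 / √(l : ℝ) else 0) ≤ 2 * √L * (1 + Real.log N) := by
  rw [Finset.sum_comm]
  have h1 : ∀ f ∈ Finset.Icc 1 N, ∑ l ∈ Finset.Icc 1 N,
      (if (l : ℝ) * (f : ℝ) ^ 2 ≤ L then 1 / √(l : ℝ) else 0) ≤ 2 * √L * (f : ℝ)⁻¹ := by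
    intro f hf
    have hf0 : (0 : ℝ) < f := by exact_mod_cast (Finset.mem_Icc.1 hf).1
    have := sum_inv_sqrt_le N (L / f ^ 2)
    rw [Real.sqrt_div hL, Real.sqrt_sq hf0.le, ← mul_div_assoc, div_eq_mul_inv _ (f : ℝ)] at this
    refine le_of_eq_of_le (Finset.sum_congr rfl fun l _ => ?_) this
    simp only [le_div_iff₀ (by positivity : (0 : ℝ) < (f : ℝ) ^ 2)]
  refine (Finset.sum_le_sum h1).trans ?_
  rw [← Finset.mul_sum]
  have h2 := harmonic_le_one_add_log N
  rw [harmonic_eq_sum_Icc] at h2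
  push_cast at h2
  gcongr

theorem one_add_log_le {c s : ℝ} (hc : 0 ≤ c) (hs : 0 ≤ s) {n : ℕ} (hn : 0 < n) {x : ℝ}
    (hx : 0 < x) (hxc : x ≤ c * (n : ℝ) ^ s + 1) :
    1 + Real.log x ≤ (1 + Real.log (c + 1) + s) * (1 + Real.log n) := by
  have hn1 : (1 : ℝ) ≤ n := by exact_mod_cast hn
  have h1 : 1 ≤ (n : ℝ) ^ s := Real.one_le_rpow hn1 hs
  have h2 : x ≤ (c + 1) * (n : ℝ) ^ s := by nlinarith
  have h3 := Real.log_le_log hx h2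
  rw [Real.log_mul (by positivity) (by positivity), Real.log_rpow (by positivity)] at h3
  have h4 : 0 ≤ Real.log n := Real.log_nonneg hn1
  have h5 : 0 ≤ Real.log (c + 1) := Real.log_nonneg (by linarith)
  nlinarith

end BeyondEndoscopy

/-! ### The bound for an individual n -/

namespace BeyondEndoscopy

theorem S1_eq_sum (k n : ℕ) (hn : 0 < n) (κ α c₁ c₂ : ℝ) (hc₂ : 0 < c₂) {N : ℕ}
    (hN : c₁ * (n : ℝ) ^ (1 / 2 + κ : ℝ) ≤ N) :
    S1 k n κ α c₁ c₂ = ∑ l ∈ Finset.Icc 1 N, ∑ f ∈ Finset.Icc 1 N,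
      ∑ ξ ∈ (Finset.Icc (-(N : ℤ)) N).filter (fun ξ : ℤ =>
        ((l * f ^ 2 : ℕ) : ℝ) * |(ξ : ℝ)| ≤ c₁ * (n : ℝ) ^ (1 / 2 + κ : ℝ) ∧
        c₂ * (n : ℝ) ^ (1 / 6 + κ + α : ℝ) ≤ |(ξ : ℝ)|),
        Kl l f ξ n / (√(l : ℝ) : ℂ) * (fourierI k l f ξ n /
          ((((l : ℝ) * (f : ℝ) ^ 2) ^ (3 / 2 : ℝ) : ℝ) : ℂ)) := by
  classical
  have hn' : (0 : ℝ) < n := by exact_mod_cast hn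
  rw [S1, finsum_mem_eq_finite_toFinset_sum _ (rangeSet_finite n hn κ α c₁ c₂ hc₂)]
  have hset : (rangeSet_finite n hn κ α c₁ c₂ hc₂).toFinset =
      (Finset.Icc 1 N ×ˢ (Finset.Icc 1 N ×ˢ Finset.Icc (-(N : ℤ)) N)).filter
        (fun p : ℕ × ℕ × ℤ =>
          ((p.1 * p.2.1 ^ 2 : ℕ) : ℝ) * |(p.2.2 : ℝ)| ≤ c₁ * (n : ℝ) ^ (1 / 2 + κ : ℝ) ∧
          c₂ * (n : ℝ) ^ (1 / 6 + κ + α : ℝ) ≤ |(p.2.2 : ℝ)|) := by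
    ext ⟨l, f, ξ⟩
    simp only [Set.Finite.mem_toFinset, rangeSet, Set.mem_ofPred_eq, Finset.mem_filter,
      Finset.mem_product, Finset.mem_Icc]
    push_cast
    constructor
    · rintro ⟨hl, hf, h1, h2⟩
      refine ⟨?_, h1, h2⟩
      have hpos : 0 < |(ξ : ℝ)| := lt_of_lt_of_le (by positivity) h2
      have hξ : 0 < |ξ| := by
        have : (0 : ℝ) < ((|ξ| : ℤ) : ℝ) := by rwa [Int.cast_abs]
        exact_mod_cast this
      have h3 : ((l * f ^ 2 * ξ.natAbs : ℕ) : ℝ) ≤ (N : ℝ) := by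
        refine le_trans ?_ hN
        push_cast
        rw [Nat.cast_natAbs, Int.cast_abs]
        exact h1
      have h4 : l * f ^ 2 * ξ.natAbs ≤ N := by exact_mod_cast h3
      have hξ1 : 1 ≤ ξ.natAbs := Int.natAbs_pos.mpr (abs_pos.mp hξ)
      have hf2 : 1 ≤ f ^ 2 := Nat.one_le_pow _ _ hf
      have a1 : l ≤ l * f ^ 2 * ξ.natAbs := by
        rw [mul_assoc]; exact Nat.le_mul_of_pos_right _ (by positivity)
      have a2 : f ≤ l * f ^ 2 * ξ.natAbs := by
        calc f ≤ f ^ 2 := by nlinarith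
          _ ≤ l * f ^ 2 := Nat.le_mul_of_pos_left _ hl
          _ ≤ _ := Nat.le_mul_of_pos_right _ hξ1
      have a3 : ξ.natAbs ≤ l * f ^ 2 * ξ.natAbs := Nat.le_mul_of_pos_left _ (by positivity)
      omega
    · rintro ⟨⟨h1, h2, -⟩, h3, h4⟩
      exact ⟨by omega, by omega, h3, h4⟩
  rw [hset, Finset.sum_filter, Finset.sum_product]
  refine Finset.sum_congr rfl fun l _ => ?_
  rw [Finset.sum_product]
  refine Finset.sum_congr rfl fun f _ => ?_
  rw [Finset.sum_filter]

theorem rpow_three_halves {x : ℝ} (hx : 0 < x) : x ^ (3 / 2 : ℝ) = x * √x := by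
  rw [Real.sqrt_eq_rpow, show (3 / 2 : ℝ) = 1 + 1 / 2 by norm_num, Real.rpow_add hx, Real.rpow_one]

theorem sqrt_mul_one_add_le {r : ℝ} (hr : 0 ≤ r) : √r * (1 + r) ≤ 2 * (1 + r * √r) := by
  have h0 := Real.sqrt_nonneg r
  have h1 : √r ≤ 1 + r * √r := by
    rcases le_total r 1 with h | h
    · have : √r ≤ 1 := Real.sqrt_le_one.2 h
      have : 0 ≤ r * √r := by positivity
      linarith
    · nlinarith
  linarith

set_option maxHeartbeats 1000000 in
/-- Individual bound for the sums `S₁(n)`. -/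
theorem exists_norm_S1_le (k : ℕ) (κ α : ℝ) (hκ : 0 < κ) (hα : 0 < α)
    (c₁ c₂ : ℝ) (hc₁ : 0 < c₁) (hc₂ : 0 < c₂) : ∃ C : ℝ, 0 ≤ C ∧ ∀ n : ℕ, 0 < n →
    ‖S1 k n κ α c₁ c₂‖ ≤ C * ((n : ℝ) ^ (-(3 / 4) : ℝ) * (1 + Real.log n) ^ 2 *
      (1 + (n : ℝ) ^ (1 / 4 - 3 * κ / 2 - 3 * α : ℝ))) := by
  -- If lf² ≤ Y/Ξ then λΞ ≥ √n Ξ²/(2Y), and this is at least c₂²/(2c₁) because the remaining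
  -- exponent of n is positive.
  obtain ⟨K, hK, hbound⟩ := sum_Kl_mul_fourierI_bound k (ρ := c₂ ^ 2 / (2 * c₁)) (by positivity)
  set C1 : ℝ := 1 + Real.log (c₁ + 1) + (1 / 2 + κ) with hC1
  set C2 : ℝ := 1 + Real.log (4 * c₁ / c₂ + 1) + 1 / 3 with hC2
  have hl1 : 0 ≤ Real.log (c₁ + 1) := Real.log_nonneg (by linarith)
  have hl2 : 0 ≤ Real.log (4 * c₁ / c₂ + 1) := Real.log_nonneg (by
    have : 0 ≤ 4 * c₁ / c₂ := by positivity
    linarith)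
  have hC1' : 1 ≤ C1 := by linarith
  have hC2' : 1 ≤ C2 := by linarith
  set CL : ℝ := C1 + C2 with hCL
  set D : ℝ := c₁ / c₂ ^ 2 with hD
  have hD0 : 0 < D := by positivity
  refine ⟨4 * K * (2 * √2) * CL ^ 2 * (√D * (1 + 4 * D)) * 2, by positivity, fun n hn => ?_⟩
  have hn' : (0 : ℝ) < n := by exact_mod_cast hn
  have hn1 : (1 : ℝ) ≤ n := by exact_mod_cast hn
  have hlogn : 0 ≤ Real.log n := Real.log_nonneg hn1
  set Y : ℝ := c₁ * (n : ℝ) ^ (1 / 2 + κ : ℝ) with hY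
  set Ξ : ℝ := c₂ * (n : ℝ) ^ (1 / 6 + κ + α : ℝ) with hΞ
  have hY0 : 0 < Y := by positivity
  have hΞ0 : 0 < Ξ := by positivity
  set L : ℝ := Y / Ξ with hL
  have hL0 : 0 < L := by positivity
  set N : ℕ := ⌈Y⌉₊ with hN
  have hYN : Y ≤ N := Nat.le_ceil _
  have hN0 : 0 < N := Nat.ceil_pos.2 hY0
  have hN1 : (N : ℝ) ≤ Y + 1 := (Nat.ceil_lt_add_one hY0.le).le
  set r : ℝ := (n : ℝ) ^ (1 / 6 - κ - 2 * α : ℝ) with hr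
  have hr0 : 0 < r := by positivity
  have hLΞ : L / Ξ = D * r := by
    rw [hL, hY, hΞ, hD, hr, show (1 / 6 - κ - 2 * α : ℝ) =
      (1 / 2 + κ) - (1 / 6 + κ + α) - (1 / 6 + κ + α) by ring, Real.rpow_sub hn', Real.rpow_sub hn']
    field_simp
  -- One majorant for every logarithm: `C1` serves quantities up to Y + 1, and `C2` serves q = 4lf²
  -- ≤ 4L, where L is at most a constant times n^{1/3}.
  set ℓ : ℝ := CL * (1 + Real.log n) with hℓ
  have hℓ1 : 1 ≤ ℓ := by
    rw [hℓ]
    nlinarith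
  have hC1ℓ : C1 * (1 + Real.log n) ≤ ℓ := by
    rw [hℓ, hCL]
    have : 0 ≤ C2 * (1 + Real.log n) := by positivity
    linarith
  have hC2ℓ : C2 * (1 + Real.log n) ≤ ℓ := by
    rw [hℓ, hCL]
    have : 0 ≤ C1 * (1 + Real.log n) := by positivity
    linarith
  have hlogY : ∀ x : ℝ, 0 < x → x ≤ Y + 1 → 1 + Real.log x ≤ ℓ := fun x hx hxY =>
    (one_add_log_le hc₁.le (by linarith) hn hx hxY).trans hC1ℓ
  have hlogL : ∀ x : ℝ, 0 < x → x ≤ 4 * L → 1 + Real.log x ≤ ℓ := fun x hx hxL => by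
    refine (one_add_log_le (c := 4 * c₁ / c₂) (s := 1 / 3) (by positivity) (by norm_num) hn hx
      (hxL.trans ?_)).trans hC2ℓ
    have e1 : L = c₁ / c₂ * (n : ℝ) ^ (1 / 3 - α : ℝ) := by
      rw [hL, hY, hΞ, show (1 / 3 - α : ℝ) = (1 / 2 + κ) - (1 / 6 + κ + α) by ring,
        Real.rpow_sub hn']
      field_simp
    have e2 : (n : ℝ) ^ (1 / 3 - α : ℝ) ≤ (n : ℝ) ^ (1 / 3 : ℝ) :=
      Real.rpow_le_rpow_of_exponent_le hn1 (by linarith)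
    have e3 : 4 * L ≤ 4 * c₁ / c₂ * (n : ℝ) ^ (1 / 3 : ℝ) := by
      calc 4 * L = 4 * c₁ / c₂ * (n : ℝ) ^ (1 / 3 - α : ℝ) := by rw [e1]; ring
        _ ≤ _ := by gcongr
    linarith
  have hlogN : 1 + Real.log N ≤ ℓ := hlogY N (by exact_mod_cast hN0) hN1
  have hsn : 0 < √(n : ℝ) := Real.sqrt_pos.2 hn'
  have hsΞ : 0 < √Ξ := Real.sqrt_pos.2 hΞ0
  set ν : ℝ := 2 / √(n : ℝ) * √(2 / √(n : ℝ)) with hν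
  have hν0 : 0 ≤ ν := by positivity
  have hνeq : ν = 2 * √2 * (n : ℝ) ^ (-(3 / 4) : ℝ) := by
    rw [hν, Real.sqrt_div (by norm_num), Real.sqrt_eq_rpow √(n : ℝ), Real.sqrt_eq_rpow (n : ℝ),
      ← Real.rpow_mul hn'.le, Real.rpow_neg hn'.le, show (3 / 4 : ℝ) = 1 / 2 + 1 / 2 * (1 / 2) by
        norm_num, Real.rpow_add hn']
    field_simp
  -- The 2 accounts for the two signs of ξ. Here ν is λ^{-3/2} with the power of lf² removed, and
  -- lf² inside the parentheses has been replaced by its maximum L.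
  set Q : ℝ := 2 * K * (ν / √Ξ * (ℓ * (1 + 4 * (L / Ξ)))) with hQ
  have hQ0 : 0 ≤ Q := by positivity
  rw [S1_eq_sum k n hn κ α c₁ c₂ hc₂ hYN]
  have inner : ∀ l ∈ Finset.Icc 1 N, ∀ f ∈ Finset.Icc 1 N,
      ‖∑ ξ ∈ (Finset.Icc (-(N : ℤ)) N).filter (fun ξ : ℤ =>
        ((l * f ^ 2 : ℕ) : ℝ) * |(ξ : ℝ)| ≤ Y ∧ Ξ ≤ |(ξ : ℝ)|),
        Kl l f ξ n / (√(l : ℝ) : ℂ) * (fourierI k l f ξ n /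
          ((((l : ℝ) * (f : ℝ) ^ 2) ^ (3 / 2 : ℝ) : ℝ) : ℂ))‖ ≤
      Q * (if (l : ℝ) * (f : ℝ) ^ 2 ≤ L then 1 / √(l : ℝ) else 0) := by
    intro l hl f hf
    have hl0 : 0 < l := (Finset.mem_Icc.1 hl).1
    have hf0 : 0 < f := (Finset.mem_Icc.1 hf).1
    have hl' : (0 : ℝ) < l := by exact_mod_cast hl0
    have hf' : (0 : ℝ) < f := by exact_mod_cast hf0
    set m : ℝ := (l : ℝ) * (f : ℝ) ^ 2 with hm
    have hm0 : 0 < m := by positivity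
    have hmcast : ((l * f ^ 2 : ℕ) : ℝ) = m := by rw [hm]; push_cast; ring
    have hqcast : ((4 * l * f ^ 2 : ℕ) : ℝ) = 4 * m := by rw [hm]; push_cast; ring
    have hm1 : (1 : ℝ) ≤ m := by
      rw [← hmcast]; exact_mod_cast (by positivity : 0 < l * f ^ 2)
    by_cases hmL : m ≤ L
    · rw [if_pos hmL, sum_filter_Icc_eq _ (by positivity : 0 < l * f ^ 2) hΞ0 hYN, hmcast]
      set B : ℕ := ⌊Y / m⌋₊ + 1 with hB
      have hB1 : (B : ℝ) ≤ Y + 1 := by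
        rw [hB]
        push_cast
        have h1 : (⌊Y / m⌋₊ : ℝ) ≤ Y / m := Nat.floor_le (by positivity)
        have h2 : Y / m ≤ Y := div_le_self hY0.le hm1
        linarith
      set lam : ℝ := √(n : ℝ) / (2 * m) with hlam
      have hρ : c₂ ^ 2 / (2 * c₁) ≤ lam * Ξ := by
        have h1 : m * Ξ ≤ Y := (le_div_iff₀ hΞ0).1 hmL
        have h2 : c₂ ^ 2 * Y ≤ c₁ * √(n : ℝ) * Ξ ^ 2 := by
          have e1 : √(n : ℝ) * Ξ ^ 2 = c₂ ^ 2 * (n : ℝ) ^ (1 / 2 + 2 * (1 / 6 + κ + α) : ℝ) := by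
            rw [hΞ, mul_pow, Real.sqrt_eq_rpow, two_mul (1 / 6 + κ + α)]
            generalize 1 / 6 + κ + α = t
            rw [Real.rpow_add hn', Real.rpow_add hn']
            ring
          have e2 : (n : ℝ) ^ (1 / 2 + κ : ℝ) ≤ (n : ℝ) ^ (1 / 2 + 2 * (1 / 6 + κ + α) : ℝ) :=
            Real.rpow_le_rpow_of_exponent_le hn1 (by linarith)
          calc c₂ ^ 2 * Y = c₁ * c₂ ^ 2 * (n : ℝ) ^ (1 / 2 + κ : ℝ) := by rw [hY]; ring
            _ ≤ c₁ * c₂ ^ 2 * (n : ℝ) ^ (1 / 2 + 2 * (1 / 6 + κ + α) : ℝ) := by gcongr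
            _ = c₁ * √(n : ℝ) * Ξ ^ 2 := by rw [mul_assoc c₁ √(n : ℝ), e1]; ring
        have h3 : c₂ ^ 2 * (m * Ξ) ≤ c₁ * √(n : ℝ) * Ξ ^ 2 :=
          (mul_le_mul_of_nonneg_left h1 (by positivity)).trans h2
        have h4 : c₂ ^ 2 * m ≤ c₁ * √(n : ℝ) * Ξ := by
          refine le_of_mul_le_mul_right ?_ hΞ0
          calc c₂ ^ 2 * m * Ξ = c₂ ^ 2 * (m * Ξ) := by ring
            _ ≤ _ := h3
            _ = _ := by ring
        rw [hlam, div_mul_eq_mul_div, div_le_div_iff₀ (by positivity) (by positivity)]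
        linarith
      have hμν : lam⁻¹ * √(lam⁻¹) = m * √m * ν := by
        have e1 : lam⁻¹ = m * (2 / √(n : ℝ)) := by
          rw [hlam]; field_simp
        rw [e1, Real.sqrt_mul hm0.le, hν]
        ring
      have hσ : ∀ σ : ℤ, σ = 1 ∨ σ = -1 →
          ‖∑ j ∈ Finset.Ico ⌈Ξ⌉₊ B, Kl l f (σ * j) n / (√(l : ℝ) : ℂ) *
            (fourierI k l f (σ * j) n / ((m ^ (3 / 2 : ℝ) : ℝ) : ℂ))‖ ≤
          K * (ν / √Ξ * (ℓ * (1 + 4 * (L / Ξ)))) * (1 / √(l : ℝ)) := by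
        intro σ hσ
        have e1 : ∑ j ∈ Finset.Ico ⌈Ξ⌉₊ B, Kl l f (σ * j) n / (√(l : ℝ) : ℂ) *
            (fourierI k l f (σ * j) n / ((m ^ (3 / 2 : ℝ) : ℝ) : ℂ)) =
            ((1 / (√(l : ℝ) * (m * √m)) : ℝ) : ℂ) *
              ∑ j ∈ Finset.Ico ⌈Ξ⌉₊ B, Kl l f (σ * j) n * fourierI k l f (σ * j) n := by
          rw [Finset.mul_sum, rpow_three_halves hm0]
          refine Finset.sum_congr rfl fun j _ => ?_
          push_cast
          ring
        have e2 := hbound l f n B σ Ξ ℓ hl0 hf0 hn (Nat.succ_pos _) hσ hΞ0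
          (by rw [hmcast]; exact hρ) hℓ1 (hlogY _ (by positivity) hB1)
          (hlogL _ (by rw [hqcast]; positivity) (by rw [hqcast]; linarith))
        rw [hmcast, hqcast, ← hlam, hμν] at e2
        rw [e1, norm_mul, Complex.norm_real, Real.norm_eq_abs,
          abs_of_pos (by positivity : 0 < 1 / (√(l : ℝ) * (m * √m)))]
        have hsl : 0 < √(l : ℝ) := Real.sqrt_pos.2 hl'
        have hsm : 0 < √m := Real.sqrt_pos.2 hm0
        calc 1 / (√(l : ℝ) * (m * √m)) * _ ≤ 1 / (√(l : ℝ) * (m * √m)) *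
              (K * (m * √m * ν / √Ξ * (ℓ * (1 + 4 * m / Ξ)))) := by gcongr
          _ = K * (ν / √Ξ * (ℓ * (1 + 4 * (m / Ξ)))) * (1 / √(l : ℝ)) := by
              field_simp
          _ ≤ _ := by gcongr
      refine (norm_add_le _ _).trans ?_
      have s1 := hσ 1 (Or.inl rfl)
      have s2 := hσ (-1) (Or.inr rfl)
      simp only [one_mul, neg_one_mul] at s1 s2
      rw [hQ]
      linarith
    -- For lf² > L no ξ qualifies, since lf²·Ξ would already exceed Y.
    · rw [if_neg hmL, mul_zero, Finset.filter_eq_empty_iff.2, Finset.sum_empty, norm_zero]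
      rintro ξ - ⟨h1, h2⟩
      rw [hmcast] at h1
      exact hmL ((le_div_iff₀ hΞ0).2 ((mul_le_mul_of_nonneg_left h2 hm0.le).trans h1))
  have total : ∑ l ∈ Finset.Icc 1 N, ∑ f ∈ Finset.Icc 1 N,
      Q * (if (l : ℝ) * (f : ℝ) ^ 2 ≤ L then 1 / √(l : ℝ) else 0) ≤ Q * (2 * √L * ℓ) := by
    simp only [← Finset.mul_sum]
    refine mul_le_mul_of_nonneg_left ((sum_sum_inv_sqrt_le N hL0.le).trans ?_) hQ0
    gcongr
  refine (norm_sum_le _ _).trans ((Finset.sum_le_sum fun l hl => (norm_sum_le _ _).trans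
    (Finset.sum_le_sum fun f hf => inner l hl f hf)).trans (total.trans ?_))
  have hsq : √L / √Ξ = √D * √r := by
    rw [← Real.sqrt_div hL0.le, hLΞ, Real.sqrt_mul hD0.le]
  have hrr : r * √r = (n : ℝ) ^ (1 / 4 - 3 * κ / 2 - 3 * α : ℝ) := by
    rw [← rpow_three_halves hr0, hr, ← Real.rpow_mul hn'.le]
    congr 1
    ring
  have hfin : √r * (1 + 4 * (D * r)) ≤ (1 + 4 * D) * (2 * (1 + r * √r)) := by
    have h1 : 1 + 4 * (D * r) ≤ (1 + 4 * D) * (1 + r) := by nlinarith [mul_pos hD0 hr0]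
    calc √r * (1 + 4 * (D * r)) ≤ √r * ((1 + 4 * D) * (1 + r)) := by gcongr
      _ = (1 + 4 * D) * (√r * (1 + r)) := by ring
      _ ≤ _ := mul_le_mul_of_nonneg_left (sqrt_mul_one_add_le hr0.le) (by positivity)
  rw [← hrr]
  calc Q * (2 * √L * ℓ) = 4 * K * ν * ℓ ^ 2 * ((√L / √Ξ) * (1 + 4 * (L / Ξ))) := by
        rw [hQ]; field_simp; ring
    _ = 4 * K * ν * ℓ ^ 2 * √D * (√r * (1 + 4 * (D * r))) := by rw [hsq, hLΞ]; ring
    _ ≤ 4 * K * ν * ℓ ^ 2 * √D * ((1 + 4 * D) * (2 * (1 + r * √r))) :=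
        mul_le_mul_of_nonneg_left hfin (by positivity)
    _ = _ := by rw [hνeq, hℓ]; ring

end BeyondEndoscopy

/-! ### Deduction of the two assertions -/

namespace BeyondEndoscopy

theorem S1_eq_zero {k n : ℕ} (hn : 0 < n) {κ α c₁ c₂ : ℝ} (hc₂ : 0 < c₂)
    (h : c₁ * (n : ℝ) ^ (1 / 2 + κ : ℝ) < 1) : S1 k n κ α c₁ c₂ = 0 := by
  have hn' : (0 : ℝ) < n := by exact_mod_cast hn
  have hempty : rangeSet n κ α c₁ c₂ = ∅ := by
    rw [Set.eq_empty_iff_forall_notMem]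
    rintro ⟨l, f, ξ⟩ ⟨hl, hf, h1, h2⟩
    simp only at hl hf h1 h2
    have hpos : 0 < |(ξ : ℝ)| := lt_of_lt_of_le (by positivity) h2
    have hξ : 0 < |ξ| := by
      have : (0 : ℝ) < ((|ξ| : ℤ) : ℝ) := by rwa [Int.cast_abs]
      exact_mod_cast this
    have h3 : (1 : ℝ) ≤ |(ξ : ℝ)| := by
      have : (1 : ℝ) ≤ ((|ξ| : ℤ) : ℝ) := by exact_mod_cast hξ
      rwa [Int.cast_abs] at this
    have h4 : (1 : ℝ) ≤ (l : ℝ) * (f : ℝ) ^ 2 := by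
      exact_mod_cast (by positivity : 0 < l * f ^ 2)
    nlinarith
  rw [S1, hempty]
  simp

theorem one_add_log_le_three_mul {x y : ℝ} (hx : 1 ≤ x) (hxy : x ≤ y) (hy : 2 ≤ y) :
    1 + Real.log x ≤ 3 * Real.log y := by
  have h1 := Real.log_le_log (by linarith) hxy
  have h2 := Real.log_le_log (by norm_num) hy
  have h3 := Real.log_two_gt_d9
  linarith

/-- Absorbs one logarithm into the surplus power n^{-3κ/2}, because the second assertion allows only
a single logarithm in its second term. -/
theorem one_add_log_mul_rpow_neg_le {x s : ℝ} (hx : 1 ≤ x) (hs : 0 < s) :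
    (1 + Real.log x) * x ^ (-s) ≤ 1 + 1 / s := by
  have h0 : 0 < x := by linarith
  have h1 := Real.log_le_rpow_div h0.le hs
  have h2 := Real.one_le_rpow hx hs.le
  rw [Real.rpow_neg h0.le, ← div_eq_mul_inv, div_le_iff₀ (by positivity)]
  calc 1 + Real.log x ≤ x ^ s + x ^ s / s := by linarith
    _ = _ := by ring

/-- Writing n^{-s} = n^{1/2-s} n^{-1/2} and using n ≤ X in the first factor reduces everything to
the sum of n^{-1/2}; this is where s ≤ 1/2 is needed. -/
theorem sum_rpow_neg_le {s X : ℝ} (hs : s ≤ 1 / 2) (hX : 0 < X) :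
    ∑ n ∈ Finset.Ico 1 ⌈X⌉₊, (n : ℝ) ^ (-s) ≤ 2 * X ^ (1 - s) := by
  have h1 : ∀ n ∈ Finset.Ico 1 ⌈X⌉₊, (n : ℝ) ^ (-s) ≤
      X ^ (1 / 2 - s) * (if (n : ℝ) ≤ X then 1 / √(n : ℝ) else 0) := by
    intro n hn
    obtain ⟨hn1, hn2⟩ := Finset.mem_Ico.1 hn
    have hnX : (n : ℝ) ≤ X := (Nat.lt_ceil.1 hn2).le
    have hn0 : (0 : ℝ) < n := by exact_mod_cast hn1
    have hsqrt : 1 / √(n : ℝ) = (n : ℝ) ^ (-(1 / 2) : ℝ) := by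
      rw [Real.rpow_neg hn0.le, ← Real.sqrt_eq_rpow, one_div]
    rw [if_pos hnX, hsqrt, show -s = (1 / 2 - s) + -(1 / 2) by ring, Real.rpow_add hn0]
    gcongr
  refine (Finset.sum_le_sum h1).trans ?_
  rw [← Finset.mul_sum]
  have h2 : ∑ n ∈ Finset.Ico 1 ⌈X⌉₊, (if (n : ℝ) ≤ X then 1 / √(n : ℝ) else 0) ≤ 2 * √X := by
    refine le_trans (Finset.sum_le_sum_of_subset_of_nonneg (fun n hn => ?_)
      (fun n _ _ => by split_ifs <;> positivity)) (sum_inv_sqrt_le ⌈X⌉₊ X)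
    obtain ⟨hn1, hn2⟩ := Finset.mem_Ico.1 hn
    exact Finset.mem_Icc.2 ⟨hn1, hn2.le⟩
  calc _ ≤ X ^ (1 / 2 - s) * (2 * √X) := by gcongr
    _ = 2 * X ^ (1 - s) := by
      rw [Real.sqrt_eq_rpow, show 1 - s = (1 / 2 - s) + 1 / 2 by ring, Real.rpow_add hX (1 / 2 - s)]
      ring

theorem one_mem_squareDivisors {n : ℕ} (hn : n ≠ 0) {κ c₃ : ℝ}
    (h : 1 ≤ c₃ * (n : ℝ) ^ ((1 + 2 * κ) / 6 : ℝ)) : 1 ∈ squareDivisors n κ c₃ := by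
  simp [squareDivisors, hn, h]

/-- Cubing turns the exponent (1 + 2κ)/6 into 1/2 + κ, which explains the condition on c₃³. If the
minimum were 1, the conclusion of the cubing would contradict n ≥ 1. -/
theorem mul_rpow_half_add_lt_one {n : ℕ} (hn : 0 < n) {κ c₁ c₃ : ℝ} (hκ : 0 < κ) (hc₁ : 0 < c₁)
    (hc₃ : min 1 c₁ ≤ c₃ ^ 3) (h : c₃ * (n : ℝ) ^ ((1 + 2 * κ) / 6 : ℝ) < 1) :
    c₁ * (n : ℝ) ^ (1 / 2 + κ : ℝ) < 1 := by
  have hn1 : (1 : ℝ) ≤ n := by exact_mod_cast hn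
  have hn0 : (0 : ℝ) < n := by linarith
  have hmin : 0 < min 1 c₁ := lt_min one_pos hc₁
  have hc₃0 : 0 < c₃ := by
    by_contra hcon
    have : c₃ ^ 3 ≤ 0 := by
      have := mul_nonneg (neg_nonneg.2 (not_lt.1 hcon)) (sq_nonneg c₃)
      nlinarith
    linarith
  have h1 : (c₃ * (n : ℝ) ^ ((1 + 2 * κ) / 6 : ℝ)) ^ 3 < 1 :=
    pow_lt_one₀ (by positivity) h (by norm_num)
  have h2 : ((n : ℝ) ^ ((1 + 2 * κ) / 6 : ℝ)) ^ 3 = (n : ℝ) ^ (1 / 2 + κ : ℝ) := by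
    rw [← Real.rpow_natCast, ← Real.rpow_mul hn0.le]
    congr 1
    push_cast
    ring
  rw [mul_pow, h2] at h1
  have h3 : 1 ≤ (n : ℝ) ^ (1 / 2 + κ : ℝ) := Real.one_le_rpow hn1 (by linarith)
  have h4 : min 1 c₁ * (n : ℝ) ^ (1 / 2 + κ : ℝ) < 1 :=
    lt_of_le_of_lt (mul_le_mul_of_nonneg_right hc₃ (by positivity)) h1
  rcases min_choice 1 c₁ with h5 | h5
  · rw [h5] at h4
    linarith
  · rwa [h5] at h4

end BeyondEndoscopy

open BeyondEndoscopy in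
theorem theorem4p5 (k : ℕ) (hk : 3 ≤ k) (κ α : ℝ) (hκ : 0 < κ) (hα : 0 < α)
    (c₁ c₂ : ℝ) (hc₁ : 0 < c₁) (hc₂ : 0 < c₂) :
    (∀ c₃ : ℝ, min 1 c₁ ≤ c₃ ^ 3 → ∃ C : ℝ, ∀ n : ℕ, 2 ≤ n →
      ‖BeyondEndoscopy.S1 k n κ α c₁ c₂‖ ≤
        C * (Real.log n / (n : ℝ) ^ ((3 - 2 * κ) / 4 : ℝ) *
          ∑ d ∈ BeyondEndoscopy.squareDivisors n κ c₃,
            (Real.log n / (d : ℝ) ^ (1 / 2 : ℝ) +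
              (n : ℝ) ^ ((1 - 2 * (κ + 3 * α)) / 4 : ℝ) / (d : ℝ) ^ (3 / 2 : ℝ)))) ∧
    (∃ C : ℝ, ∀ X : ℝ, 2 ≤ X →
      ‖∑ n ∈ Finset.Ico 1 ⌈X⌉₊, (Real.sqrt n : ℂ) * BeyondEndoscopy.S1 k n κ α c₁ c₂‖ ≤
        C * (Real.log X ^ 2 * X ^ ((3 + 2 * κ) / 4 : ℝ) +
          Real.log X * X ^ (1 - 3 * α / 2 : ℝ))) := by
  obtain ⟨C, hC, hS⟩ := exists_norm_S1_le k κ α hκ hα c₁ c₂ hc₁ hc₂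
  constructor
  · intro c₃ hc₃
    refine ⟨9 * C * (1 + 1 / κ), fun n hn => ?_⟩
    have hn0 : 0 < n := by omega
    have hn' : (0 : ℝ) < n := by exact_mod_cast hn0
    have hn2 : (2 : ℝ) ≤ n := by exact_mod_cast hn
    have hn1 : (1 : ℝ) ≤ n := by linarith
    have hlog : 0 ≤ Real.log n := Real.log_nonneg hn1
    have hterm : ∀ d ∈ squareDivisors n κ c₃, 0 ≤ Real.log n / (d : ℝ) ^ (1 / 2 : ℝ) +
        (n : ℝ) ^ ((1 - 2 * (κ + 3 * α)) / 4 : ℝ) / (d : ℝ) ^ (3 / 2 : ℝ) := fun d _ => by positivity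
    have hsum := Finset.sum_nonneg hterm
    -- If `d = 1` is admissible its term alone majorises. Otherwise the sum on the right may be
    -- empty, and S₁ vanishes.
    by_cases h1 : 1 ≤ c₃ * (n : ℝ) ^ ((1 + 2 * κ) / 6 : ℝ)
    · have hsingle := Finset.single_le_sum hterm (one_mem_squareDivisors hn0.ne' h1)
      simp only [Nat.cast_one, Real.one_rpow, div_one] at hsingle
      -- The individual bound has one logarithm too many in its second term. It is paid for with
      -- n^κ, since the target exponent exceeds the available one by κ + 3α/2.
      have hE : Real.log n * (n : ℝ) ^ (1 / 4 - 3 * κ / 2 - 3 * α : ℝ) ≤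
          1 / κ * (n : ℝ) ^ ((1 - 2 * (κ + 3 * α)) / 4 : ℝ) := by
        calc Real.log n * (n : ℝ) ^ (1 / 4 - 3 * κ / 2 - 3 * α : ℝ)
            ≤ ((n : ℝ) ^ κ / κ) * (n : ℝ) ^ ((1 - 2 * (κ + 3 * α)) / 4 - κ : ℝ) := by
              exact mul_le_mul (Real.log_le_rpow_div hn'.le hκ)
                (Real.rpow_le_rpow_of_exponent_le hn1 (by linarith)) (by positivity) (by positivity)
          _ = _ := by
              rw [Real.rpow_sub hn']
              field_simp
      have hl3 := one_add_log_le_three_mul hn1 le_rfl hn2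
      have hexp : (n : ℝ) ^ (-(3 / 4) : ℝ) ≤ 1 / (n : ℝ) ^ ((3 - 2 * κ) / 4 : ℝ) := by
        rw [one_div, ← Real.rpow_neg hn'.le]
        exact Real.rpow_le_rpow_of_exponent_le hn1 (by linarith)
      set E : ℝ := (n : ℝ) ^ ((1 - 2 * (κ + 3 * α)) / 4 : ℝ) with hEdef
      set E' : ℝ := (n : ℝ) ^ (1 / 4 - 3 * κ / 2 - 3 * α : ℝ) with hEdef'
      have hE0 : 0 ≤ E := by positivity
      have hE0' : 0 ≤ E' := by positivity
      have hfac : Real.log n * (1 + E') ≤ (1 + 1 / κ) * (Real.log n + E) := by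
        have : 0 ≤ 1 / κ * Real.log n := by positivity
        nlinarith
      calc ‖S1 k n κ α c₁ c₂‖ ≤ C * ((n : ℝ) ^ (-(3 / 4) : ℝ) * (1 + Real.log n) ^ 2 * (1 + E')) :=
            hS n hn0
        _ ≤ C * (1 / (n : ℝ) ^ ((3 - 2 * κ) / 4 : ℝ) * (3 * Real.log n) ^ 2 * (1 + E')) := by
            gcongr
        _ = 9 * C * (Real.log n / (n : ℝ) ^ ((3 - 2 * κ) / 4 : ℝ)) * (Real.log n * (1 + E')) := by
            ring
        _ ≤ 9 * C * (Real.log n / (n : ℝ) ^ ((3 - 2 * κ) / 4 : ℝ)) *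
            ((1 + 1 / κ) * (Real.log n + E)) := mul_le_mul_of_nonneg_left hfac (by positivity)
        _ = 9 * C * (1 + 1 / κ) * (Real.log n / (n : ℝ) ^ ((3 - 2 * κ) / 4 : ℝ) *
            (Real.log n + E)) := by ring
        _ ≤ _ := mul_le_mul_of_nonneg_left (mul_le_mul_of_nonneg_left hsingle (by positivity))
            (by positivity)
    · rw [S1_eq_zero hn0 hc₂ (mul_rpow_half_add_lt_one hn0 hκ hc₁ hc₃ (not_le.1 h1)), norm_zero]
      positivity
  · refine ⟨C * (36 + 6 * (1 + 1 / (3 * κ / 2))), fun X hX => ?_⟩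
    have hX0 : 0 < X := by linarith
    have hX1 : 1 ≤ X := by linarith
    have hlog : 0 ≤ Real.log X := Real.log_nonneg hX1
    have hX34 : X ^ (1 - 1 / 4 : ℝ) ≤ X ^ ((3 + 2 * κ) / 4 : ℝ) :=
      Real.rpow_le_rpow_of_exponent_le hX1 (by linarith)
    have hs1 := sum_rpow_neg_le (s := 1 / 4) (by norm_num) hX0
    have hT1 : 0 ≤ Real.log X ^ 2 * X ^ ((3 + 2 * κ) / 4 : ℝ) := by positivity
    have hT2 : 0 ≤ Real.log X * X ^ (1 - 3 * α / 2 : ℝ) := by positivity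
    have hκ1 : 0 ≤ 1 + 1 / (3 * κ / 2) := by positivity
    have hterm : ∀ n ∈ Finset.Ico 1 ⌈X⌉₊, 1 ≤ (n : ℝ) ∧ 0 ≤ Real.log n ∧
        1 + Real.log n ≤ 3 * Real.log X ∧ ‖(√(n : ℝ) : ℂ) * S1 k n κ α c₁ c₂‖ ≤
        C * (9 * Real.log X ^ 2 * (n : ℝ) ^ (-(1 / 4) : ℝ) +
          (1 + Real.log n) ^ 2 * (n : ℝ) ^ (-(3 * κ / 2 + 3 * α) : ℝ)) := by
      intro n hn
      obtain ⟨hn1, hn2⟩ := Finset.mem_Ico.1 hn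
      have hnX : (n : ℝ) ≤ X := (Nat.lt_ceil.1 hn2).le
      have hn1' : (1 : ℝ) ≤ n := by exact_mod_cast hn1
      have hn0 : (0 : ℝ) < n := by linarith
      have hlogn := Real.log_nonneg hn1'
      have hl3 := one_add_log_le_three_mul hn1' hnX hX
      refine ⟨hn1', hlogn, hl3, ?_⟩
      rw [norm_mul, Complex.norm_real, Real.norm_eq_abs, abs_of_nonneg (Real.sqrt_nonneg _)]
      have e1 : √(n : ℝ) * (n : ℝ) ^ (-(3 / 4) : ℝ) = (n : ℝ) ^ (-(1 / 4) : ℝ) := by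
        rw [Real.sqrt_eq_rpow, ← Real.rpow_add hn0]
        norm_num
      have e2 : (n : ℝ) ^ (-(1 / 4) : ℝ) * (n : ℝ) ^ (1 / 4 - 3 * κ / 2 - 3 * α : ℝ) =
          (n : ℝ) ^ (-(3 * κ / 2 + 3 * α) : ℝ) := by
        rw [← Real.rpow_add hn0]
        congr 1
        ring
      calc √(n : ℝ) * ‖S1 k n κ α c₁ c₂‖ ≤ √(n : ℝ) * (C * ((n : ℝ) ^ (-(3 / 4) : ℝ) *
            (1 + Real.log n) ^ 2 * (1 + (n : ℝ) ^ (1 / 4 - 3 * κ / 2 - 3 * α : ℝ)))) := by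
            gcongr
            exact hS n hn1
        _ = C * ((1 + Real.log n) ^ 2 * (n : ℝ) ^ (-(1 / 4) : ℝ) +
            (1 + Real.log n) ^ 2 * (n : ℝ) ^ (-(3 * κ / 2 + 3 * α) : ℝ)) := by
            rw [← e2, ← e1]; ring
        _ ≤ C * ((3 * Real.log X) ^ 2 * (n : ℝ) ^ (-(1 / 4) : ℝ) +
            (1 + Real.log n) ^ 2 * (n : ℝ) ^ (-(3 * κ / 2 + 3 * α) : ℝ)) := by gcongr
        _ = _ := by ring
    -- For α ≥ 1/12 the exponent 3κ/2 + 3α is at least 1/4, so the second term is dominated by the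
    -- first. For α < 1/12 the exponent 3α/2 is below 1/8 and `sum_rpow_neg_le` applies.
    rcases le_or_gt (1 / 12) α with hα1 | hα1
    · have hb : ∀ n ∈ Finset.Ico 1 ⌈X⌉₊, ‖(√(n : ℝ) : ℂ) * S1 k n κ α c₁ c₂‖ ≤
          C * (18 * Real.log X ^ 2) * (n : ℝ) ^ (-(1 / 4) : ℝ) := by
        intro n hn
        obtain ⟨hn1, hlogn, hl3, hle⟩ := hterm n hn
        have e1 : (n : ℝ) ^ (-(3 * κ / 2 + 3 * α) : ℝ) ≤ (n : ℝ) ^ (-(1 / 4) : ℝ) :=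
          Real.rpow_le_rpow_of_exponent_le hn1 (by linarith)
        calc _ ≤ _ := hle
          _ ≤ C * (9 * Real.log X ^ 2 * (n : ℝ) ^ (-(1 / 4) : ℝ) +
              (3 * Real.log X) ^ 2 * (n : ℝ) ^ (-(1 / 4) : ℝ)) := by gcongr
          _ = _ := by ring
      refine (norm_sum_le_of_le _ hb).trans ?_
      rw [← Finset.mul_sum]
      calc C * (18 * Real.log X ^ 2) * ∑ n ∈ Finset.Ico 1 ⌈X⌉₊, (n : ℝ) ^ (-(1 / 4) : ℝ)
          ≤ C * (18 * Real.log X ^ 2) * (2 * X ^ ((3 + 2 * κ) / 4 : ℝ)) := by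
            gcongr
            linarith
        _ = C * (36 * (Real.log X ^ 2 * X ^ ((3 + 2 * κ) / 4 : ℝ))) := by ring
        _ ≤ C * ((36 + 6 * (1 + 1 / (3 * κ / 2))) * (Real.log X ^ 2 * X ^ ((3 + 2 * κ) / 4 : ℝ) +
            Real.log X * X ^ (1 - 3 * α / 2 : ℝ))) := by
            gcongr <;> linarith
        _ = _ := by ring
    · have hs2 := sum_rpow_neg_le (s := 3 * α / 2) (by linarith) hX0
      have hb : ∀ n ∈ Finset.Ico 1 ⌈X⌉₊, ‖(√(n : ℝ) : ℂ) * S1 k n κ α c₁ c₂‖ ≤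
          C * (9 * Real.log X ^ 2) * (n : ℝ) ^ (-(1 / 4) : ℝ) +
          C * (3 * Real.log X * (1 + 1 / (3 * κ / 2))) * (n : ℝ) ^ (-(3 * α / 2) : ℝ) := by
        intro n hn
        obtain ⟨hn1, hlogn, hl3, hle⟩ := hterm n hn
        have hn0 : (0 : ℝ) < n := by linarith
        -- The pointwise bound has n^{-3α}; weakening it to n^{-3α/2} already yields the asserted
        -- power X^{1-3α/2}.
        have e1 : (n : ℝ) ^ (-(3 * α) : ℝ) ≤ (n : ℝ) ^ (-(3 * α / 2) : ℝ) :=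
          Real.rpow_le_rpow_of_exponent_le hn1 (by linarith)
        have e2 := one_add_log_mul_rpow_neg_le hn1 (by positivity : 0 < 3 * κ / 2)
        have e3 : (1 + Real.log n) ^ 2 * (n : ℝ) ^ (-(3 * κ / 2 + 3 * α) : ℝ) ≤
            3 * Real.log X * (1 + 1 / (3 * κ / 2)) * (n : ℝ) ^ (-(3 * α / 2) : ℝ) := by
          rw [neg_add, Real.rpow_add hn0]
          calc _ = (1 + Real.log n) * ((1 + Real.log n) * (n : ℝ) ^ (-(3 * κ / 2) : ℝ)) *
                (n : ℝ) ^ (-(3 * α) : ℝ) := by ring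
            _ ≤ _ := by gcongr
        calc _ ≤ _ := hle
          _ ≤ C * (9 * Real.log X ^ 2 * (n : ℝ) ^ (-(1 / 4) : ℝ) +
              3 * Real.log X * (1 + 1 / (3 * κ / 2)) * (n : ℝ) ^ (-(3 * α / 2) : ℝ)) := by gcongr
          _ = _ := by ring
      refine (norm_sum_le_of_le _ hb).trans ?_
      rw [Finset.sum_add_distrib, ← Finset.mul_sum, ← Finset.mul_sum]
      calc _ ≤ C * (9 * Real.log X ^ 2) * (2 * X ^ ((3 + 2 * κ) / 4 : ℝ)) +
            C * (3 * Real.log X * (1 + 1 / (3 * κ / 2))) * (2 * X ^ (1 - 3 * α / 2 : ℝ)) := by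
            gcongr
            linarith
        _ = C * (18 * (Real.log X ^ 2 * X ^ ((3 + 2 * κ) / 4 : ℝ)) +
            6 * (1 + 1 / (3 * κ / 2)) * (Real.log X * X ^ (1 - 3 * α / 2 : ℝ))) := by ring
        _ ≤ C * ((36 + 6 * (1 + 1 / (3 * κ / 2))) * (Real.log X ^ 2 * X ^ ((3 + 2 * κ) / 4 : ℝ)) +
            (36 + 6 * (1 + 1 / (3 * κ / 2))) * (Real.log X * X ^ (1 - 3 * α / 2 : ℝ))) := by
            gcongr <;> linarith
        _ = _ := by ring
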